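/- **Setting.** Let $\mathbb N=\{1,2,\dots\}$. Fix strictly increasing sequences $(m_j)_{j\ge1}$, $(n_j)_{j\ge1}$ of positive integers with $m_1=100$, $n_1=1$ and, for all $j\in\mathbb N$, $m_{j+1}\ge j^2m_j^2$ and $n_{j+1}>\frac{4}{\log 100}\,n_j\log m_{j+1}$. *Tree.* Let $\mathcal D=\bigcup_{n\ge0}\{0,1\}^n$, ordered by $\lambda\le\mu$ iff $\lambda$ is an initial segment of $\mu$, with the metric $d(\lambda,\mu)=2^{-n}$ for $\lambda\ne\mu$, where $n$ is the largest height (length) of a common initial segment of $\lambda$ and $\mu$; let $\overline{\mathcal D}$ be its completion. The lexicographic order of $\mathcal D$ orders nodes first by height and nodes of equal height lexicographically: $\emptyset,(0),(1),(0,0),(0,1),\dots$. Let $\phi:\{\infty\}\cup\{m_j:j\in\mathbb N\}\to\mathcal D$ be the bijection with $\phi(\infty)=\emptyset$, $\phi(m_1)=(0)$, $\phi(m_2)=(1)$, $\phi(m_3)=(0,0)$, and so on in this order. *Schreier families.* For finite sets $F,G\subset\mathbb N$, $F<G$ means $\max F<\min G$. Let $\mathcal S_0=\{\{i\}:i\in\mathbb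 N\}$, $\mathcal S_1=\{F:\ |F|\le\min F\}$ (with $\emptyset\in\mathcal S_1$), and let $\mathcal S_{n+1}$, $n\ge1$, consist of $\emptyset$ and of all unions $F_1\cup\dots\cup F_d$ of nonempty $F_1<\dots<F_d$ in $\mathcal S_n$ with $d\le\min F_1$. Let $c_{00}$ be the space of finitely supported real sequences with unit vectors $e_i$ (written $e_i^*$ when used as functionals), and $\langle f,x\rangle=\sum_i f_ix_i$. Nonzero $x_1,\dots,x_d\in c_{00}$ are successive, $x_1<\dots<x_d$, if $\max\operatorname{supp}x_{i}<\min\operatorname{supp}x_{i+1}$ for all $i<d$; they are $\mathcal S_n$-admissible if moreover $\{\min\operatorname{supp}x_i\}_{i=1}^d\in\mathcal S_n$. *Norming set.* Each functional $f$ below is taken together with a fixed weight tuple $\vec w(f)=(m_{j_1},\dots,m_{j_l})$, $l\ge1$; put $w(f)=m_{j_1}\cdots m_{j_l}$ and $m(f)=\max_z m_{j_z}$; for $f=\pm e_i^*$ put $w(f)=m(f)=\infty$. Write $d(m(f),\lambda)$ for $d(\phi(m(f)),\lambda)$. Successive functionals $f_1<\dots<f_d$ ($d\ge1$) are *$(n_{j_1},\lambda)$-packed*,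 $\lambda\in\overline{\mathcal D}$, if they are $\mathcal S_{n_{j_1}}$-admissible and, for $2\le i\le d$, $w(f_i)\ge2^{\max\operatorname{supp}f_{i-1}}$ and $d(m(f_i),\lambda)\le2^{-\max\operatorname{supp}f_{i-1}}$. For $l\ge2$ they are *$(n_{j_1},\dots,n_{j_l},\lambda)$-packed* if $w(f_i)\ge2^{\max\operatorname{supp}f_{i-1}}$ for $2\le i\le d$, and there are a partition of $\{1,\dots,d\}$ into nonempty sets $F_1<\dots<F_M$ such that $(f_{\min F_k})_{k=1}^M$ is $\mathcal S_{n_{j_l}}$-admissible, and $\lambda_1,\dots,\lambda_M\in\overline{\mathcal D}$, such that each $(f_i)_{i\in F_k}$ is $(n_{j_1},\dots,n_{j_{l-1}},\lambda_k)$-packed and, for $2\le k\le M$, with $\eta_k=2^{-\max\operatorname{supp}f_{\max F_{k-1}}}$, one has $d(\lambda_k,\lambda)\le\eta_k$ and $d(m(f_i),\lambda_k)\le\eta_k$ for all $i\in F_k$. Let $W_0=\{\pm e_i^*:i\in\mathbb N\}$. Let $W_1$ be $W_0$ together with all $\frac1{m_{j_1}\cdots m_{j_l}}\sum_{i\in F}e_i^*$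 with $l\ge1$ and $\emptyset\ne F\in\mathcal S_{n_{j_1}+\dots+n_{j_l}}$. For $k\ge1$ let $W_{k+1}$ be $W_k$ together with all $\frac1{m_{j_1}\cdots m_{j_l}}\sum_{i=1}^df_i$ where $f_1<\dots<f_d$ are in $W_k$ and are $(n_{j_1},\dots,n_{j_l},\lambda)$-packed for some $\lambda\in\overline{\mathcal D}$. The new functionals have weight tuple $(m_{j_1},\dots,m_{j_l})$. Put $W=\bigcup_kW_k$, and let $X_{\mathcal D}$ be the completion of $c_{00}$ under $\|x\|=\sup\{|\langle f,x\rangle|:f\in W\}$. An infinite-dimensional block subspace of $X_{\mathcal D}$ is the closed linear span of an infinite sequence of nonzero successive vectors of $c_{00}$. A Banach space $E$ has the Lebesgue property if every Riemann integrable $f:[0,1]\to E$ is continuous at almost every point of $[0,1]$ (Lebesgue measure). **Theorem.** Let $Y$ be an infinite-dimensional block subspace of $X_{\mathcal D}$. Then there is a collection $(y_\lambda)_{\lambda\in\mathcal D}$ of norm-one vectors in $Y\cap c_{00}$ that is block in the lexicographic order of $\mathcal D$ (that is, $\max\operatorname{supp}y_\lambda<\min\operatorname{supp}y_{\lambda'}$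 whenever $\lambda$ precedes $\lambda'$ in that order) such that, for every integer $N\ge0$, all nodes $(\mu_\lambda)_{\lambda\in\{0,1\}^N}$ in $\mathcal D$ with $\mu_\lambda\ge\lambda$, and all real scalars $(a_\lambda)_{\lambda\in\{0,1\}^N}$, $$\max_{\lambda\in\{0,1\}^N}|a_\lambda|\ \le\ \Big\|\sum_{\lambda\in\{0,1\}^N}a_\lambda y_{\mu_\lambda}\Big\|\ \le\ 3\max_{\lambda\in\{0,1\}^N}|a_\lambda|.$$ Moreover, every infinite-dimensional closed subspace of $X_{\mathcal D}$ fails the Lebesgue property. -/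

import Mathlib

open scoped ENNReal NNReal

noncomputable section

namespace XDSpace

/-! ### The binary tree, its metric and its completion -/

/-- The binary tree `𝒟 = ⋃ₙ {0,1}ⁿ`: finite sequences of zeros (`false`) and ones (`true`). -/
def Node : Type := List Bool

namespace Node

/-- A sequence `λ ∈ {0,1}^N`, viewed as a node of height `N`. -/
def ofFn {N : ℕ} (l : Fin N → Bool) : Node := List.ofFn l

/-- The tree order: `a ≤ b` when `a` is an initial segment of `b`. -/
instance : LE Node := ⟨fun a b => List.IsPrefix (α := Bool) a b⟩

/-- The lexicographic enumeration order of the tree: first by height and, among nodes of the same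
height, lexicographically with `0 < 1`. -/
def LexLT (a b : Node) : Prop := List.Shortlex (α := Bool) (· < ·) a b

/-- Height of the largest common initial segment. -/
def meetHeight : List Bool → List Bool → ℕ
  | a :: s, b :: t => if a = b then meetHeight s t + 1 else 0
  | _, _ => 0

theorem meetHeight_comm : ∀ s t : List Bool, meetHeight s t = meetHeight t s
  | [], [] => rfl
  | [], _ :: _ => rfl
  | _ :: _, [] => rfl
  | a :: s, b :: t => by
    by_cases h : a = b
    · subst h; simp [meetHeight, meetHeight_comm s t]
    · simp [meetHeight, h, Ne.symm h]

theorem meetHeight_ultra : ∀ {s t u : List Bool}, s ≠ t → t ≠ u → s ≠ u →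
    min (meetHeight s t) (meetHeight t u) ≤ meetHeight s u
  | [], _, _, _, _, _ => by simp [meetHeight]
  | _ :: _, [], _, _, _, _ => by simp [meetHeight]
  | _ :: _, _ :: _, [], _, _, _ => by simp [meetHeight]
  | a :: s, b :: t, c :: u, h1, h2, h3 => by
    by_cases hab : a = b
    · by_cases hbc : b = c
      · subst hab; subst hbc
        have := meetHeight_ultra (s := s) (t := t) (u := u)
          (by simpa using h1) (by simpa using h2) (by simpa using h3)
        simp only [meetHeight, if_true]
        omega
      · simp [meetHeight, hbc]
    · simp [meetHeight, hab]

open Classical in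
/-- The metric `d(λ, μ) = 2⁻ⁿ` for `λ ≠ μ`, `n` being the maximal height of a common predecessor. -/
instance : Dist Node :=
  ⟨fun a b => if a = b then 0 else (2⁻¹ : ℝ) ^ meetHeight a b⟩

theorem dist_def (a b : Node) [Decidable (a = b)] :
    dist a b = if a = b then 0 else (2⁻¹ : ℝ) ^ meetHeight a b := by
  simp only [dist]
  congr

instance : MetricSpace Node where
  dist_self a := by classical simp [dist_def]
  dist_comm a b := by
    classical
    rw [dist_def, dist_def, meetHeight_comm a b]
    simp only [eq_comm]
  dist_triangle a b c := by
    classical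
    have hnn : ∀ x y : Node, 0 ≤ dist x y := fun x y => by
      rw [dist_def]; split_ifs <;> positivity
    by_cases h1 : a = b
    · subst h1; linarith [hnn a a]
    by_cases h2 : b = c
    · subst h2; linarith [hnn b b]
    by_cases h3 : a = c
    · have : dist a c = 0 := by rw [dist_def, if_pos h3]
      linarith [hnn a b, hnn b c]
    rw [dist_def, dist_def, dist_def, if_neg h1, if_neg h2, if_neg h3]
    have hp : ∀ n : ℕ, (0 : ℝ) ≤ 2⁻¹ ^ n := fun n => by positivity
    have key : ∀ m n : ℕ, m ≤ n → (2⁻¹ : ℝ) ^ n ≤ 2⁻¹ ^ m := fun m n h =>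
      pow_le_pow_of_le_one (by norm_num) (by norm_num) h
    rcases min_le_iff.1 (meetHeight_ultra h1 h2 h3) with h | h
    · linarith [key _ _ h, hp (meetHeight b c)]
    · linarith [key _ _ h, hp (meetHeight a b)]
  eq_of_dist_eq_zero {a b} h := by
    classical
    rw [dist_def] at h
    by_contra hne
    rw [if_neg hne] at h
    exact absurd h (by positivity)

/-- The enumeration of the tree in lexicographic order: `∅, (0), (1), (0,0), (0,1), (1,0), …`.
The two successors of the node with number `k` have the numbers `2 * k + 1` and `2 * k + 2`. -/
def enum : ℕ → List Bool
  | 0 => []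
  | j + 1 => enum (j / 2) ++ [decide (j % 2 = 1)]
decreasing_by omega

end Node

/-- The completion of the tree (with respect to its metric). -/
abbrev NodeBar : Type := UniformSpace.Completion Node

/-! ### Schreier families -/

/-- The Schreier families of finite subsets of `{1, 2, …}`. -/
def Schreier : ℕ → Finset ℕ+ → Prop
  | 0, F => ∃ i, F = {i}
  | 1, F => ∀ i ∈ F, F.card ≤ (i : ℕ)
  | n + 2, F => ∃ L : List (Finset ℕ+),
      (∀ G ∈ L, G.Nonempty ∧ Schreier (n + 1) G) ∧
      L.Pairwise (fun G H => ∀ i ∈ G, ∀ j ∈ H, i < j) ∧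
      (∀ i ∈ F, L.length ≤ (i : ℕ)) ∧
      ∀ i, i ∈ F ↔ ∃ G ∈ L, i ∈ G

/-! ### Parameters and functionals -/

/-- The pair of sequences `(m_j)`, `(n_j)`, `j = 1, 2, …`, that is fixed in the construction. -/
structure Params where
  m : ℕ+ → ℕ
  n : ℕ+ → ℕ
  m_strictMono : StrictMono m
  n_strictMono : StrictMono n
  m_one : m 1 = 100
  n_one : n 1 = 1
  m_growth : ∀ j : ℕ+, (j : ℕ) ^ 2 * m j ^ 2 ≤ m (j + 1)
  n_growth : ∀ j : ℕ+, 4 / Real.log 100 * n j * Real.log (m (j + 1)) < n (j + 1)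

/-- The support of `x` lies to the left of the support of `y`. -/
def Before (x y : ℕ+ →₀ ℝ) : Prop := ∀ i ∈ x.support, ∀ j ∈ y.support, i < j

/-- Minimum of the support (of a nonzero vector). -/
def minSupp (x : ℕ+ →₀ ℝ) : ℕ+ := if h : x.support.Nonempty then x.support.min' h else 1

/-- Maximum of the support (of a nonzero vector). -/
def maxSupp (x : ℕ+ →₀ ℝ) : ℕ := x.support.sup (fun i => (i : ℕ))

/-- A vector `vec` of `c₀₀` together with a fixed representation of its weight:
`idx = [j_l, …, j_1]` stands for the weight tuple `(m_{j_1}, …, m_{j_l})`, *listed from the last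
entry to the first*, and `idx = []` for the infinite weight of the functionals `± e_i*`. -/
structure WFun where
  vec : ℕ+ →₀ ℝ
  idx : List ℕ+

/-- The natural number `m_{j_1} ⋯ m_{j_l}`. -/
def Params.prodM (P : Params) (js : List ℕ+) : ℕ := (js.map P.m).prod

/-- The weight `w(f) = m_{j_1} ⋯ m_{j_l}`, with `w(± e_i*) = ∞`. -/
def WFun.weight (P : Params) (f : WFun) : ℕ∞ :=
  if f.idx = [] then ⊤ else (P.prodM f.idx : ℕ∞)

/-- The node `φ(m(f))`, where `m(f) = max_z m_{j_z}` (so `m(± e_i*) = ∞`), and where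
`φ : {∞, m_1, m_2, …} → 𝒟` is the bijection that sends `∞` to the root, and `m_j` to the node with
number `j` in the lexicographic enumeration. -/
def WFun.node (f : WFun) : Node := Node.enum (f.idx.foldr (fun j a => max (j : ℕ) a) 0)

/-- `d(m(f), λ)` -/
def WFun.distTo (f : WFun) (lam : NodeBar) : ℝ := dist (f.node : NodeBar) lam

/-- `f_1 < ⋯ < f_d` are successive. -/
def Successive (L : List WFun) : Prop := L.Pairwise fun f g => Before f.vec g.vec

/-- `{min supp f_i : i}` belongs to the Schreier family of order `n`. -/
def Admissible (n : ℕ) (L : List WFun) : Prop :=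
  Schreier n (L.map fun f => minSupp f.vec).toFinset

/-- `w(f_i) ≥ 2 ^ max supp f_{i-1}` for `i ≥ 2`. (For successive functionals the maxima of the
supports increase, so that all pairs may be compared instead of the neighbouring ones.) -/
def FastGrowing (P : Params) (L : List WFun) : Prop :=
  L.Pairwise fun f g => ((2 ^ maxSupp f.vec : ℕ) : ℕ∞) ≤ g.weight P

/-- Successive functionals `L = (f_1, …, f_d)` are `(n_{j_1}, …, n_{j_l}, λ)`-packed; the tuple is
listed from the last entry to the first, `[j_l, …, j_1]`, as it is consumed from the end.

In the inductive step, `B` lists the successive pieces `(f_i)_{i ∈ F_k}` of the partition together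
with their nodes `λ_k`, `k = 1, …, M`. As before, conditions that involve
`max supp f_{i-1}` or `max supp f_{max F_{k-1}}` are stated for all earlier functionals. -/
def Packed (P : Params) : List ℕ+ → NodeBar → List WFun → Prop
  | [], _, _ => False
  | [j], lam, L =>
      Admissible (P.n j) L ∧ FastGrowing P L ∧
      L.Pairwise fun f g => g.distTo lam ≤ (2⁻¹ : ℝ) ^ maxSupp f.vec
  | j :: j' :: js, lam, L =>
      FastGrowing P L ∧
      ∃ B : List (List WFun × NodeBar),
        (B.map Prod.fst).flatten = L ∧
        (∀ b ∈ B, b.1 ≠ []) ∧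
        Admissible (P.n j) (B.filterMap fun b => b.1.head?) ∧
        (∀ b ∈ B, Packed P (j' :: js) b.2 b.1) ∧
        B.Pairwise fun b c => ∀ f ∈ b.1,
          (∀ g ∈ c.1, g.distTo c.2 ≤ (2⁻¹ : ℝ) ^ maxSupp f.vec) ∧
          dist c.2 lam ≤ (2⁻¹ : ℝ) ^ maxSupp f.vec

/-- The levels `W_0 ⊆ W_1 ⊆ W_2 ⊆ …` of the norming set. -/
def Level (P : Params) : ℕ → Set WFun
  | 0 => {f | f.idx = [] ∧ ∃ i : ℕ+, f.vec = Finsupp.single i 1 ∨ f.vec = Finsupp.single i (-1)}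
  | 1 => Level P 0 ∪
      {f | f.idx ≠ [] ∧ ∃ F : Finset ℕ+, F.Nonempty ∧ Schreier (f.idx.map P.n).sum F ∧
        f.vec = (P.prodM f.idx : ℝ)⁻¹ • ∑ i ∈ F, Finsupp.single i (1 : ℝ)}
  | k + 2 => Level P (k + 1) ∪
      {f | ∃ L : List WFun, L ≠ [] ∧ (∀ g ∈ L, g ∈ Level P (k + 1)) ∧ Successive L ∧
        (∃ lam : NodeBar, Packed P f.idx lam L) ∧
        f.vec = (P.prodM f.idx : ℝ)⁻¹ • (L.map WFun.vec).sum}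

/-- The norming set `W = ⋃ₖ W_k`. -/
def NormingSet (P : Params) : Set WFun := ⋃ k, Level P k

/-! ### The norm and the space -/

theorem abs_listSum_le {L : List WFun} (hs : Successive L) (h : ∀ f ∈ L, ∀ i, |f.vec i| ≤ 1)
    (i : ℕ+) : |(L.map WFun.vec).sum i| ≤ 1 := by
  induction L with
  | nil => simp
  | cons f L ih =>
    have hs' := List.pairwise_cons.1 hs
    by_cases hi : f.vec i = 0
    · simpa [hi] using ih hs'.2 (fun g hg => h g (List.mem_cons_of_mem _ hg))
    · have hz : ∀ K : List WFun, (∀ g ∈ K, Before f.vec g.vec) →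
          (K.map WFun.vec).sum i = 0 := by
        intro K hK
        induction K with
        | nil => simp
        | cons g K ihK =>
          have h1 : g.vec i = 0 := by
            by_contra hg
            exact lt_irrefl i (hK g (by simp) i (by simpa using hi) i (by simpa using hg))
          simpa [h1] using ihK fun g' hg' => hK g' (List.mem_cons_of_mem _ hg')
      simpa [hz L hs'.1] using h f (by simp) i

theorem abs_inv_mul_le {p : ℕ} {a : ℝ} (ha : |a| ≤ 1) : |(p : ℝ)⁻¹ * a| ≤ 1 := by
  rw [abs_mul, abs_inv, Nat.abs_cast]
  exact mul_le_one₀ (Nat.cast_inv_le_one p) (abs_nonneg a) ha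

theorem abs_level_le (P : Params) : ∀ k, ∀ f ∈ Level P k, ∀ i, |f.vec i| ≤ 1
  | 0 => by
    rintro f ⟨-, j, hj | hj⟩ i <;> rw [hj, Finsupp.single_apply] <;> split_ifs <;> simp
  | 1 => by
    rintro f (hf | ⟨-, F, -, -, hF⟩) i
    · exact abs_level_le P 0 f hf i
    · rw [hF, Finsupp.smul_apply, smul_eq_mul]
      refine abs_inv_mul_le ?_
      rw [Finsupp.finsetSum_apply]
      simp only [Finsupp.single_apply, Finset.sum_ite_eq']
      split_ifs <;> simp
  | k + 2 => by
    rintro f (hf | ⟨L, -, hL, hs, -, hv⟩) i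
    · exact abs_level_le P (k + 1) f hf i
    · rw [hv, Finsupp.smul_apply, smul_eq_mul]
      exact abs_inv_mul_le
        (abs_listSum_le hs (fun g hg => abs_level_le P (k + 1) g (hL g hg)) i)

/-- The space `c₀₀` of finitely supported real sequences, to be normed by the norming set. -/
def C00 (_P : Params) : Type := ℕ+ →₀ ℝ

namespace C00

variable {P : Params}

instance : AddCommGroup (C00 P) := inferInstanceAs (AddCommGroup (ℕ+ →₀ ℝ))

instance : Module ℝ (C00 P) := inferInstanceAs (Module ℝ (ℕ+ →₀ ℝ))

/-- The underlying finitely supported sequence. -/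
def coords (x : C00 P) : ℕ+ →₀ ℝ := x

/-- The duality pairing `f(x) = ∑ i, f_i x_i`. -/
def pair (f : ℕ+ →₀ ℝ) : C00 P →ₗ[ℝ] ℝ := Finsupp.linearCombination ℝ (⇑f)

/-- `‖x‖ = sup {|f(x)| : f ∈ W}`. -/
instance : Norm (C00 P) := ⟨fun x => ⨆ f : NormingSet P, |pair f.1.vec x|⟩

theorem norm_def (x : C00 P) : ‖x‖ = ⨆ f : NormingSet P, |pair f.1.vec x| := rfl

theorem bddAbove_pair (x : C00 P) :
    BddAbove (Set.range fun f : NormingSet P => |pair f.1.vec x|) := by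
  refine ⟨∑ i ∈ x.coords.support, |x.coords i|, ?_⟩
  rintro _ ⟨⟨f, hf⟩, rfl⟩
  obtain ⟨k, hk⟩ := Set.mem_iUnion.1 hf
  change |∑ i ∈ x.coords.support, x.coords i • f.vec i| ≤ _
  refine (Finset.abs_sum_le_sum_abs _ _).trans (Finset.sum_le_sum fun i _ => ?_)
  rw [smul_eq_mul, abs_mul]
  exact mul_le_of_le_one_right (abs_nonneg _) (abs_level_le P k f hk i)

theorem abs_pair_le (x : C00 P) (f : NormingSet P) : |pair f.1.vec x| ≤ ‖x‖ :=
  le_ciSup (bddAbove_pair x) f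

theorem unit_mem (i : ℕ+) : (⟨Finsupp.single i 1, []⟩ : WFun) ∈ NormingSet P :=
  Set.mem_iUnion.2 ⟨0, rfl, i, Or.inl rfl⟩

instance : Nonempty (NormingSet P) := ⟨⟨_, unit_mem 1⟩⟩

theorem pair_single (x : C00 P) (i : ℕ+) : pair (Finsupp.single i 1) x = x.coords i := by
  change (∑ j ∈ x.coords.support, x.coords j • (Finsupp.single i (1 : ℝ)) j) = _
  simp [Finsupp.single_apply, eq_comm]

theorem normCore : NormedSpace.Core ℝ (C00 P) where
  norm_nonneg x := Real.iSup_nonneg fun _ => abs_nonneg _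
  norm_smul c x := by
    simp only [norm_def, map_smul, smul_eq_mul, abs_mul, Real.norm_eq_abs]
    exact (Real.mul_iSup_of_nonneg (abs_nonneg c) _).symm
  norm_triangle x y := by
    refine ciSup_le fun f => ?_
    rw [map_add]
    exact (abs_add_le _ _).trans (add_le_add (abs_pair_le x f) (abs_pair_le y f))
  norm_eq_zero_iff x := by
    constructor
    · intro h
      have : x.coords = 0 := by
        ext i
        have := abs_pair_le x ⟨_, unit_mem i⟩
        rw [h, pair_single] at this
        simpa using this
      exact this
    · rintro rfl
      simp [norm_def]

instance : NormedAddCommGroup (C00 P) := NormedAddCommGroup.ofCore normCore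

instance : NormedSpace ℝ (C00 P) := NormedSpace.ofCore normCore

end C00

/-- The Banach space `X_𝒟`: the completion of `c₀₀`. -/
abbrev XD (P : Params) : Type := UniformSpace.Completion (C00 P)

/-- An infinite-dimensional block subspace: the closed linear span of an infinite sequence of
nonzero successive vectors of `c₀₀`. -/
def IsBlockSubspace {P : Params} (Y : Submodule ℝ (XD P)) : Prop :=
  ∃ x : ℕ → C00 P, (∀ r, x r ≠ 0) ∧ (∀ r, Before (x r).coords (x (r + 1)).coords) ∧
    Y = (Submodule.span ℝ (Set.range fun r => (x r : XD P))).topologicalClosure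

/-! ### The Lebesgue property -/

/-- The unit interval as a one-dimensional box. -/
def unitBox : BoxIntegral.Box (Fin 1) where
  lower := fun _ => 0
  upper := fun _ => 1
  lower_lt_upper := fun _ => zero_lt_one

/-- Riemann integrability of `f : [0,1] → E` (the values of `f` outside `[0,1]` play no role). -/
def RiemannIntegrable {E : Type*} [NormedAddCommGroup E] [NormedSpace ℝ E] (f : ℝ → E) : Prop :=
  BoxIntegral.Integrable unitBox BoxIntegral.IntegrationParams.Riemann (fun t => f (t 0))
    (BoxIntegral.BoxAdditiveMap.volume (E := E))

/-- The Lebesgue property: every Riemann integrable `f : [0,1] → E` is continuous at almost every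
point of `[0,1]`. -/
def LebesgueProperty (E : Type*) [NormedAddCommGroup E] [NormedSpace ℝ E] : Prop :=
  ∀ f : ℝ → E, RiemannIntegrable f →
    ∀ᵐ t ∂(MeasureTheory.volume.restrict (Set.Icc (0 : ℝ) 1)),
      ContinuousWithinAt f (Set.Icc (0 : ℝ) 1) t

end XDSpace

end

open XDSpace

/-! The upper estimate rests on exact vectors. Such a vector is normalized and tied to an index `j`;
a functional acts on it substantially only if `j` is the largest index of the functional itself or
of one of the functionals that it averages. Exact vectors exist in every block subspace, for all
large `j` and arbitrarily far out. So `y_λ` can be given an index whose node extends `λ`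
(`exists_isExactTree`).

Let `v = ∑ a_λ y_{μ_λ}`, where `λ` runs through the sequences of length `N` and `|a_λ| ≤ M`. Cut a
functional of finite weight at position `N + 10`. The part on the left does not meet `v`, and the
piece at the cut costs at most `‖v‖ / 100`, because every `m_j` is at least 100. The remaining
constituents have large weights and nodes near one point of the completed tree, so these nodes have
the same first `N` entries and match at most one `λ`; the index of the functional itself matches at
most one more. Two terms cost `2M` and all others together `M / 10`, whence `‖v‖ ≤ ‖v‖ / 100 + 2.1
M`. The lower estimate holds because nonzero restrictions of members of the norming set are members,
so that coordinate projections are contractive.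

Exact vectors are built in three stages. (1) A normalized block sequence has, up to signs, a
subsequence with lower `ℓ₁` estimates with constant `0.98 / m_j` on sets of order `n_j`
(`exists_lowerEst`). If the weights of near-norming functionals are unbounded, compactness of the
completed tree makes some of them packed. If the weights are bounded, one weight tuple may be fixed,
and prefixing `j` to it merges the functionals into one of a longer tuple; this is the role of
weight tuples. (2) Iterated special convex combinations yield a rapidly increasing sequence
(`exists_isRIS`): were all normalized combinations bad, each step would gain a factor 100 in the
coefficient sum while keeping the norm at most one, against the lower estimate for the next index.
(3) A normalized special convex combination of order `n_j` of such a sequence is exact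
(`exists_isExact`). Functionals of large weight act weakly on it, and those of small weight whose
largest index is not `j` have order below `n_j`, hence act through essentially one of their
constituents.

For the Lebesgue property, a gliding hump puts a copy of a block sequence into a given
infinite-dimensional subspace, and with it a tree bounded away from zero that satisfies the upper
`c₀` estimate. The function that takes the tree's values at the centres of the dyadic intervals, and
zero elsewhere, is nowhere continuous on the unit interval. It is Riemann integrable with integral
zero: nodes with a common initial segment of length `N` receive total mass of order `2⁻ᴺ` in a fine
Riemann sum, and the `c₀` estimate replaces the sum over the segments by a maximum. -/

namespace XDSpace

/-! ### Combinatorics of the Schreier families -/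

namespace Schreier

/-- Empty pieces can be discarded without lengthening the list. Decompositions that arise by
filtering therefore need no check of nonemptiness. -/
theorem of_list {n : ℕ} {F : Finset ℕ+} (L : List (Finset ℕ+))
    (h1 : ∀ G ∈ L, Schreier (n + 1) G)
    (h2 : L.Pairwise fun G H => ∀ i ∈ G, ∀ j ∈ H, i < j)
    (h3 : ∀ i ∈ F, L.length ≤ (i : ℕ)) (h4 : ∀ i, i ∈ F ↔ ∃ G ∈ L, i ∈ G) :
    Schreier (n + 2) F := by
  classical
  refine ⟨L.filter (fun G => G.Nonempty), ?_, h2.filter _, ?_, ?_⟩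
  · intro G hG
    rw [List.mem_filter] at hG
    exact ⟨by simpa using hG.2, h1 G hG.1⟩
  · exact fun i hi => (List.length_filter_le _ _).trans (h3 i hi)
  · intro i
    rw [h4]
    constructor
    · rintro ⟨G, hG, hi⟩
      exact ⟨G, List.mem_filter.2 ⟨hG, by simpa using ⟨i, hi⟩⟩, hi⟩
    · rintro ⟨G, hG, hi⟩
      exact ⟨G, (List.mem_filter.1 hG).1, hi⟩

/-- Heredity and spreading are joined in one statement so that a single induction proves both: the
pieces of `F` are pulled back along `s`, and in order one `s` is injective and the cardinality bound
only gets weaker. Order zero is excluded because that family does not contain the empty set. -/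
theorem spread_fun : ∀ {n : ℕ}, 1 ≤ n → ∀ {F G : Finset ℕ+}, Schreier n F → ∀ s : ℕ+ → ℕ+,
    (∀ g ∈ G, s g ∈ F ∧ s g ≤ g) → (∀ g ∈ G, ∀ g' ∈ G, g < g' → s g < s g') → Schreier n G
  | 0, h, _, _, _, _, _, _ => absurd h (by norm_num)
  | 1, _, F, G, hF, s, h1, h2 => by
    intro i hi
    have hc : G.card ≤ F.card := by
      refine Finset.card_le_card_of_injOn s (fun g hg => (h1 g hg).1) ?_
      intro a ha b hb hab
      rcases lt_trichotomy a b with h | h | h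
      · exact absurd hab (h2 a ha b hb h).ne
      · exact h
      · exact absurd hab (h2 b hb a ha h).ne'
    exact (hc.trans (hF _ (h1 i hi).1)).trans (by exact_mod_cast (h1 i hi).2)
  | n + 2, _, F, G, hF, s, h1, h2 => by
    classical
    obtain ⟨L, hL1, hL2, hL3, hL4⟩ := hF
    refine of_list (L.map fun H => G.filter fun g => s g ∈ H) ?_ ?_ ?_ ?_
    · intro G' hG'
      obtain ⟨H, hH, rfl⟩ := List.mem_map.1 hG'
      refine spread_fun (by omega) (hL1 H hH).2 s ?_ ?_
      · intro g hg
        rw [Finset.mem_filter] at hg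
        exact ⟨hg.2, (h1 g hg.1).2⟩
      · intro g hg g' hg'
        exact h2 g (Finset.mem_filter.1 hg).1 g' (Finset.mem_filter.1 hg').1
    · rw [List.pairwise_map]
      refine hL2.imp ?_
      intro H H' hHH i hi j hj
      rw [Finset.mem_filter] at hi hj
      by_contra hlt
      rcases (not_lt.1 hlt).lt_or_eq with h | h
      · exact absurd (h2 j hj.1 i hi.1 h) (not_lt.2 (hHH _ hi.2 _ hj.2).le)
      · subst h
        exact lt_irrefl _ (hHH _ hi.2 _ hj.2)
    · intro i hi
      rw [List.length_map]
      exact (hL3 _ (h1 i hi).1).trans (by exact_mod_cast (h1 i hi).2)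
    · intro i
      constructor
      · intro hi
        obtain ⟨H, hH, hs⟩ := (hL4 _).1 (h1 i hi).1
        exact ⟨_, List.mem_map.2 ⟨H, hH, rfl⟩, Finset.mem_filter.2 ⟨hi, hs⟩⟩
      · rintro ⟨G', hG', hi⟩
        obtain ⟨H, hH, rfl⟩ := List.mem_map.1 hG'
        exact (Finset.mem_filter.1 hi).1

/-- The Schreier families are hereditary and spreading. -/
theorem spread {n : ℕ} (hn : 1 ≤ n) {F G : Finset ℕ+} (hF : Schreier n F) (r : ℕ+ → ℕ+ → Prop)
    (h1 : ∀ g ∈ G, ∃ a ∈ F, a ≤ g ∧ r a g)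
    (h2 : ∀ a g a' g', r a g → r a' g' → g < g' → a < a') : Schreier n G := by
  classical
  choose! s hs using h1
  exact spread_fun hn hF s (fun g hg => ⟨(hs g hg).1, (hs g hg).2.1⟩)
    fun g hg g' hg' h => h2 _ _ _ _ (hs g hg).2.2 (hs g' hg').2.2 h

theorem subset {n : ℕ} (hn : 1 ≤ n) {F G : Finset ℕ+} (hF : Schreier n F) (h : G ⊆ F) :
    Schreier n G :=
  spread_fun hn hF id (fun _ hg => ⟨h hg, le_rfl⟩) fun _ _ _ _ h => h

theorem succ {n : ℕ} (hn : 1 ≤ n) {F : Finset ℕ+} (hF : Schreier n F) : Schreier (n + 1) F := by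
  obtain ⟨m, rfl⟩ : ∃ m, n = m + 1 := ⟨n - 1, by omega⟩
  refine of_list [F] (by simpa using hF) (by simp) ?_ (by simp)
  intro i _
  exact i.pos

theorem mono {p q : ℕ} (hp : 1 ≤ p) (hpq : p ≤ q) {F : Finset ℕ+} (hF : Schreier p F) :
    Schreier q F := by
  induction q, hpq using Nat.le_induction with
  | base => exact hF
  | succ q hq ih => exact succ (hp.trans hq) ih

theorem singleton {n : ℕ} (hn : 1 ≤ n) (i : ℕ+) : Schreier n {i} :=
  mono le_rfl hn (fun j _ => by rw [Finset.card_singleton]; exact j.pos)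

/-- A union of members of the family of order `p` whose minima (or smaller numbers) form a member of
the family of order `q` is a member of the family of order `p + q`. -/
theorem conv {p : ℕ} (hp : 1 ≤ p) : ∀ {q : ℕ}, 1 ≤ q → ∀ {F R : Finset ℕ+} (s : ℕ+ → ℕ+),
    (∀ i ∈ F, s i ≤ i ∧ s i ∈ R) → (∀ i ∈ F, ∀ j ∈ F, i ≤ j → s i ≤ s j) →
    (∀ r ∈ R, Schreier p (F.filter fun i => s i = r)) → Schreier q R → Schreier (p + q) F
  | 0, h, _, _, _, _, _, _, _ => absurd h (by norm_num)
  | 1, _, F, R, s, h1, h2, h3, h4 => by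
    classical
    obtain ⟨m, rfl⟩ : ∃ m, p = m + 1 := ⟨p - 1, by omega⟩
    refine of_list ((R.sort (· ≤ ·)).map fun r => F.filter fun i => s i = r) ?_ ?_ ?_ ?_
    · intro G hG
      obtain ⟨r, hr, rfl⟩ := List.mem_map.1 hG
      exact h3 r (by simpa using hr)
    · rw [List.pairwise_map]
      refine (Finset.sortedLT_sort R).pairwise.imp ?_
      intro r r' hr i hi j hj
      rw [Finset.mem_filter] at hi hj
      by_contra hlt
      have := h2 j hj.1 i hi.1 (not_lt.1 hlt)
      rw [hi.2, hj.2] at this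
      exact absurd hr (not_lt.2 this)
    · intro i hi
      rw [List.length_map, Finset.length_sort]
      exact (h4 _ (h1 i hi).2).trans (by exact_mod_cast (h1 i hi).1)
    · intro i
      constructor
      · intro hi
        exact ⟨_, List.mem_map.2 ⟨s i, by simpa using (h1 i hi).2, rfl⟩,
          Finset.mem_filter.2 ⟨hi, rfl⟩⟩
      · rintro ⟨G, hG, hi⟩
        obtain ⟨r, hr, rfl⟩ := List.mem_map.1 hG
        exact (Finset.mem_filter.1 hi).1
  | q + 2, _, F, R, s, h1, h2, h3, h4 => by
    classical
    obtain ⟨L, hL1, hL2, hL3, hL4⟩ := h4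
    rw [show p + (q + 2) = (p + q) + 2 by ring]
    refine of_list (L.map fun H => F.filter fun i => s i ∈ H) ?_ ?_ ?_ ?_
    · intro G hG
      obtain ⟨H, hH, rfl⟩ := List.mem_map.1 hG
      rw [show p + q + 1 = p + (q + 1) by ring]
      refine conv hp (by omega) (R := H) s ?_ ?_ ?_ (hL1 H hH).2
      · intro i hi
        rw [Finset.mem_filter] at hi
        exact ⟨(h1 i hi.1).1, hi.2⟩
      · intro i hi j hj
        exact h2 i (Finset.mem_filter.1 hi).1 j (Finset.mem_filter.1 hj).1
      · intro r hr
        refine subset hp (h3 r ((hL4 r).2 ⟨H, hH, hr⟩)) ?_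
        exact Finset.filter_subset_filter _ (Finset.filter_subset _ _)
    · rw [List.pairwise_map]
      refine hL2.imp ?_
      intro H H' hHH i hi j hj
      rw [Finset.mem_filter] at hi hj
      by_contra hlt
      exact absurd (h2 j hj.1 i hi.1 (not_lt.1 hlt)) (not_le.2 (hHH _ hi.2 _ hj.2))
    · intro i hi
      rw [List.length_map]
      exact (hL3 _ (h1 i hi).2).trans (by exact_mod_cast (h1 i hi).1)
    · intro i
      constructor
      · intro hi
        obtain ⟨H, hH, hs⟩ := (hL4 _).1 (h1 i hi).2
        exact ⟨_, List.mem_map.2 ⟨H, hH, rfl⟩, Finset.mem_filter.2 ⟨hi, hs⟩⟩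
      · rintro ⟨G', hG', hi⟩
        obtain ⟨H, hH, rfl⟩ := List.mem_map.1 hG'
        exact (Finset.mem_filter.1 hi).1

end Schreier

/-! ### Recursive choices and special convex combinations -/

/-- Recursive construction of a sequence in which each term depends on its index and on a bound
that is computed from the previous term. -/
theorem exists_seq_of_step {α : Type*} (Q : ℕ → ℕ → α → Prop) (bd : ℕ → α → ℕ) (T : ℕ)
    (h : ∀ n T, ∃ a, Q n T a) :
    ∃ s : ℕ → α, Q 0 T (s 0) ∧ ∀ n, Q (n + 1) (bd n (s n)) (s (n + 1)) := by
  choose g hg using h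
  let s : ℕ → α := fun n => Nat.rec (g 0 T) (fun n a => g (n + 1) (bd n a)) n
  exact ⟨s, hg 0 T, fun n => hg (n + 1) _⟩

/-- A subsequence along which a relation that holds eventually in the second variable holds for all
pairs of terms. -/
theorem exists_strictMono_of_eventually (R : ℕ → ℕ → Prop)
    (h : ∀ r, ∀ᶠ r' in Filter.atTop, R r r') :
    ∃ φ : ℕ → ℕ, StrictMono φ ∧ ∀ i k, i < k → R (φ i) (φ k) := by
  have h' : ∀ T, ∃ N, ∀ n ≥ N, ∀ r ≤ T, R r n := by
    intro T
    have : ∀ᶠ n in Filter.atTop, ∀ r ∈ Finset.range (T + 1), R r n :=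
      (Filter.eventually_all_finset _).2 fun r _ => h r
    obtain ⟨N, hN⟩ := Filter.eventually_atTop.1 this
    exact ⟨N, fun n hn r hr => hN n hn r (Finset.mem_range.2 (by omega))⟩
  obtain ⟨φ, -, hφ⟩ := exists_seq_of_step (fun _ T n => T < n ∧ ∀ r ≤ T, R r n) (fun _ n => n) 0 (by
    intro _ T
    obtain ⟨N, hN⟩ := h' T
    exact ⟨max N (T + 1), lt_of_lt_of_le (Nat.lt_succ_self T) (le_max_right _ _),
      hN _ (le_max_left _ _)⟩)
  have hm : StrictMono φ := strictMono_nat_of_lt_succ fun n => (hφ n).1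
  refine ⟨φ, hm, fun i k hik => ?_⟩
  obtain ⟨k, rfl⟩ : ∃ m, k = m + 1 := ⟨k - 1, by omega⟩
  exact (hφ k).2 _ (hm.monotone (by omega))

/-- `c` is a probability on the finite set `K` of indices, `K` is placed (by `lo`) on a set of the
Schreier family of order `n`, and sets that are placed (by `hi`) on members of families of smaller
order have small measure. -/
structure IsSCC (lo hi : ℕ → ℕ+) (n : ℕ) (ε : ℝ) (K : Finset ℕ) (c : ℕ → ℝ) : Prop where
  nonneg : ∀ k, 0 ≤ c k
  sum_eq : ∑ k ∈ K, c k = 1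
  schreier : Schreier n (K.image lo)
  le : ∀ k ∈ K, c k ≤ ε
  small : ∀ p, 1 ≤ p → p < n → ∀ G ⊆ K, Schreier p (G.image hi) → ∑ k ∈ G, c k ≤ ε

/-- A uniform average over `a > 1 / ε` consecutive indices. Starting beyond `a` makes the set of
positions a Schreier set; smallness on lower orders is vacuous. -/
theorem exists_isSCC_one {lo hi : ℕ → ℕ+} (hlo : StrictMono lo) {ε : ℝ} (hε : 0 < ε) (N : ℕ) :
    ∃ (K : Finset ℕ) (c : ℕ → ℝ), (∀ k ∈ K, N ≤ k) ∧ IsSCC lo hi 1 ε K c := by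
  obtain ⟨a, ha⟩ := exists_nat_gt (1 / ε)
  have ha0 : (0 : ℝ) < a := lt_trans (by positivity) ha
  have hlo' : ∀ k, k ≤ (lo k : ℕ) := fun k => by
    have : StrictMono fun k => (lo k : ℕ) := fun i j h => by exact_mod_cast hlo h
    exact this.le_apply
  refine ⟨Finset.Ico (N + a) (N + a + a), fun _ => (a : ℝ)⁻¹, ?_, ?_, ?_, ?_, ?_, ?_⟩
  · intro k hk
    rw [Finset.mem_Ico] at hk
    omega
  · intro k
    positivity
  · rw [Finset.sum_const, Nat.card_Ico]
    simp [ha0.ne']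
  · intro i hi
    obtain ⟨k, hk, rfl⟩ := Finset.mem_image.1 hi
    refine Finset.card_image_le.trans ?_
    rw [Nat.card_Ico]
    rw [Finset.mem_Ico] at hk
    have := hlo' k
    omega
  · intro k _
    rw [inv_le_comm₀ ha0 hε, ← one_div]
    exact ha.le
  · intro p h1 h2
    omega

theorem sum_filter_mem_list_le {c : ℕ → ℝ} (hc : ∀ k, 0 ≤ c k) (hi : ℕ → ℕ+) {ε : ℝ}
    (L : List (Finset ℕ+)) (G : Finset ℕ)
    (hL : ∀ H ∈ L, ∑ k ∈ G.filter (fun k => hi k ∈ H), c k ≤ ε) :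
    ∑ k ∈ G.filter (fun k => ∃ H ∈ L, hi k ∈ H), c k ≤ L.length * ε := by
  classical
  induction L with
  | nil => simp
  | cons H L ih =>
    have h1 : G.filter (fun k => ∃ H' ∈ H :: L, hi k ∈ H') ⊆
        G.filter (fun k => hi k ∈ H) ∪ G.filter (fun k => ∃ H' ∈ L, hi k ∈ H') := by
      intro k
      simp only [Finset.mem_filter, Finset.mem_union, List.mem_cons, exists_eq_or_imp]
      tauto
    have h2 := Finset.sum_le_sum_of_subset_of_nonneg (f := c) h1 (fun k _ _ => hc k)
    have h3 : ∑ k ∈ G.filter (fun k => hi k ∈ H) ∪ G.filter (fun k => ∃ H' ∈ L, hi k ∈ H'), c k ≤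
        ∑ k ∈ G.filter (fun k => hi k ∈ H), c k +
          ∑ k ∈ G.filter (fun k => ∃ H' ∈ L, hi k ∈ H'), c k := by
      rw [← Finset.sum_union_inter]
      exact le_add_of_nonneg_right (Finset.sum_nonneg fun k _ => hc k)
    have h4 := hL H (by simp)
    have h5 := ih fun H' hH' => hL H' (List.mem_cons_of_mem _ hH')
    rw [List.length_cons]
    push_cast
    linarith

/-- A set of the critical order `n` need not have small mass. It splits, however, into at most `hi
g` pieces of order `n - 1` (single points if `n = 1`), each of mass at most `ε`. The factor `hi g`
can be compensated in advance by combinations placed further out. -/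
theorem IsSCC.mass_le {lo hi : ℕ → ℕ+} (hinj : Function.Injective hi) {n : ℕ} {ε : ℝ}
    {K : Finset ℕ} {c : ℕ → ℝ} (h : IsSCC lo hi n ε K c) (hn : 1 ≤ n) (hε : 0 ≤ ε) {G : Finset ℕ}
    (hG : Schreier n (G.image hi)) {g : ℕ} (hg : g ∈ G) :
    ∑ k ∈ G ∩ K, c k ≤ (hi g : ℕ) * ε := by
  classical
  have hgi : hi g ∈ G.image hi := Finset.mem_image_of_mem _ hg
  match n, hn, h, hG with
  | 1, _, h, hG =>
    have h1 : ∑ k ∈ G ∩ K, c k ≤ (G ∩ K).card • ε :=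
      Finset.sum_le_card_nsmul _ _ _ fun k hk => h.le k (Finset.mem_inter.1 hk).2
    have h2 : (G ∩ K).card ≤ (hi g : ℕ) := by
      refine (Finset.card_le_card Finset.inter_subset_left).trans ?_
      rw [← Finset.card_image_of_injective G hinj]
      exact hG _ hgi
    rw [nsmul_eq_mul] at h1
    refine h1.trans (mul_le_mul_of_nonneg_right (by exact_mod_cast h2) hε)
  | m + 2, _, h, hG =>
    obtain ⟨L, hL1, -, hL3, hL4⟩ := hG
    have h1 := sum_filter_mem_list_le h.nonneg hi (ε := ε) L (G ∩ K) (by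
      intro H hH
      refine h.small (m + 1) (by omega) (by omega) _
        ((Finset.filter_subset _ _).trans Finset.inter_subset_right) ?_
      refine Schreier.subset (by omega) (hL1 H hH).2 ?_
      intro i hi'
      obtain ⟨k, hk, rfl⟩ := Finset.mem_image.1 hi'
      exact (Finset.mem_filter.1 hk).2)
    rw [Finset.filter_true_of_mem] at h1
    · refine h1.trans (mul_le_mul_of_nonneg_right ?_ hε)
      exact_mod_cast hL3 _ hgi
    · intro k hk
      exact (hL4 _).1 (Finset.mem_image_of_mem _ (Finset.mem_inter.1 hk).1)

theorem exists_isSCC_succ {lo hi : ℕ → ℕ+} (h1 : ∀ k, lo k ≤ hi k) (h2 : ∀ k, hi k < lo (k + 1))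
    {n : ℕ} (hn : 1 ≤ n)
    (ih : ∀ ε : ℝ, 0 < ε → ∀ N : ℕ, ∃ (K : Finset ℕ) (c : ℕ → ℝ),
      (∀ k ∈ K, N ≤ k) ∧ IsSCC lo hi n ε K c) {ε : ℝ} (hε : 0 < ε) (N : ℕ) :
    ∃ (K : Finset ℕ) (c : ℕ → ℝ), (∀ k ∈ K, N ≤ k) ∧ IsSCC lo hi (n + 1) ε K c := by
  classical
  have hlo : StrictMono lo := strictMono_nat_of_lt_succ fun k => (h1 k).trans_lt (h2 k)
  have hhi : StrictMono hi := strictMono_nat_of_lt_succ fun k => (h2 k).trans_le (h1 _)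
  have hlo' : ∀ k, k ≤ (lo k : ℕ) := fun k => by
    have : StrictMono fun k => (lo k : ℕ) := fun i j h => by exact_mod_cast hlo h
    exact this.le_apply
  -- The new combination is the average of `a` successive ones of order `n`, the `b`-th of precision
  -- `1 / (a · hi (T b))`, where `T b` exceeds all earlier indices. A set of order at most `n` has
  -- mass at most one in the first block that it meets and at most `1 / a` in each later one. This
  -- gives at most 2 in total, and averaging leaves `2 / a < ε`.
  obtain ⟨a, ha⟩ := exists_nat_gt (2 / ε)
  have ha0 : (0 : ℝ) < a := lt_trans (by positivity) ha
  have hhi0 : ∀ k, (0 : ℝ) < ((hi k : ℕ) : ℝ) := fun k => by exact_mod_cast (hi k).pos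
  obtain ⟨s, hs0, hs⟩ := exists_seq_of_step
    (fun _ T (x : Finset ℕ × (ℕ → ℝ)) => (∀ k ∈ x.1, T ≤ k) ∧
      IsSCC lo hi n (1 / (a * ((hi T : ℕ) : ℝ))) x.1 x.2)
    (fun _ x => x.1.sup id + 1) (N + a) (by
      intro _ T
      obtain ⟨K, c, hK⟩ := ih (1 / (a * ((hi T : ℕ) : ℝ)))
        (one_div_pos.2 (mul_pos ha0 (hhi0 T))) T
      exact ⟨(K, c), hK⟩)
  let T : ℕ → ℕ := fun b => Nat.casesOn b (N + a) fun b => (s b).1.sup id + 1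
  have hT : ∀ b, (∀ k ∈ (s b).1, T b ≤ k) ∧
      IsSCC lo hi n (1 / (a * ((hi (T b) : ℕ) : ℝ))) (s b).1 (s b).2 := by
    intro b
    cases b with
    | zero => exact hs0
    | succ b => exact hs b
  have hT' : ∀ b, ∀ k ∈ (s b).1, k < T (b + 1) := fun b k hk =>
    Nat.lt_succ_of_le (Finset.le_sup (f := id) hk)
  have hne : ∀ b, (s b).1.Nonempty := by
    intro b
    rw [Finset.nonempty_iff_ne_empty]
    intro h0
    have := (hT b).2.sum_eq
    rw [h0] at this
    simp at this
  have hTm : StrictMono T := strictMono_nat_of_lt_succ fun b => by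
    obtain ⟨k, hk⟩ := hne b
    exact ((hT b).1 k hk).trans_lt (hT' b k hk)
  have hsep : ∀ b b', b < b' → ∀ k ∈ (s b).1, ∀ k' ∈ (s b').1, k < k' := by
    intro b b' hb k hk k' hk'
    exact (hT' b k hk).trans_le ((hTm.monotone hb).trans ((hT b').1 k' hk'))
  let c : ℕ → ℝ := fun k => (a : ℝ)⁻¹ * ∑ b ∈ Finset.range a, if k ∈ (s b).1 then (s b).2 k else 0
  have hc0 : ∀ k, 0 ≤ c k := fun k => mul_nonneg (by positivity)
    (Finset.sum_nonneg fun b _ => by split_ifs <;> simp [(hT b).2.nonneg k])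
  have hsum : ∀ G : Finset ℕ, ∑ k ∈ G, c k =
      (a : ℝ)⁻¹ * ∑ b ∈ Finset.range a, ∑ k ∈ G ∩ (s b).1, (s b).2 k := by
    intro G
    simp only [c]
    rw [← Finset.mul_sum, Finset.sum_comm]
    simp only [Finset.sum_ite_mem]
  let K : Finset ℕ := (Finset.range a).biUnion fun b => (s b).1
  have hKN : ∀ k ∈ K, N + a ≤ k := by
    intro k hk
    obtain ⟨b, -, hk⟩ := Finset.mem_biUnion.1 hk
    exact (hTm.monotone (Nat.zero_le b)).trans ((hT b).1 k hk)
  have hsmall : ∀ p, 1 ≤ p → p < n + 1 → ∀ G ⊆ K, Schreier p (G.image hi) → ∑ k ∈ G, c k ≤ ε := by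
    intro p hp hpn G hGK hG
    have hG' : Schreier n (G.image hi) := Schreier.mono hp (by omega) hG
    rcases G.eq_empty_or_nonempty with rfl | hGne
    · simpa using hε.le
    have hex : ∃ b, (G ∩ (s b).1).Nonempty := by
      obtain ⟨g, hg⟩ := hGne
      obtain ⟨b, -, hb⟩ := Finset.mem_biUnion.1 (hGK hg)
      exact ⟨b, g, Finset.mem_inter.2 ⟨hg, hb⟩⟩
    let b0 := Nat.find hex
    obtain ⟨g, hg⟩ := Nat.find_spec hex
    rw [Finset.mem_inter] at hg
    have hb : ∀ b ∈ Finset.range a, ∑ k ∈ G ∩ (s b).1, (s b).2 k ≤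
        (if b = b0 then 1 else 0) + 1 / (a : ℝ) := by
      intro b _
      have hpos : 0 < 1 / (a : ℝ) := by positivity
      rcases lt_trichotomy b b0 with h | h | h
      · have := Nat.find_min hex h
        rw [Finset.not_nonempty_iff_eq_empty] at this
        rw [this, if_neg h.ne]
        simp
      · rw [if_pos h]
        have : ∑ k ∈ G ∩ (s b).1, (s b).2 k ≤ 1 := by
          rw [← (hT b).2.sum_eq]
          exact Finset.sum_le_sum_of_subset_of_nonneg Finset.inter_subset_right
            fun k _ _ => (hT b).2.nonneg k
        linarith
      · rw [if_neg h.ne', zero_add]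
        have hle := (hT b).2.mass_le hhi.injective hn
          (one_div_nonneg.2 (mul_pos ha0 (hhi0 _)).le) hG' hg.1
        refine hle.trans ?_
        have hgT : (((hi g : ℕ+) : ℕ) : ℝ) ≤ ((hi (T b) : ℕ) : ℝ) := by
          have h3 : g ≤ T b := (hT' b0 g hg.2).le.trans (hTm.monotone h)
          exact_mod_cast hhi.monotone h3
        rw [mul_one_div, div_le_div_iff₀ (mul_pos ha0 (hhi0 _)) ha0, one_mul]
        calc (((hi g : ℕ+) : ℕ) : ℝ) * a ≤ ((hi (T b) : ℕ) : ℝ) * a :=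
              mul_le_mul_of_nonneg_right hgT ha0.le
          _ = a * ((hi (T b) : ℕ) : ℝ) := mul_comm _ _
    rw [hsum]
    have h3 := Finset.sum_le_sum hb
    rw [Finset.sum_add_distrib, Finset.sum_const, Finset.card_range, nsmul_eq_mul,
      mul_one_div_cancel ha0.ne', Finset.sum_ite_eq'] at h3
    have h4 : ∑ b ∈ Finset.range a, ∑ k ∈ G ∩ (s b).1, (s b).2 k ≤ 2 := by
      refine h3.trans ?_
      split_ifs <;> norm_num
    calc (a : ℝ)⁻¹ * _ ≤ (a : ℝ)⁻¹ * 2 := mul_le_mul_of_nonneg_left h4 (by positivity)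
      _ ≤ ε := by
        rw [inv_mul_le_iff₀ ha0]
        rw [div_lt_iff₀ hε] at ha
        exact ha.le
  -- The bound for single coefficients is the bound `hsmall` for singletons, which are sets of order
  -- one.
  refine ⟨K, c, fun k hk => (Nat.le_add_right _ _).trans (hKN k hk), hc0, ?_, ?_, ?_, hsmall⟩
  · rw [hsum]
    have : ∀ b ∈ Finset.range a, ∑ k ∈ K ∩ (s b).1, (s b).2 k = 1 := by
      intro b hb
      rw [Finset.inter_eq_right.2 (Finset.subset_biUnion_of_mem (fun b => (s b).1) hb)]
      exact (hT b).2.sum_eq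
    rw [Finset.sum_congr rfl this]
    simp [ha0.ne']
  · obtain ⟨m, rfl⟩ : ∃ m, n = m + 1 := ⟨n - 1, by omega⟩
    refine Schreier.of_list ((List.range a).map fun b => (s b).1.image lo) ?_ ?_ ?_ ?_
    · intro G hG
      obtain ⟨b, -, rfl⟩ := List.mem_map.1 hG
      exact (hT b).2.schreier
    · rw [List.pairwise_map]
      refine List.pairwise_lt_range.imp ?_
      intro b b' hb i hi j hj
      obtain ⟨k, hk, rfl⟩ := Finset.mem_image.1 hi
      obtain ⟨k', hk', rfl⟩ := Finset.mem_image.1 hj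
      exact hlo (hsep b b' hb k hk k' hk')
    · intro i hi
      obtain ⟨k, hk, rfl⟩ := Finset.mem_image.1 hi
      rw [List.length_map, List.length_range]
      exact (Nat.le_add_left _ _).trans ((hKN k hk).trans (hlo' k))
    · intro i
      simp only [K, Finset.mem_image, Finset.mem_biUnion, Finset.mem_range, List.mem_map,
        List.mem_range]
      constructor
      · rintro ⟨k, ⟨b, hb, hk⟩, rfl⟩
        exact ⟨_, ⟨b, hb, rfl⟩, Finset.mem_image_of_mem _ hk⟩
      · rintro ⟨G, ⟨b, hb, rfl⟩, hi⟩
        obtain ⟨k, hk, rfl⟩ := Finset.mem_image.1 hi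
        exact ⟨k, ⟨b, hb, hk⟩, rfl⟩
  · intro k hk
    have := hsmall 1 le_rfl (by omega) {k} (by simpa using hk)
      (by rw [Finset.image_singleton]; exact Schreier.singleton le_rfl _)
    simpa using this

/-- Existence of special convex combinations. -/
theorem exists_isSCC {lo hi : ℕ → ℕ+} (h1 : ∀ k, lo k ≤ hi k) (h2 : ∀ k, hi k < lo (k + 1))
    {n : ℕ} (hn : 1 ≤ n) : ∀ ε : ℝ, 0 < ε → ∀ N : ℕ,
    ∃ (K : Finset ℕ) (c : ℕ → ℝ), (∀ k ∈ K, N ≤ k) ∧ IsSCC lo hi n ε K c := by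
  induction n, hn using Nat.le_induction with
  | base =>
    intro ε hε N
    exact exists_isSCC_one (strictMono_nat_of_lt_succ fun k => (h1 k).trans_lt (h2 k)) hε N
  | succ n hn ih =>
    intro ε hε N
    exact exists_isSCC_succ h1 h2 hn ih hε N

/-! ### Supports and successive functionals -/

theorem minSupp_mem {x : ℕ+ →₀ ℝ} (hx : x ≠ 0) : minSupp x ∈ x.support := by
  have h : x.support.Nonempty := Finsupp.support_nonempty_iff.2 hx
  rw [minSupp, dif_pos h]
  exact Finset.min'_mem _ _

theorem minSupp_le {x : ℕ+ →₀ ℝ} {i : ℕ+} (hi : i ∈ x.support) : minSupp x ≤ i := by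
  rw [minSupp, dif_pos ⟨i, hi⟩]
  exact Finset.min'_le _ _ hi

theorem le_maxSupp {x : ℕ+ →₀ ℝ} {i : ℕ+} (hi : i ∈ x.support) : (i : ℕ) ≤ maxSupp x :=
  Finset.le_sup (f := fun i : ℕ+ => (i : ℕ)) hi

theorem maxSupp_mono {x y : ℕ+ →₀ ℝ} (h : x.support ⊆ y.support) : maxSupp x ≤ maxSupp y :=
  Finset.sup_mono h

theorem exists_mem_maxSupp {x : ℕ+ →₀ ℝ} (hx : x ≠ 0) : ∃ i ∈ x.support, (i : ℕ) = maxSupp x := by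
  obtain ⟨i, hi, h⟩ := Finset.exists_mem_eq_sup x.support (Finsupp.support_nonempty_iff.2 hx)
    (fun i : ℕ+ => (i : ℕ))
  exact ⟨i, hi, h.symm⟩

theorem Before.minSupp_lt {x y : ℕ+ →₀ ℝ} (h : Before x y) (hx : x ≠ 0) (hy : y ≠ 0) :
    minSupp x < minSupp y :=
  h _ (minSupp_mem hx) _ (minSupp_mem hy)

theorem Before.maxSupp_lt {x y : ℕ+ →₀ ℝ} (h : Before x y) (hx : x ≠ 0) (hy : y ≠ 0) :
    maxSupp x < minSupp y := by
  obtain ⟨i, hi, h'⟩ := exists_mem_maxSupp hx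
  rw [← h']
  exact_mod_cast h i hi _ (minSupp_mem hy)

theorem Before.trans {x y z : ℕ+ →₀ ℝ} (h : Before x y) (h' : Before y z) (hy : y ≠ 0) :
    Before x z := fun i hi j hj =>
  (h i hi _ (minSupp_mem hy)).trans (h' _ (minSupp_mem hy) j hj)

theorem Before.mono {x y x' y' : ℕ+ →₀ ℝ} (h : Before x y) (hx : x'.support ⊆ x.support)
    (hy : y'.support ⊆ y.support) : Before x' y' :=
  fun i hi j hj => h i (hx hi) j (hy hj)

theorem pairwise_trichotomy {α : Type*} {R : α → α → Prop} {l : List α} (h : l.Pairwise R) {a b : α}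
    (ha : a ∈ l) (hb : b ∈ l) : a = b ∨ R a b ∨ R b a := by
  induction l with
  | nil => simp at ha
  | cons c l ih =>
    rw [List.pairwise_cons] at h
    rcases List.mem_cons.1 ha with rfl | ha'
    · rcases List.mem_cons.1 hb with rfl | hb'
      · exact Or.inl rfl
      · exact Or.inr (Or.inl (h.1 _ hb'))
    · rcases List.mem_cons.1 hb with rfl | hb'
      · exact Or.inr (Or.inr (h.1 _ ha'))
      · exact ih h.2 ha' hb'

theorem Successive.sum_apply_of_notMem {L : List WFun} {i : ℕ+} (h : ∀ g ∈ L, i ∉ g.vec.support) :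
    (L.map WFun.vec).sum i = 0 := by
  induction L with
  | nil => simp
  | cons f L ih =>
    have h1 := h f (by simp)
    rw [Finsupp.notMem_support_iff] at h1
    simp [h1, ih fun g hg => h g (List.mem_cons_of_mem _ hg)]

theorem Successive.sum_apply {L : List WFun} (hL : Successive L) {g : WFun} (hg : g ∈ L) {i : ℕ+}
    (hi : i ∈ g.vec.support) : (L.map WFun.vec).sum i = g.vec i := by
  induction L with
  | nil => simp at hg
  | cons f L ih =>
    rw [Successive, List.pairwise_cons] at hL
    rw [List.map_cons, List.sum_cons, Finsupp.add_apply]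
    rcases List.mem_cons.1 hg with rfl | hg'
    · rw [sum_apply_of_notMem, add_zero]
      intro g' hg' hi'
      exact lt_irrefl _ (hL.1 g' hg' i hi i hi')
    · rw [ih hL.2 hg']
      have : f.vec i = 0 := by
        by_contra h0
        exact lt_irrefl _ (hL.1 g hg' i (by simpa using h0) i hi)
      rw [this, zero_add]

theorem Successive.support_subset_sum {L : List WFun} (hL : Successive L) {g : WFun} (hg : g ∈ L) :
    g.vec.support ⊆ (L.map WFun.vec).sum.support := by
  intro i hi
  rw [Finsupp.mem_support_iff, hL.sum_apply hg hi]
  exact Finsupp.mem_support_iff.1 hi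

theorem exists_mem_support_of_sum {L : List WFun} {i : ℕ+} (hi : i ∈ (L.map WFun.vec).sum.support) :
    ∃ g ∈ L, i ∈ g.vec.support := by
  by_contra! h
  exact Finsupp.mem_support_iff.1 hi (Successive.sum_apply_of_notMem h)

/-! ### Restrictions -/

open Classical in
/-- Restriction of a weighted functional to a set of coordinates. -/
noncomputable def WFun.res (E : Set ℕ+) (f : WFun) : WFun := ⟨f.vec.filter (· ∈ E), f.idx⟩

open Classical in
/-- The nonzero restrictions of the members of a list. -/
noncomputable def resList (E : Set ℕ+) (L : List WFun) : List WFun :=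
  (L.map (WFun.res E)).filter fun g => g.vec ≠ 0

theorem WFun.res_support (E : Set ℕ+) (f : WFun) : (f.res E).vec.support ⊆ f.vec.support := by
  classical
  rw [WFun.res, Finsupp.support_filter]
  exact Finset.filter_subset _ _

theorem WFun.res_vec (E : Set ℕ+) [DecidablePred (· ∈ E)] (f : WFun) :
    (f.res E).vec = f.vec.filter (· ∈ E) := by
  simp only [WFun.res]
  congr

theorem WFun.res_distTo (E : Set ℕ+) (f : WFun) (lam : NodeBar) :
    (f.res E).distTo lam = f.distTo lam := rfl

theorem WFun.res_weight (P : Params) (E : Set ℕ+) (f : WFun) :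
    (f.res E).weight P = f.weight P := rfl

theorem mem_resList {E : Set ℕ+} {L : List WFun} {g : WFun} :
    g ∈ resList E L ↔ ∃ f ∈ L, f.res E = g ∧ g.vec ≠ 0 := by
  classical
  rw [resList, List.mem_filter, List.mem_map]
  constructor
  · rintro ⟨⟨f, hf, h⟩, h'⟩
    exact ⟨f, hf, h, by simpa using h'⟩
  · rintro ⟨f, hf, h, h'⟩
    exact ⟨⟨f, hf, h⟩, by simpa using h'⟩

theorem resList_append (E : Set ℕ+) (L L' : List WFun) :
    resList E (L ++ L') = resList E L ++ resList E L' := by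
  simp [resList]

theorem pairwise_resList {R : WFun → WFun → Prop} {E : Set ℕ+}
    (hR : ∀ f g, R f g → R (f.res E) (g.res E)) {L : List WFun} (h : L.Pairwise R) :
    (resList E L).Pairwise R := by
  classical
  refine List.Pairwise.filter _ ?_
  rw [List.pairwise_map]
  exact h.imp (fun {f g} => hR f g)

theorem sum_resList (E : Set ℕ+) [DecidablePred (· ∈ E)] (L : List WFun) :
    ((resList E L).map WFun.vec).sum = (L.map WFun.vec).sum.filter (· ∈ E) := by
  classical
  induction L with
  | nil => simp [resList, Finsupp.filter_zero]
  | cons f L ih =>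
    have h1 : resList E (f :: L) = resList E [f] ++ resList E L := resList_append E [f] L
    rw [h1, List.map_append, List.sum_append, ih, List.map_cons, List.sum_cons, Finsupp.filter_add]
    congr 1
    by_cases h : (f.res E).vec = 0
    · have : f.vec.filter (· ∈ E) = 0 := by
        rw [← WFun.res_vec, h]
      simp [resList, h, this]
    · simp only [resList, List.map_cons, List.map_nil, List.filter_cons]
      simp only [ne_eq, h, not_false_eq_true, decide_true, if_true, List.filter_nil, List.map_cons,
        List.map_nil, List.sum_cons, List.sum_nil, add_zero]
      exact WFun.res_vec E f

theorem Successive.resList {L : List WFun} (h : Successive L) (E : Set ℕ+) :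
    Successive (resList E L) :=
  pairwise_resList (fun f g hfg => hfg.mono (f.res_support E) (g.res_support E)) h

theorem FastGrowing.resList {P : Params} {L : List WFun} (h : FastGrowing P L) (E : Set ℕ+) :
    FastGrowing P (resList E L) := by
  refine pairwise_resList (fun f g hfg => ?_) h
  rw [WFun.res_weight]
  refine le_trans ?_ hfg
  exact_mod_cast Nat.pow_le_pow_right (by norm_num) (maxSupp_mono (f.res_support E))

theorem half_pow_le_of_le {a b : ℕ} (h : a ≤ b) : (2⁻¹ : ℝ) ^ b ≤ 2⁻¹ ^ a :=
  pow_le_pow_of_le_one (by norm_num) (by norm_num) h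

/-- Restricting moves the minima of the supports to the right and keeps their order, so spreading
applies. -/
theorem Admissible.resList {n : ℕ} (hn : 1 ≤ n) {L : List WFun} (h : Admissible n L)
    (h0 : ∀ g ∈ L, g.vec ≠ 0) (hs : Successive L) (E : Set ℕ+) : Admissible n (resList E L) := by
  classical
  refine Schreier.spread hn h (fun a b => ∃ f ∈ L, (f.res E).vec ≠ 0 ∧ a = minSupp f.vec ∧
    b = minSupp (f.res E).vec) ?_ ?_
  · intro b hb
    simp only [List.mem_toFinset, List.mem_map] at hb
    obtain ⟨g, hg, rfl⟩ := hb
    obtain ⟨f, hf, rfl, h1⟩ := mem_resList.1 hg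
    refine ⟨minSupp f.vec, ?_, minSupp_le (f.res_support E (minSupp_mem h1)), f, hf, h1, rfl, rfl⟩
    simp only [List.mem_toFinset, List.mem_map]
    exact ⟨f, hf, rfl⟩
  · rintro a b a' b' ⟨f, hf, h1, rfl, rfl⟩ ⟨f', hf', h1', rfl, rfl⟩ hlt
    rcases pairwise_trichotomy hs hf hf' with rfl | h' | h'
    · exact absurd hlt (lt_irrefl _)
    · exact h'.minSupp_lt (h0 f hf) (h0 f' hf')
    · exact absurd hlt (not_lt.2
        ((h'.mono (f'.res_support E) (f.res_support E)).minSupp_lt h1' h1).le)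

theorem Admissible.sublist {n : ℕ} (hn : 1 ≤ n) {L L' : List WFun} (h : Admissible n L)
    (hL : L' ⊆ L) : Admissible n L' := by
  refine Schreier.subset hn h ?_
  intro i hi
  simp only [List.mem_toFinset, List.mem_map] at hi ⊢
  obtain ⟨f, hf, rfl⟩ := hi
  exact ⟨f, hL hf, rfl⟩

theorem Params.one_le_n (P : Params) (j : ℕ+) : 1 ≤ P.n j := by
  rw [← P.n_one]
  exact P.n_strictMono.monotone (one_le)

theorem one_le_sum_n (P : Params) {js : List ℕ+} (h : js ≠ []) : 1 ≤ (js.map P.n).sum := by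
  match js, h with
  | j :: js, _ =>
    rw [List.map_cons, List.sum_cons]
    have := P.one_le_n j
    omega

theorem pairwise_flatten_fst {R : WFun → WFun → Prop} {B : List (List WFun × NodeBar)} :
    ((B.map Prod.fst).flatten).Pairwise R ↔ (∀ b ∈ B, b.1.Pairwise R) ∧
      B.Pairwise fun b c => ∀ f ∈ b.1, ∀ g ∈ c.1, R f g := by
  rw [List.pairwise_flatten, List.pairwise_map]
  simp

theorem head?_resList {E : Set ℕ+} {L : List WFun} {g : WFun} (h : (resList E L).head? = some g) :
    ∃ f ∈ L, f.res E = g ∧ g.vec ≠ 0 :=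
  mem_resList.1 (List.mem_of_head? h)

theorem minSupp_head_le {L : List WFun} (hs : Successive L) (h0 : ∀ g ∈ L, g.vec ≠ 0) {f g : WFun}
    (hf : L.head? = some f) (hg : g ∈ L) : minSupp f.vec ≤ minSupp g.vec := by
  match L, hf with
  | f' :: L, hf =>
    obtain rfl : f' = f := by simpa using hf
    rcases List.mem_cons.1 hg with rfl | hg'
    · exact le_rfl
    · exact (((List.pairwise_cons.1 hs).1 g hg').minSupp_lt (h0 _ (by simp)) (h0 g hg)).le

/-- Under restriction minima move right and maxima move left, while weights and nodes do not change.
Every condition in the definition becomes weaker, once the functionals and blocks that vanish have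
been removed. -/
theorem Packed.restrict (P : Params) (E : Set ℕ+) : ∀ (js : List ℕ+) (lam : NodeBar) (L : List WFun),
    (∀ g ∈ L, g.vec ≠ 0) → Successive L → Packed P js lam L → Packed P js lam (resList E L)
  | [], _, _, _, _, h => h.elim
  | [j], lam, L, h0, hs, h => by
    obtain ⟨h1, h2, h3⟩ := h
    refine ⟨h1.resList (P.one_le_n j) h0 hs E, h2.resList E, pairwise_resList (fun f g hfg => ?_) h3⟩
    rw [WFun.res_distTo]
    exact hfg.trans (half_pow_le_of_le (maxSupp_mono (f.res_support E)))
  | j :: j' :: js, lam, L, h0, hs, h => by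
    classical
    obtain ⟨hfg, B, rfl, hne, hadm, hpk, hpw⟩ := h
    have hmem : ∀ b ∈ B, ∀ g ∈ b.1, g ∈ (B.map Prod.fst).flatten := fun b hb g hg =>
      List.mem_flatten.2 ⟨b.1, List.mem_map.2 ⟨b, hb, rfl⟩, hg⟩
    have hs' := pairwise_flatten_fst.1 hs
    let B' := (B.map fun b => (resList E b.1, b.2)).filter fun b => b.1 ≠ []
    have hB' : ∀ b' ∈ B', ∃ b ∈ B, b' = (resList E b.1, b.2) ∧ b'.1 ≠ [] := by
      intro b' hb'
      obtain ⟨h1, h2⟩ := List.mem_filter.1 hb'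
      obtain ⟨b, hb, rfl⟩ := List.mem_map.1 h1
      exact ⟨b, hb, rfl, by simpa using h2⟩
    refine ⟨hfg.resList E, B', ?_, ?_, ?_, ?_, ?_⟩
    · have : ∀ B : List (List WFun × NodeBar),
          ((((B.map fun b => (resList E b.1, b.2)).filter fun b => b.1 ≠ []).map
            Prod.fst).flatten) = resList E (B.map Prod.fst).flatten := by
        intro B
        induction B with
        | nil => simp [resList]
        | cons b B ih =>
          rw [List.map_cons, List.map_cons, List.flatten_cons, resList_append, ← ih,
            List.filter_cons]
          by_cases h : resList E b.1 = []
          · simp [h]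
          · simp [h]
      exact this B
    · intro b' hb'
      obtain ⟨b, -, -, h⟩ := hB' b' hb'
      exact h
    · refine Schreier.spread (P.one_le_n j) hadm (fun a i => ∃ b ∈ B, ∃ f f' : WFun,
        b.1.head? = some f ∧ (resList E b.1).head? = some f' ∧ a = minSupp f.vec ∧
        i = minSupp f'.vec) ?_ ?_
      · intro i hi
        simp only [List.mem_toFinset, List.mem_map, List.mem_filterMap] at hi
        obtain ⟨f', ⟨b', hb', hf'⟩, rfl⟩ := hi
        obtain ⟨b, hb, rfl, -⟩ := hB' b' hb'
        obtain ⟨g, hg, hgf, hne'⟩ := head?_resList hf'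
        obtain ⟨f, hf⟩ : ∃ f, b.1.head? = some f := by
          cases hb1 : b.1 with
          | nil => exact absurd hb1 (hne b hb)
          | cons f t => exact ⟨f, rfl⟩
        refine ⟨minSupp f.vec, ?_, ?_, b, hb, f, f', hf, hf', rfl, rfl⟩
        · simp only [List.mem_toFinset, List.mem_map, List.mem_filterMap]
          exact ⟨f, ⟨b, hb, hf⟩, rfl⟩
        -- The head of the restricted block may come from a later functional than the head of the
        -- block; its minimum is the larger one in either case.
        · refine (minSupp_head_le (hs'.1 b hb) (fun g hg => h0 g (hmem b hb g hg)) hf hg).trans ?_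
          subst hgf
          exact minSupp_le (g.res_support E (minSupp_mem hne'))
      · rintro a i a' i' ⟨b, hb, f, f', hf, hf', rfl, rfl⟩ ⟨b2, hb2, f2, f2', hf2, hf2', rfl, rfl⟩ hlt
        have hfb := List.mem_of_head? hf
        have hfb2 := List.mem_of_head? hf2
        obtain ⟨g, hg, rfl, hn⟩ := head?_resList hf'
        obtain ⟨g2, hg2, rfl, hn2⟩ := head?_resList hf2'
        rcases pairwise_trichotomy hs'.2 hb hb2 with rfl | h | h
        · rw [hf'] at hf2'
          rw [Option.some.inj hf2'] at hlt
          exact absurd hlt (lt_irrefl _)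
        · exact (h f hfb f2 hfb2).minSupp_lt (h0 f (hmem b hb f hfb)) (h0 f2 (hmem b2 hb2 f2 hfb2))
        · exact absurd hlt (not_lt.2 (((h g2 hg2 g hg).mono (g2.res_support E)
            (g.res_support E)).minSupp_lt hn2 hn).le)
    · intro b' hb'
      obtain ⟨b, hb, rfl, -⟩ := hB' b' hb'
      exact Packed.restrict P E (j' :: js) b.2 b.1 (fun g hg => h0 g (hmem b hb g hg)) (hs'.1 b hb)
        (hpk b hb)
    · refine List.Pairwise.filter _ ?_
      rw [List.pairwise_map]
      refine hpw.imp ?_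
      intro b c hbc f' hf'
      obtain ⟨f, hf, rfl, -⟩ := mem_resList.1 hf'
      have hle := half_pow_le_of_le (maxSupp_mono (f.res_support E))
      refine ⟨fun g' hg' => ?_, ((hbc f hf).2).trans hle⟩
      obtain ⟨g, hg, rfl, -⟩ := mem_resList.1 hg'
      exact ((hbc f hf).1 g hg).trans hle

/-- The functionals of a packed list are admissible for the sum of the orders. -/
theorem Packed.admissible (P : Params) : ∀ (js : List ℕ+) (lam : NodeBar) (L : List WFun),
    (∀ g ∈ L, g.vec ≠ 0) → Successive L → Packed P js lam L → Admissible (js.map P.n).sum L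
  | [], _, _, _, _, h => h.elim
  | [j], lam, L, h0, hs, h => by simpa using h.1
  | j :: j' :: js, lam, L, h0, hs, h => by
    classical
    obtain ⟨hfg, B, rfl, hne, hadm, hpk, -⟩ := h
    have hmem : ∀ b ∈ B, ∀ g ∈ b.1, g ∈ (B.map Prod.fst).flatten := fun b hb g hg =>
      List.mem_flatten.2 ⟨b.1, List.mem_map.2 ⟨b, hb, rfl⟩, hg⟩
    have hs' := pairwise_flatten_fst.1 hs
    have hex : ∀ i ∈ ((B.map Prod.fst).flatten.map fun f => minSupp f.vec).toFinset,
        ∃ x : (List WFun × NodeBar) × WFun × WFun, x.1 ∈ B ∧ x.1.1.head? = some x.2.1 ∧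
          x.2.2 ∈ x.1.1 ∧ i = minSupp x.2.2.vec := by
      intro i hi
      simp only [List.mem_toFinset, List.mem_map, List.mem_flatten] at hi
      obtain ⟨f, ⟨_, ⟨b, hb, rfl⟩, hfb⟩, rfl⟩ := hi
      cases hb1 : b.1 with
      | nil => exact absurd hb1 (hne b hb)
      | cons g t => exact ⟨(b, g, f), hb, by simp [hb1], hfb, rfl⟩
    have : Nonempty ((List WFun × NodeBar) × WFun × WFun) := ⟨(([], lam), ⟨0, []⟩, ⟨0, []⟩)⟩
    choose! x hxB hxh hxf hxi using hex
    rw [List.map_cons, List.sum_cons, add_comm]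
    -- The minimum of each functional is sent to the minimum of the first functional of its block:
    -- the fibres have the order of the shorter tuple, and the image has order `n_j`.
    refine Schreier.conv (one_le_sum_n P (by simp)) (P.one_le_n j) (fun i => minSupp (x i).2.1.vec)
      ?_ ?_ ?_ hadm
    · intro i hi
      constructor
      · nth_rewrite 2 [hxi i hi]
        exact minSupp_head_le (hs'.1 _ (hxB i hi)) (fun g hg => h0 g (hmem _ (hxB i hi) g hg))
          (hxh i hi) (hxf i hi)
      · simp only [List.mem_toFinset, List.mem_map, List.mem_filterMap]
        exact ⟨_, ⟨_, hxB i hi, hxh i hi⟩, rfl⟩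
    · intro i hi k hk hik
      rcases pairwise_trichotomy hs'.2 (hxB i hi) (hxB k hk) with h | h | h
      · have h1 := hxh i hi
        rw [h, hxh k hk] at h1
        rw [Option.some.inj h1]
      · exact ((h _ (List.mem_of_head? (hxh i hi)) _ (List.mem_of_head? (hxh k hk))).minSupp_lt
          (h0 _ (hmem _ (hxB i hi) _ (List.mem_of_head? (hxh i hi))))
          (h0 _ (hmem _ (hxB k hk) _ (List.mem_of_head? (hxh k hk))))).le
      · have := (h _ (hxf k hk) _ (hxf i hi)).minSupp_lt
          (h0 _ (hmem _ (hxB k hk) _ (hxf k hk))) (h0 _ (hmem _ (hxB i hi) _ (hxf i hi)))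
        rw [← hxi i hi, ← hxi k hk] at this
        exact absurd hik (not_le.2 this)
    · intro r hr
      simp only [List.mem_toFinset, List.mem_map, List.mem_filterMap] at hr
      obtain ⟨f, ⟨b, hb, hf⟩, rfl⟩ := hr
      refine Schreier.subset (one_le_sum_n P (by simp)) (Packed.admissible P (j' :: js) b.2 b.1
        (fun g hg => h0 g (hmem b hb g hg)) (hs'.1 b hb) (hpk b hb)) ?_
      intro i hi
      obtain ⟨hi, hir⟩ := Finset.mem_filter.1 hi
      have hfi := List.mem_of_head? (hxh i hi)
      have hfb := List.mem_of_head? hf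
      have n1 := h0 _ (hmem _ (hxB i hi) _ hfi)
      have n2 := h0 _ (hmem _ hb _ hfb)
      rcases pairwise_trichotomy hs'.2 (hxB i hi) hb with h | h | h
      · rw [List.mem_toFinset, List.mem_map]
        rw [← h]
        exact ⟨_, hxf i hi, (hxi i hi).symm⟩
      · exact absurd hir ((h _ hfi _ hfb).minSupp_lt n1 n2).ne
      · exact absurd hir ((h _ hfb _ hfi).minSupp_lt n2 n1).ne'

/-! ### The norming set -/

theorem level_subset_succ (P : Params) : ∀ k, Level P k ⊆ Level P (k + 1)
  | 0 => fun _ h => Or.inl h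
  | _ + 1 => fun _ h => Or.inl h

theorem level_mono (P : Params) : Monotone (Level P) := monotone_nat_of_le_succ (level_subset_succ P)

theorem Params.hundred_le_m (P : Params) (j : ℕ+) : 100 ≤ P.m j := by
  rw [← P.m_one]
  exact P.m_strictMono.monotone (one_le)

theorem Params.prodM_cons (P : Params) (j : ℕ+) (js : List ℕ+) :
    P.prodM (j :: js) = P.m j * P.prodM js := by
  simp [Params.prodM]

theorem Params.one_le_prodM (P : Params) (js : List ℕ+) : 1 ≤ P.prodM js := by
  induction js with
  | nil => simp [Params.prodM]
  | cons j js ih =>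
    rw [P.prodM_cons]
    exact Nat.mul_pos (by have := P.hundred_le_m j; omega) ih

theorem Params.prodM_pos (P : Params) (js : List ℕ+) : (0 : ℝ) < P.prodM js := by
  exact_mod_cast P.one_le_prodM js

/-- The functionals that are introduced on the first level. -/
def IsFlat (P : Params) (f : WFun) : Prop :=
  f.idx ≠ [] ∧ ∃ F : Finset ℕ+, F.Nonempty ∧ Schreier (f.idx.map P.n).sum F ∧
    f.vec = (P.prodM f.idx : ℝ)⁻¹ • ∑ i ∈ F, Finsupp.single i (1 : ℝ)

/-- The functionals that are introduced on the later levels. -/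
def IsPackedSum (P : Params) (f : WFun) : Prop :=
  ∃ L : List WFun, L ≠ [] ∧ (∀ g ∈ L, g ∈ NormingSet P) ∧ Successive L ∧
    (∃ lam : NodeBar, Packed P f.idx lam L) ∧
    f.vec = (P.prodM f.idx : ℝ)⁻¹ • (L.map WFun.vec).sum

theorem level_cases (P : Params) : ∀ k, ∀ f ∈ Level P k,
    f ∈ Level P 0 ∨ IsFlat P f ∨ IsPackedSum P f
  | 0 => fun _ h => Or.inl h
  | 1 => fun _ h => h.elim Or.inl fun h => Or.inr (Or.inl h)
  | k + 2 => fun f h => h.elim (level_cases P (k + 1) f) fun ⟨L, h1, h2, h3⟩ =>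
      Or.inr (Or.inr ⟨L, h1, fun g hg => Set.mem_iUnion.2 ⟨_, h2 g hg⟩, h3⟩)

theorem normingSet_cases {P : Params} {f : WFun} (h : f ∈ NormingSet P) :
    f ∈ Level P 0 ∨ IsFlat P f ∨ IsPackedSum P f := by
  obtain ⟨k, hk⟩ := Set.mem_iUnion.1 h
  exact level_cases P k f hk

theorem IsFlat.mem {P : Params} {f : WFun} (h : IsFlat P f) : f ∈ NormingSet P :=
  Set.mem_iUnion.2 ⟨1, Or.inr h⟩

theorem IsPackedSum.mem {P : Params} {f : WFun} (h : IsPackedSum P f) : f ∈ NormingSet P := by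
  obtain ⟨L, h1, h2, h3⟩ := h
  have : ∃ k, ∀ g ∈ L, g ∈ Level P (k + 1) := by
    clear h1 h3
    induction L with
    | nil => exact ⟨0, by simp⟩
    | cons g L ih =>
      obtain ⟨k, hk⟩ := ih fun g hg => h2 g (List.mem_cons_of_mem _ hg)
      obtain ⟨k', hk'⟩ := Set.mem_iUnion.1 (h2 g (by simp))
      refine ⟨max k k', fun g' hg' => ?_⟩
      rcases List.mem_cons.1 hg' with rfl | hg'
      · exact level_mono P (by omega) hk'
      · exact level_mono P (by omega) (hk g' hg')
  obtain ⟨k, hk⟩ := this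
  exact Set.mem_iUnion.2 ⟨k + 2, Or.inr ⟨L, h1, hk, h3⟩⟩

theorem sum_single_apply (F : Finset ℕ+) (i : ℕ+) [Decidable (i ∈ F)] :
    (∑ k ∈ F, Finsupp.single k (1 : ℝ)) i = if i ∈ F then 1 else 0 := by
  classical
  rw [Finsupp.finsetSum_apply]
  simp [Finsupp.single_apply]

theorem level_vec_ne_zero (P : Params) : ∀ k, ∀ f ∈ Level P k, f.vec ≠ 0
  | 0 => by
    rintro f ⟨-, i, h | h⟩ <;> rw [h] <;> simp
  | 1 => by
    classical
    rintro f (h | ⟨-, F, ⟨i, hi⟩, -, hF⟩)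
    · exact level_vec_ne_zero P 0 f h
    · intro h0
      have := DFunLike.congr_fun hF i
      rw [h0, Finsupp.smul_apply, sum_single_apply, if_pos hi, Finsupp.zero_apply] at this
      have h1 := P.prodM_pos f.idx
      rw [smul_eq_mul, mul_one] at this
      exact (inv_pos.2 h1).ne this
  | k + 2 => by
    rintro f (h | ⟨L, hne, hL, hs, -, hv⟩)
    · exact level_vec_ne_zero P (k + 1) f h
    · intro h0
      match L, hne with
      | g :: L, _ =>
        have hg := level_vec_ne_zero P (k + 1) g (hL g (by simp))
        have h1 := hs.support_subset_sum (g := g) (by simp) (minSupp_mem hg)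
        rw [h0, eq_comm, smul_eq_zero] at hv
        rcases hv with hv | hv
        · exact inv_ne_zero (P.prodM_pos f.idx).ne' hv
        · rw [hv] at h1
          simp at h1

theorem vec_ne_zero {P : Params} {f : WFun} (h : f ∈ NormingSet P) : f.vec ≠ 0 := by
  obtain ⟨k, hk⟩ := Set.mem_iUnion.1 h
  exact level_vec_ne_zero P k f hk

theorem abs_vec_le_one {P : Params} {f : WFun} (h : f ∈ NormingSet P) (i : ℕ+) : |f.vec i| ≤ 1 := by
  obtain ⟨k, hk⟩ := Set.mem_iUnion.1 h
  exact abs_level_le P k f hk i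

/-- Only nonzero restrictions are claimed, as zero is not a member of any level. Stability under
restriction is what makes all coordinate projections contractive. -/
theorem level_res (P : Params) (E : Set ℕ+) : ∀ k, ∀ f ∈ Level P k, (f.res E).vec ≠ 0 →
    f.res E ∈ Level P k
  | 0 => by
    classical
    rintro f ⟨h1, i, h⟩ h0
    refine ⟨h1, i, ?_⟩
    rw [WFun.res_vec] at h0 ⊢
    rcases h with h | h
    all_goals
      rw [h] at h0 ⊢
      by_cases hi : i ∈ E
      · rw [Finsupp.filter_single_of_pos (· ∈ E) hi]
        simp
      · rw [Finsupp.filter_single_of_neg (· ∈ E) hi] at h0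
        exact absurd rfl h0
  | 1 => by
    classical
    rintro f (h | ⟨h1, F, hne, hF, hv⟩) h0
    · exact Or.inl (level_res P E 0 f h h0)
    · right
      have hv' : (f.res E).vec =
          (P.prodM f.idx : ℝ)⁻¹ • ∑ i ∈ F.filter (· ∈ E), Finsupp.single i (1 : ℝ) := by
        rw [WFun.res_vec, hv, Finsupp.filter_smul]
        congr 1
        ext i
        rw [Finsupp.filter_apply, sum_single_apply, sum_single_apply]
        by_cases hi : i ∈ E <;> simp [hi]
      refine ⟨h1, F.filter (· ∈ E), ?_, Schreier.subset (one_le_sum_n P h1) hF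
        (Finset.filter_subset _ _), hv'⟩
      rw [Finset.nonempty_iff_ne_empty]
      intro he
      rw [he] at hv'
      simp [hv'] at h0
  | k + 2 => by
    classical
    rintro f (h | ⟨L, hne, hL, hs, ⟨lam, hp⟩, hv⟩) h0
    · exact Or.inl (level_res P E (k + 1) f h h0)
    · right
      have hv' : (f.res E).vec = (P.prodM f.idx : ℝ)⁻¹ • ((resList E L).map WFun.vec).sum := by
        rw [WFun.res_vec, hv, Finsupp.filter_smul, sum_resList]
      refine ⟨resList E L, ?_, ?_, hs.resList E, ⟨lam, hp.restrict P E _ _ _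
        (fun g hg => level_vec_ne_zero P _ g (hL g hg)) hs⟩, hv'⟩
      · intro he
        rw [he] at hv'
        simp [hv'] at h0
      · intro g hg
        obtain ⟨f', hf', rfl, hn⟩ := mem_resList.1 hg
        exact level_res P E (k + 1) f' (hL f' hf') hn

theorem res_mem {P : Params} {f : WFun} (h : f ∈ NormingSet P) {E : Set ℕ+}
    (h0 : (f.res E).vec ≠ 0) : f.res E ∈ NormingSet P := by
  obtain ⟨k, hk⟩ := Set.mem_iUnion.1 h
  exact Set.mem_iUnion.2 ⟨k, level_res P E k f hk h0⟩

noncomputable section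

variable {P : Params}

/-! ### The duality pairing and the norm -/

namespace C00

theorem pair_apply (f : ℕ+ →₀ ℝ) (x : C00 P) :
    pair f x = ∑ i ∈ x.coords.support, x.coords i * f i := rfl

theorem pair_congr {f g : ℕ+ →₀ ℝ} {x : C00 P} (h : ∀ i ∈ x.coords.support, f i = g i) :
    pair f x = pair g x := by
  rw [pair_apply, pair_apply]
  exact Finset.sum_congr rfl fun i hi => by rw [h i hi]

theorem pair_add_left (f g : ℕ+ →₀ ℝ) (x : C00 P) : pair (f + g) x = pair f x + pair g x := by
  simp only [pair_apply, Finsupp.add_apply, mul_add, Finset.sum_add_distrib]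

theorem pair_smul_left (a : ℝ) (f : ℕ+ →₀ ℝ) (x : C00 P) : pair (a • f) x = a * pair f x := by
  simp only [pair_apply, Finsupp.smul_apply, smul_eq_mul, Finset.mul_sum]
  exact Finset.sum_congr rfl fun i _ => by ring

theorem pair_zero_left (x : C00 P) : pair (0 : ℕ+ →₀ ℝ) x = 0 := by
  simp [pair_apply]

theorem pair_eq_zero {f : ℕ+ →₀ ℝ} {x : C00 P}
    (h : ∀ i ∈ f.support, i ∉ x.coords.support) : pair f x = 0 := by
  rw [← pair_zero_left x]
  refine pair_congr fun i hi => ?_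
  by_contra h0
  exact h i (Finsupp.mem_support_iff.2 h0) hi

open Classical in
/-- Restriction of a vector to a set of coordinates. -/
def res (E : Set ℕ+) (x : C00 P) : C00 P := Finsupp.filter (· ∈ E) x.coords

theorem coords_res (E : Set ℕ+) [DecidablePred (· ∈ E)] (x : C00 P) :
    (res E x).coords = x.coords.filter (· ∈ E) := by
  have h : (res E x).coords = (WFun.res E ⟨x.coords, []⟩).vec := rfl
  rw [h, WFun.res_vec]

theorem coords_add (x y : C00 P) : (x + y).coords = x.coords + y.coords := rfl

theorem coords_smul (a : ℝ) (x : C00 P) : (a • x).coords = a • x.coords := rfl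

theorem coords_eq_zero {x : C00 P} : x.coords = 0 ↔ x = 0 := Iff.rfl

theorem coords_sum {ι : Type*} (s : Finset ι) (x : ι → C00 P) :
    (∑ i ∈ s, x i).coords = ∑ i ∈ s, (x i).coords := by
  classical
  induction s using Finset.induction_on with
  | empty => rfl
  | insert a s ha ih => rw [Finset.sum_insert ha, Finset.sum_insert ha, coords_add, ih]

theorem pair_res (f : WFun) (E : Set ℕ+) (x : C00 P) :
    pair f.vec (res E x) = pair (f.res E).vec x := by
  classical
  rw [pair_apply, pair_apply, coords_res, WFun.res_vec, Finsupp.support_filter, Finset.sum_filter]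
  refine Finset.sum_congr rfl fun i _ => ?_
  rw [Finsupp.filter_apply, Finsupp.filter_apply]
  split_ifs <;> simp

theorem abs_pair_le_norm {f : WFun} (hf : f ∈ NormingSet P) (x : C00 P) : |pair f.vec x| ≤ ‖x‖ :=
  abs_pair_le x ⟨f, hf⟩

theorem norm_le {x : C00 P} {M : ℝ} (h : ∀ f ∈ NormingSet P, |pair f.vec x| ≤ M) : ‖x‖ ≤ M :=
  ciSup_le fun f => h f.1 f.2

theorem exists_lt_pair {x : C00 P} {r : ℝ} (h : r < ‖x‖) :
    ∃ f ∈ NormingSet P, r < |pair f.vec x| := by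
  obtain ⟨f, hf⟩ := exists_lt_of_lt_ciSup h
  exact ⟨f.1, f.2, hf⟩

theorem abs_pair_res_le {f : WFun} (hf : f ∈ NormingSet P) (E : Set ℕ+) (x : C00 P) :
    |pair (f.res E).vec x| ≤ ‖x‖ := by
  by_cases h : (f.res E).vec = 0
  · rw [h, pair_zero_left, abs_zero]
    exact norm_nonneg x
  · exact abs_pair_le_norm (res_mem hf h) x

theorem norm_res_le (E : Set ℕ+) (x : C00 P) : ‖res E x‖ ≤ ‖x‖ :=
  norm_le fun f hf => by
    rw [pair_res]
    exact abs_pair_res_le hf E x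

theorem abs_coords_le (x : C00 P) (i : ℕ+) : |x.coords i| ≤ ‖x‖ := by
  rw [← pair_single x i]
  exact abs_pair_le_norm (unit_mem i) x

/-- The `ℓ₁`-norm of a vector. -/
def l1 (x : C00 P) : ℝ := ∑ i ∈ x.coords.support, |x.coords i|

theorem abs_pair_le_l1 {f : ℕ+ →₀ ℝ} {a : ℝ} (h : ∀ i, |f i| ≤ a) (x : C00 P) :
    |pair f x| ≤ a * x.l1 := by
  rw [pair_apply, l1, Finset.mul_sum]
  refine (Finset.abs_sum_le_sum_abs _ _).trans (Finset.sum_le_sum fun i _ => ?_)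
  rw [abs_mul, mul_comm]
  exact mul_le_mul_of_nonneg_right (h i) (abs_nonneg _)

theorem norm_le_l1 (x : C00 P) : ‖x‖ ≤ x.l1 :=
  norm_le fun _ hf => (abs_pair_le_l1 (abs_vec_le_one hf) x).trans (one_mul _).le

end C00

/-- The reciprocal of the weight. -/
def WFun.invW (P : Params) (f : WFun) : ℝ := if f.idx = [] then 0 else (P.prodM f.idx : ℝ)⁻¹

theorem WFun.invW_nonneg (f : WFun) : 0 ≤ f.invW P := by
  rw [WFun.invW]
  split_ifs
  · exact le_rfl
  · exact (inv_pos.2 (P.prodM_pos _)).le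

theorem WFun.invW_le (f : WFun) {N : ℕ} (hN : 0 < N) (h : (N : ℕ∞) ≤ f.weight P) :
    f.invW P ≤ (N : ℝ)⁻¹ := by
  rw [WFun.invW]
  split_ifs with h0
  · positivity
  · rw [WFun.weight, if_neg h0] at h
    have h1 : N ≤ P.prodM f.idx := by exact_mod_cast h
    exact inv_anti₀ (by exact_mod_cast hN) (by exact_mod_cast h1)

theorem WFun.invW_le_half_pow (f : WFun) {t : ℕ} (h : ((2 ^ t : ℕ) : ℕ∞) ≤ f.weight P) :
    f.invW P ≤ 2⁻¹ ^ t := by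
  have := f.invW_le (pow_pos (by norm_num) t) h
  rwa [Nat.cast_pow, Nat.cast_ofNat, ← inv_pow] at this

/-- The largest element of the support, as a positive integer. -/
def topSupp (x : ℕ+ →₀ ℝ) : ℕ+ := if h : x.support.Nonempty then x.support.max' h else 1

theorem topSupp_mem {x : ℕ+ →₀ ℝ} (hx : x ≠ 0) : topSupp x ∈ x.support := by
  have h : x.support.Nonempty := Finsupp.support_nonempty_iff.2 hx
  rw [topSupp, dif_pos h]
  exact Finset.max'_mem _ _

theorem le_topSupp {x : ℕ+ →₀ ℝ} {i : ℕ+} (hi : i ∈ x.support) : i ≤ topSupp x := by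
  rw [topSupp, dif_pos ⟨i, hi⟩]
  exact Finset.le_max' _ _ hi

/-! ### Decompositions of functionals -/

theorem exists_first {α : Type*} (p : α → Prop) (L : List α) :
    (∀ a ∈ L, ¬ p a) ∨ ∃ A b D, L = A ++ b :: D ∧ (∀ a ∈ A, ¬ p a) ∧ p b := by
  induction L with
  | nil => left; simp
  | cons a L ih =>
    by_cases h : p a
    · exact Or.inr ⟨[], a, L, rfl, by simp, h⟩
    · rcases ih with ih | ⟨A, b, D, rfl, h1, h2⟩
      · left
        simpa [h] using ih
      · exact Or.inr ⟨a :: A, b, D, rfl, by simpa [h] using h1, h2⟩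

/-- A list of functionals of the norming set whose average, with the weight given by `js`, is of
the form that functionals of the norming set have. -/
structure IsDecomp (P : Params) (js : List ℕ+) (L : List WFun) : Prop where
  mem : ∀ g ∈ L, g ∈ NormingSet P
  successive : Successive L
  fast : FastGrowing P L
  admissible : Admissible (js.map P.n).sum L

theorem IsDecomp.ne_zero {js : List ℕ+} {L : List WFun} (h : IsDecomp P js L) :
    ∀ g ∈ L, g.vec ≠ 0 := fun g hg => vec_ne_zero (h.mem g hg)

theorem IsDecomp.sublist {js : List ℕ+} (hjs : js ≠ []) {L L' : List WFun} (h : IsDecomp P js L)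
    (hL : L'.Sublist L) : IsDecomp P js L' where
  mem := fun g hg => h.mem g (hL.subset hg)
  successive := List.Pairwise.sublist hL h.successive
  fast := List.Pairwise.sublist hL h.fast
  admissible := h.admissible.sublist (one_le_sum_n P hjs) hL.subset

/-- The functional `w⁻¹ (f₁ + ⋯ + f_d)`. -/
def avg (P : Params) (js : List ℕ+) (L : List WFun) : ℕ+ →₀ ℝ :=
  (P.prodM js : ℝ)⁻¹ • (L.map WFun.vec).sum

theorem avg_append (js : List ℕ+) (L L' : List WFun) :
    avg P js (L ++ L') = avg P js L + avg P js L' := by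
  rw [avg, avg, avg, List.map_append, List.sum_append, smul_add]

theorem avg_nil (js : List ℕ+) : avg P js [] = 0 := by
  simp [avg]

theorem support_avg (js : List ℕ+) (L : List WFun) :
    (avg P js L).support = (L.map WFun.vec).sum.support :=
  Finsupp.support_smul_eq (inv_ne_zero (P.prodM_pos js).ne')

theorem pair_avg_eq_zero {js : List ℕ+} {L : List WFun} {x : C00 P}
    (h : ∀ g ∈ L, ∀ i ∈ g.vec.support, i ∉ x.coords.support) : C00.pair (avg P js L) x = 0 := by
  refine C00.pair_eq_zero fun i hi => ?_
  rw [support_avg] at hi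
  obtain ⟨g, hg, hi⟩ := exists_mem_support_of_sum hi
  exact h g hg i hi

/-- The functionals of a list which ends to the left of a vector do not act on it. -/
theorem pair_avg_eq_zero_of_lt {js : List ℕ+} {L : List WFun} {x : C00 P} {t : ℕ}
    (h : ∀ g ∈ L, maxSupp g.vec < t) (hx : ∀ i ∈ x.coords.support, t ≤ (i : ℕ)) :
    C00.pair (avg P js L) x = 0 :=
  pair_avg_eq_zero fun g hg _ hi hi' =>
    absurd ((hx _ hi').trans (le_maxSupp hi)) (not_le.2 (h g hg))

theorem minSupp_single (i : ℕ+) {a : ℝ} (ha : a ≠ 0) : minSupp (Finsupp.single i a) = i := by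
  have h := minSupp_mem (x := Finsupp.single i a) (by simpa using ha)
  rw [Finsupp.support_single i ha] at h
  simpa using h

/-- The list of unit functionals on a finite set. -/
def unitList (F : Finset ℕ+) : List WFun :=
  (F.sort (· ≤ ·)).map fun i => ⟨Finsupp.single i 1, []⟩

theorem sum_unitList (F : Finset ℕ+) :
    ((unitList F).map WFun.vec).sum = ∑ i ∈ F, Finsupp.single i (1 : ℝ) := by
  rw [unitList, List.map_map]
  rw [← List.sum_toFinset _ (Finset.sort_nodup F (· ≤ ·)), Finset.sort_toFinset]
  rfl

theorem mem_unitList {F : Finset ℕ+} {g : WFun} :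
    g ∈ unitList F ↔ ∃ i ∈ F, g = ⟨Finsupp.single i 1, []⟩ := by
  simp [unitList, eq_comm]

theorem isDecomp_unitList {js : List ℕ+} {F : Finset ℕ+} (hF : Schreier (js.map P.n).sum F) :
    IsDecomp P js (unitList F) where
  mem := by
    intro g hg
    obtain ⟨i, -, rfl⟩ := mem_unitList.1 hg
    exact C00.unit_mem i
  successive := by
    rw [Successive, unitList, List.pairwise_map]
    refine (Finset.sortedLT_sort F).pairwise.imp ?_
    intro i j hij a ha b hb
    rw [Finsupp.support_single i one_ne_zero, Finset.mem_singleton] at ha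
    rw [Finsupp.support_single j one_ne_zero, Finset.mem_singleton] at hb
    rwa [ha, hb]
  fast := by
    rw [FastGrowing, unitList, List.pairwise_map]
    refine List.pairwise_of_forall fun a b => ?_
    simp [WFun.weight]
  admissible := by
    rw [Admissible]
    convert hF
    ext i
    simp only [List.mem_toFinset, List.mem_map, mem_unitList]
    constructor
    · rintro ⟨g, ⟨k, hk, rfl⟩, rfl⟩
      rwa [minSupp_single k one_ne_zero]
    · intro hi
      exact ⟨_, ⟨i, hi, rfl⟩, minSupp_single i one_ne_zero⟩

/-- Most estimates from above need only the total order and the growth of the weights. The positions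
of the nodes are forgotten here; `IsSplit` keeps the part of that information that is used for the
tree. -/
theorem isDecomp_of_packed {js : List ℕ+} {L : List WFun} {lam : NodeBar}
    (hL : ∀ g ∈ L, g ∈ NormingSet P) (hs : Successive L) (hp : Packed P js lam L) :
    IsDecomp P js L where
  mem := hL
  successive := hs
  fast := by
    match js, hp with
    | [_], hp => exact hp.2.1
    | _ :: _ :: _, hp => exact hp.1
  admissible := hp.admissible P js lam L (fun g hg => vec_ne_zero (hL g hg)) hs

/-- A functional of finite weight is, beyond any position `t`, an average of functionals of large
weight whose nodes are close to each other, up to a functional of small norm. -/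
structure IsSplit (P : Params) (f : WFun) (t : ℕ) (A B D : List WFun) (lam : NodeBar) : Prop where
  decomp : IsDecomp P f.idx (A ++ B ++ D)
  vec_eq : f.vec = avg P f.idx (A ++ B ++ D)
  left : ∀ g ∈ A, maxSupp g.vec < t
  middle : ∀ x : C00 P, |C00.pair (avg P f.idx B) x| ≤ ‖x‖ / 100
  right : ∀ g ∈ D, ((2 ^ t : ℕ) : ℕ∞) ≤ g.weight P ∧ g.distTo lam ≤ 2 * (2⁻¹ : ℝ) ^ t

theorem two_pow_le_weight {t a : ℕ} (h : t ≤ a) {g : WFun} (hg : ((2 ^ a : ℕ) : ℕ∞) ≤ g.weight P) :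
    ((2 ^ t : ℕ) : ℕ∞) ≤ g.weight P :=
  le_trans (by exact_mod_cast Nat.pow_le_pow_right (by norm_num) h) hg

theorem abs_inv_m_mul_le (j : ℕ+) {a b : ℝ} (h : |a| ≤ b) : |(P.m j : ℝ)⁻¹ * a| ≤ b / 100 := by
  have hm : (100 : ℝ) ≤ P.m j := by exact_mod_cast P.hundred_le_m j
  rw [abs_mul, abs_of_nonneg (by positivity), div_eq_inv_mul]
  exact mul_le_mul (inv_anti₀ (by norm_num) hm) h (abs_nonneg _) (by norm_num)

/-- The cut is made at the first functional, or for longer tuples at the first block, whose support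
reaches `t`. Whatever comes later has weight at least `2 ^ t`. The factor 2 in the distance arises
for longer tuples, from the passage from the node of the functional to `λ_k` and from there to `λ`.
The tail `D` is again packed for the same tuple, which is needed when tails are merged. -/
theorem exists_isSplit_of_packed {f : WFun} {L : List WFun} {lam : NodeBar}
    (hL : ∀ g ∈ L, g ∈ NormingSet P) (hs : Successive L) (hp : Packed P f.idx lam L)
    (hv : f.vec = avg P f.idx L) (t : ℕ) :
    ∃ A B D, IsSplit P f t A B D lam ∧ (D = [] ∨ Packed P f.idx lam D) := by
  have hdec := isDecomp_of_packed hL hs hp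
  obtain ⟨vec, idx⟩ := f
  match idx, hp, hv, hdec with
  | [j], hp, hv, hdec =>
    obtain ⟨h1, h2, h3⟩ := hp
    rcases exists_first (fun g : WFun => t ≤ maxSupp g.vec) L with h | ⟨A, b, D, rfl, hA, hb⟩
    · refine ⟨L, [], [], ⟨by simpa using hdec, by simpa using hv, fun g hg => not_le.1 (h g hg), ?_,
        by simp⟩, Or.inl rfl⟩
      intro x
      rw [avg_nil, C00.pair_zero_left, abs_zero]
      positivity
    · have h2' := (List.pairwise_append.1 h2).2.1
      have h3' := (List.pairwise_append.1 h3).2.1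
      rw [List.pairwise_cons] at h2' h3'
      refine ⟨A, [b], D, ⟨by simpa using hdec, by simpa using hv, fun g hg => not_le.1 (hA g hg), ?_,
        ?_⟩, Or.inr ⟨h1.sublist (P.one_le_n j) (by intro g hg; simp [hg]), h2'.2, h3'.2⟩⟩
      · intro x
        have : avg P [j] [b] = (P.m j : ℝ)⁻¹ • b.vec := by simp [avg, Params.prodM]
        rw [this, C00.pair_smul_left]
        exact abs_inv_m_mul_le j (C00.abs_pair_le_norm (hL b (by simp)) x)
      · intro g hg
        refine ⟨two_pow_le_weight hb (h2'.1 g hg), (h3'.1 g hg).trans ?_⟩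
        have h4 := half_pow_le_of_le hb
        have h5 : (0 : ℝ) ≤ 2⁻¹ ^ t := by positivity
        linarith
  | j :: j' :: js, hp, hv, hdec =>
    obtain ⟨hfg, B, rfl, hne, hadm, hpk, hpw⟩ := hp
    have hmem : ∀ b ∈ B, ∀ g ∈ b.1, g ∈ (B.map Prod.fst).flatten := fun b hb g hg =>
      List.mem_flatten.2 ⟨b.1, List.mem_map.2 ⟨b, hb, rfl⟩, hg⟩
    have hs' := pairwise_flatten_fst.1 hs
    rcases exists_first (fun b : List WFun × NodeBar => ∃ f ∈ b.1, t ≤ maxSupp f.vec) B with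
      h | ⟨A, b, D, rfl, hA, f, hf, hb⟩
    · refine ⟨(B.map Prod.fst).flatten, [], [], ⟨by simpa using hdec, by simpa using hv, ?_, ?_,
        by simp⟩, Or.inl rfl⟩
      · intro g hg
        simp only [List.mem_flatten, List.mem_map] at hg
        obtain ⟨_, ⟨b, hb, rfl⟩, hg⟩ := hg
        by_contra hlt
        exact h b hb ⟨g, hg, not_lt.1 hlt⟩
      · intro x
        rw [avg_nil, C00.pair_zero_left, abs_zero]
        positivity
    · have hpw' := (List.pairwise_append.1 hpw).2.1
      have hfg' := pairwise_flatten_fst.1 hfg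
      have hfg2 := (List.pairwise_append.1 hfg'.2).2.1
      rw [List.pairwise_cons] at hpw' hfg2
      have hsub : (D.map Prod.fst).flatten.Sublist
          ((A ++ b :: D).map Prod.fst).flatten := by
        rw [List.map_append, List.map_cons, List.flatten_append, List.flatten_cons]
        exact (List.sublist_append_right _ _).trans (List.sublist_append_right _ _)
      refine ⟨(A.map Prod.fst).flatten, b.1, (D.map Prod.fst).flatten,
        ⟨by simpa using hdec, by simpa using hv, ?_, ?_, ?_⟩, Or.inr ⟨List.Pairwise.sublist hsub hfg,
        D, rfl, fun b' hb' => hne b' (by simp [hb']), ?_, fun b' hb' => hpk b' (by simp [hb']),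
        hpw'.2⟩⟩
      · intro g hg
        simp only [List.mem_flatten, List.mem_map] at hg
        obtain ⟨_, ⟨b', hb', rfl⟩, hg⟩ := hg
        by_contra hlt
        exact hA b' hb' ⟨g, hg, not_lt.1 hlt⟩
      · intro x
        -- The average of the cut block over the shorter tuple is itself a norming functional, so
        -- the extra factor `1 / m_j` leaves at most `‖x‖ / 100`.
        have hg : (⟨avg P (j' :: js) b.1, j' :: js⟩ : WFun) ∈ NormingSet P :=
          IsPackedSum.mem ⟨b.1, hne b (by simp), fun g hg => hL g (hmem b (by simp) g hg),
            hs'.1 b (by simp), ⟨b.2, hpk b (by simp)⟩, rfl⟩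
        have : avg P (j :: j' :: js) b.1 = (P.m j : ℝ)⁻¹ • avg P (j' :: js) b.1 := by
          rw [avg, avg, P.prodM_cons, smul_smul, Nat.cast_mul, mul_inv]
        change |C00.pair (avg P (j :: j' :: js) b.1) x| ≤ _
        rw [this, C00.pair_smul_left]
        exact abs_inv_m_mul_le j (C00.abs_pair_le_norm hg x)
      · intro g hg
        simp only [List.mem_flatten, List.mem_map] at hg
        obtain ⟨_, ⟨c, hc, rfl⟩, hg⟩ := hg
        refine ⟨two_pow_le_weight hb (hfg2.1 c hc f hf g hg), ?_⟩
        have h4 := half_pow_le_of_le hb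
        have h5 := (hpw'.1 c hc f hf).1 g hg
        have h6 := (hpw'.1 c hc f hf).2
        have h7 : g.distTo lam ≤ g.distTo c.2 + dist c.2 lam := dist_triangle _ _ _
        linarith
      · refine hadm.sublist (P.one_le_n j) ?_
        rw [List.filterMap_append, List.filterMap_cons]
        intro g hg
        rw [List.mem_append]
        right
        split
        · exact hg
        · exact List.mem_cons_of_mem _ hg

/-- The root of the tree, as a point of the completion. -/
def rootBar : NodeBar := ((WFun.node ⟨0, []⟩ : Node) : NodeBar)

/-- A flat functional averages unit functionals, which have infinite weight and the root as node.
Nothing has to be cut off. -/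
theorem IsFlat.isSplit {f : WFun} {F : Finset ℕ+} (hF : Schreier (f.idx.map P.n).sum F)
    (hv : f.vec = (P.prodM f.idx : ℝ)⁻¹ • ∑ i ∈ F, Finsupp.single i (1 : ℝ)) (t : ℕ) :
    IsSplit P f t [] [] (unitList F) rootBar where
  decomp := by simpa using isDecomp_unitList hF
  vec_eq := by
    rw [List.nil_append, List.nil_append, avg, sum_unitList, hv]
  left := by simp
  middle := by
    intro x
    rw [avg_nil, C00.pair_zero_left, abs_zero]
    positivity
  right := by
    intro g hg
    obtain ⟨i, -, rfl⟩ := mem_unitList.1 hg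
    refine ⟨by simp [WFun.weight], ?_⟩
    have : WFun.distTo ⟨Finsupp.single i 1, []⟩ rootBar = 0 := dist_self _
    rw [this]
    positivity

theorem idx_eq_nil {f : WFun} (h : f ∈ Level P 0) : f.idx = [] := h.1

theorem IsPackedSum.idx_ne_nil {f : WFun} (h : IsPackedSum P f) : f.idx ≠ [] := by
  obtain ⟨L, -, -, -, ⟨lam, hp⟩, -⟩ := h
  intro h0
  rw [h0] at hp
  exact hp

theorem exists_isSplit {f : WFun} (hf : f ∈ NormingSet P) (h0 : f.idx ≠ []) (t : ℕ) :
    ∃ A B D lam, IsSplit P f t A B D lam := by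
  rcases normingSet_cases hf with h | ⟨-, F, -, hF, hv⟩ | ⟨L, -, hL, hs, ⟨lam, hp⟩, hv⟩
  · exact absurd (idx_eq_nil h) h0
  · exact ⟨_, _, _, _, IsFlat.isSplit hF hv t⟩
  · obtain ⟨A, B, D, h, -⟩ := exists_isSplit_of_packed hL hs hp hv t
    exact ⟨A, B, D, lam, h⟩

theorem exists_isDecomp {f : WFun} (hf : f ∈ NormingSet P) (h0 : f.idx ≠ []) :
    ∃ L, IsDecomp P f.idx L ∧ f.vec = avg P f.idx L := by
  obtain ⟨A, B, D, lam, h⟩ := exists_isSplit hf h0 0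
  exact ⟨_, h.decomp, h.vec_eq⟩

theorem abs_vec_le_inv {f : WFun} (hf : f ∈ NormingSet P) (h0 : f.idx ≠ []) (i : ℕ+) :
    |f.vec i| ≤ (P.prodM f.idx : ℝ)⁻¹ := by
  obtain ⟨L, hL, hv⟩ := exists_isDecomp hf h0
  rw [hv, avg, Finsupp.smul_apply, smul_eq_mul, abs_mul,
    abs_of_nonneg (inv_nonneg.2 (P.prodM_pos _).le)]
  exact mul_le_of_le_one_right (inv_nonneg.2 (P.prodM_pos _).le)
    (abs_listSum_le hL.successive (fun g hg => abs_vec_le_one (hL.mem g hg)) i)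

/-! ### Block sequences and estimates on special convex combinations -/

/-- Infinite sequences of nonzero successive vectors. -/
structure IsBlockSeq (x : ℕ → C00 P) : Prop where
  ne_zero : ∀ k, (x k).coords ≠ 0
  before : ∀ i k, i < k → Before (x i).coords (x k).coords

theorem isBlockSeq_of_succ {x : ℕ → C00 P} (h0 : ∀ k, (x k).coords ≠ 0)
    (h : ∀ k, Before (x k).coords (x (k + 1)).coords) : IsBlockSeq x := by
  refine ⟨h0, fun i k hik => ?_⟩
  induction k, Nat.succ_le_of_lt hik using Nat.le_induction with
  | base => exact h i
  | succ k hk ih => exact (ih (by omega)).trans (h k) (h0 k)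

/-- The smallest element of the support of the `k`-th vector. -/
def lo (x : ℕ → C00 P) (k : ℕ) : ℕ+ := minSupp (x k).coords

/-- The largest element of the support of the `k`-th vector. -/
def hi (x : ℕ → C00 P) (k : ℕ) : ℕ+ := topSupp (x k).coords

namespace IsBlockSeq

variable {x : ℕ → C00 P}

theorem lo_le_hi (hx : IsBlockSeq x) (k : ℕ) : lo x k ≤ hi x k :=
  le_topSupp (minSupp_mem (hx.ne_zero k))

theorem hi_lt_lo (hx : IsBlockSeq x) {i k : ℕ} (h : i < k) : hi x i < lo x k :=
  hx.before i k h _ (topSupp_mem (hx.ne_zero i)) _ (minSupp_mem (hx.ne_zero k))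

theorem lo_strictMono (hx : IsBlockSeq x) : StrictMono (lo x) :=
  fun i _ h => (hx.lo_le_hi i).trans_lt (hx.hi_lt_lo h)

theorem hi_strictMono (hx : IsBlockSeq x) : StrictMono (hi x) :=
  fun _ k h => (hx.hi_lt_lo h).trans_le (hx.lo_le_hi k)

theorem le_lo (hx : IsBlockSeq x) (k : ℕ) : k ≤ (lo x k : ℕ) := by
  have : StrictMono fun k => (lo x k : ℕ) := fun i j h => by exact_mod_cast hx.lo_strictMono h
  exact this.le_apply

theorem lo_le (_hx : IsBlockSeq x) {k : ℕ} {i : ℕ+} (hi : i ∈ (x k).coords.support) : lo x k ≤ i :=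
  minSupp_le hi

theorem le_hi (_hx : IsBlockSeq x) {k : ℕ} {i : ℕ+} (h : i ∈ (x k).coords.support) : i ≤ hi x k :=
  le_topSupp h

theorem comp (hx : IsBlockSeq x) {φ : ℕ → ℕ} (hφ : StrictMono φ) : IsBlockSeq fun k => x (φ k) :=
  ⟨fun _ => hx.ne_zero _, fun _ _ h => hx.before _ _ (hφ h)⟩

theorem index_le (hx : IsBlockSeq x) {i k : ℕ} {a b : ℕ+} (ha : a ∈ (x i).coords.support)
    (hb : b ∈ (x k).coords.support) (h : a < b) : i ≤ k := by
  by_contra hlt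
  exact lt_asymm h (hx.before k i (not_le.1 hlt) b hb a ha)

theorem pair_sum (f : ℕ+ →₀ ℝ) (K : Finset ℕ) (c : ℕ → ℝ) :
    C00.pair f (∑ k ∈ K, c k • x k) = ∑ k ∈ K, c k * C00.pair f (x k) := by
  rw [map_sum]
  exact Finset.sum_congr rfl fun k _ => by rw [map_smul, smul_eq_mul]

theorem exists_isSCC (hx : IsBlockSeq x) {n : ℕ} (hn : 1 ≤ n) {ε : ℝ} (hε : 0 < ε) (N : ℕ) :
    ∃ (K : Finset ℕ) (c : ℕ → ℝ), (∀ k ∈ K, N ≤ k) ∧ IsSCC (lo x) (hi x) n ε K c :=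
  XDSpace.exists_isSCC hx.lo_le_hi (fun k => hx.hi_lt_lo (Nat.lt_succ_self k)) hn ε hε N

/-- Averages of functionals over a set of a family of order smaller than `n` act on a special
convex combination of order `n` essentially one by one. -/
theorem abs_pair_avg_le (hx : IsBlockSeq x) {l : ℕ → ℕ+} {n : ℕ} {ε : ℝ} {K : Finset ℕ} {c : ℕ → ℝ}
    (hc : IsSCC l (hi x) n ε K c) {js : List ℕ+} {L : List WFun} (h0 : ∀ g ∈ L, g.vec ≠ 0)
    (hs : Successive L) {p : ℕ} (hp : 1 ≤ p) (hpn : p < n) (hadm : Admissible p L) {M η : ℝ}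
    (hM0 : 0 ≤ M) (hη0 : 0 ≤ η) (hM : ∀ k ∈ K, |C00.pair (avg P js L) (x k)| ≤ M)
    (hη : ∀ g ∈ L, ∃ k0, ∀ k ∈ K, k ≠ k0 → |C00.pair g.vec (x k)| ≤ η) :
    |C00.pair (avg P js L) (∑ k ∈ K, c k • x k)| ≤ 2 * M * ε + (P.prodM js : ℝ)⁻¹ * η := by
  classical
  choose! e he using hη
  let act : WFun → ℕ → Prop := fun g k => ∃ i ∈ g.vec.support, i ∈ (x k).coords.support
  -- An index is bad if two functionals of the list act on its vector, and exceptional if some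
  -- acting functional has it as its exceptional index. Outside of both sets at most one functional
  -- acts, and it acts by at most `η`. Each of the two sets has mass at most `ε`, which accounts for
  -- `2 * M * ε`.
  let bad : Finset ℕ := K.filter fun k =>
    ∃ g ∈ L, ∃ g' ∈ L, Before g.vec g'.vec ∧ act g k ∧ act g' k
  let exc : Finset ℕ := K.filter fun k => ∃ g ∈ L, act g k ∧ k = e g
  have hbad : ∑ k ∈ bad, c k ≤ ε := by
    refine hc.small p hp hpn bad (Finset.filter_subset _ _) ?_
    -- The minimum of the later one of two functionals acting on `x k` lies between `lo x k` and `hi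
    -- x k`. Bad indices thus correspond increasingly to minima of the list, and spreading moves
    -- these to `hi x k`.
    refine Schreier.spread hp hadm
      (fun a b => ∃ k, b = hi x k ∧ lo x k ≤ a ∧ a ≤ hi x k) ?_ ?_
    · intro b hb
      obtain ⟨k, hk, rfl⟩ := Finset.mem_image.1 hb
      obtain ⟨-, g, hg, g', hg', hb, ⟨i, hi1, hi2⟩, i', hi1', hi2'⟩ := Finset.mem_filter.1 hk
      have h1 : minSupp g'.vec ≤ hi x k := (minSupp_le hi1').trans (hx.le_hi hi2')
      refine ⟨minSupp g'.vec, ?_, h1, k, rfl, ?_, h1⟩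
      · rw [List.mem_toFinset]
        exact List.mem_map.2 ⟨g', hg', rfl⟩
      · exact (hx.lo_le hi2).trans (hb _ hi1 _ (minSupp_mem (h0 g' hg'))).le
    · rintro a b a' b' ⟨k, rfl, -, h2⟩ ⟨k', rfl, h1', -⟩ hlt
      exact h2.trans_lt ((hx.hi_lt_lo (hx.hi_strictMono.lt_iff_lt.1 hlt)).trans_le h1')
  have hexc : ∑ k ∈ exc, c k ≤ ε := by
    refine hc.small p hp hpn exc (Finset.filter_subset _ _) ?_
    refine Schreier.spread hp hadm
      (fun a b => ∃ k, ∃ g ∈ L, act g k ∧ k = e g ∧ a = minSupp g.vec ∧ b = hi x k) ?_ ?_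
    · intro b hb
      obtain ⟨k, hk, rfl⟩ := Finset.mem_image.1 hb
      obtain ⟨-, g, hg, ⟨i, hi1, hi2⟩, he⟩ := Finset.mem_filter.1 hk
      refine ⟨minSupp g.vec, ?_, (minSupp_le hi1).trans (hx.le_hi hi2), k, g, hg, ⟨i, hi1, hi2⟩, he,
        rfl, rfl⟩
      rw [List.mem_toFinset]
      exact List.mem_map.2 ⟨g, hg, rfl⟩
    · rintro a b a' b' ⟨k, g, hg, ⟨i, hi1, hi2⟩, hk, rfl, rfl⟩
        ⟨k', g', hg', ⟨i', hi1', hi2'⟩, hk', rfl, rfl⟩ hlt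
      have hkk := hx.hi_strictMono.lt_iff_lt.1 hlt
      rcases pairwise_trichotomy hs hg hg' with rfl | h | h
      · exact absurd (hk.trans hk'.symm) hkk.ne
      · exact h.minSupp_lt (h0 g hg) (h0 g' hg')
      · exact absurd (h _ hi1' _ hi1) (lt_asymm (hx.before k k' hkk _ hi2 _ hi2'))
  have hw := inv_nonneg.2 (P.prodM_pos js).le
  have hrest : ∀ k ∈ K, k ∉ bad → k ∉ exc →
      |C00.pair (avg P js L) (x k)| ≤ (P.prodM js : ℝ)⁻¹ * η := by
    intro k hk h1 h2
    by_cases hact : ∃ g ∈ L, act g k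
    · obtain ⟨g, hg, hgk⟩ := hact
      have huniq : ∀ g' ∈ L, act g' k → g' = g := by
        intro g' hg' hgk'
        rcases pairwise_trichotomy hs hg' hg with h | h | h
        · exact h
        · exact absurd (Finset.mem_filter.2 ⟨hk, g', hg', g, hg, h, hgk', hgk⟩) h1
        · exact absurd (Finset.mem_filter.2 ⟨hk, g, hg, g', hg', h, hgk, hgk'⟩) h1
      have h3 : C00.pair (L.map WFun.vec).sum (x k) = C00.pair g.vec (x k) := by
        refine C00.pair_congr fun i hi => ?_
        by_cases hig : i ∈ g.vec.support
        · exact hs.sum_apply hg hig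
        · rw [Finsupp.notMem_support_iff.1 hig, Successive.sum_apply_of_notMem]
          intro g' hg' hi'
          rw [huniq g' hg' ⟨i, hi', hi⟩] at hi'
          exact hig hi'
      rw [avg, C00.pair_smul_left, h3, abs_mul, abs_of_nonneg hw]
      refine mul_le_mul_of_nonneg_left (he g hg k hk ?_) hw
      intro hke
      exact h2 (Finset.mem_filter.2 ⟨hk, g, hg, hgk, hke⟩)
    · have : C00.pair (avg P js L) (x k) = 0 :=
        pair_avg_eq_zero fun g hg i hi hi' => hact ⟨g, hg, i, hi, hi'⟩
      rw [this, abs_zero]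
      exact mul_nonneg hw hη0
  rw [pair_sum]
  refine (Finset.abs_sum_le_sum_abs _ _).trans ?_
  have hterm : ∀ k ∈ K, |c k * C00.pair (avg P js L) (x k)| ≤
      ((if k ∈ bad then M * c k else 0) + (if k ∈ exc then M * c k else 0)) +
        c k * ((P.prodM js : ℝ)⁻¹ * η) := by
    intro k hk
    have hck := hc.nonneg k
    have hMc : 0 ≤ M * c k := mul_nonneg hM0 hck
    have hle : |c k * C00.pair (avg P js L) (x k)| ≤ M * c k := by
      rw [abs_mul, abs_of_nonneg hck, mul_comm]
      exact mul_le_mul_of_nonneg_right (hM k hk) hck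
    have hnn : 0 ≤ c k * ((P.prodM js : ℝ)⁻¹ * η) := mul_nonneg hck (mul_nonneg hw hη0)
    by_cases h1 : k ∈ bad
    · rw [if_pos h1]
      split_ifs <;> linarith
    · by_cases h2 : k ∈ exc
      · rw [if_pos h2, if_neg h1]
        linarith
      · rw [if_neg h1, if_neg h2, abs_mul, abs_of_nonneg hck, zero_add, zero_add]
        exact mul_le_mul_of_nonneg_left (hrest k hk h1 h2) hck
  refine (Finset.sum_le_sum hterm).trans ?_
  rw [Finset.sum_add_distrib, Finset.sum_add_distrib, Finset.sum_ite_mem, Finset.sum_ite_mem,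
    ← Finset.sum_mul, hc.sum_eq, one_mul, Finset.inter_eq_right.2 (Finset.filter_subset _ _),
    Finset.inter_eq_right.2 (Finset.filter_subset _ _), ← Finset.mul_sum, ← Finset.mul_sum]
  have h1 := mul_le_mul_of_nonneg_left hbad hM0
  have h2 := mul_le_mul_of_nonneg_left hexc hM0
  linarith

end IsBlockSeq

/-! ### Compactness of the completed tree -/

theorem meetHeight_append (a s t : List Bool) :
    Node.meetHeight (a ++ s) (a ++ t) = a.length + Node.meetHeight s t := by
  induction a with
  | nil => simp
  | cons b a ih =>
    simp only [List.cons_append, Node.meetHeight, if_true, ih, List.length_cons]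
    omega

theorem node_dist_le {a b : Node} {n : ℕ} (h : n ≤ Node.meetHeight a b) :
    dist a b ≤ (2⁻¹ : ℝ) ^ n := by
  classical
  rw [Node.dist_def]
  split_ifs
  · positivity
  · exact half_pow_le_of_le h

theorem node_dist_take_le (a : List Bool) (n : ℕ) :
    dist (show Node from a) (show Node from a.take n) ≤ (2⁻¹ : ℝ) ^ n := by
  classical
  by_cases hn : n ≤ a.length
  · refine node_dist_le ?_
    have h1 : Node.meetHeight a (a.take n) =
        Node.meetHeight (a.take n ++ a.drop n) (a.take n ++ []) := by
      rw [List.take_append_drop, List.append_nil]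
    have h2 : n ≤ Node.meetHeight a (a.take n) := by
      rw [h1, meetHeight_append, List.length_take, min_eq_left hn]
      exact Nat.le_add_right _ _
    exact h2
  · rw [List.take_of_length_le (by omega), dist_self]
    positivity

theorem finite_node_length_le (n : ℕ) : {a : Node | List.length (α := Bool) a ≤ n}.Finite :=
  List.finite_length_le Bool n

/-- The finitely many nodes of height at most `n` form a `2⁻ⁿ`-net, since truncation at height `n`
moves a node by at most that much. -/
theorem node_totallyBounded : TotallyBounded (Set.univ : Set Node) := by
  rw [Metric.totallyBounded_iff]
  intro ε hε
  obtain ⟨n, hn⟩ := exists_pow_lt_of_lt_one hε (by norm_num : (2⁻¹ : ℝ) < 1)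
  refine ⟨_, finite_node_length_le n, fun a _ => ?_⟩
  simp only [Set.mem_iUnion]
  refine ⟨List.take n a, ?_, (node_dist_take_le a n).trans_lt hn⟩
  exact (List.length_take_le n (show List Bool from a))

instance : CompactSpace NodeBar := by
  refine ⟨?_⟩
  rw [isCompact_iff_totallyBounded_isComplete]
  refine ⟨?_, isClosed_univ.isComplete⟩
  have h := (node_totallyBounded.image (UniformSpace.Completion.uniformContinuous_coe Node)).closure
  rwa [Set.image_univ, UniformSpace.Completion.denseRange_coe.closure_range] at h

/-- In the application `M r` is the end of a support, so the conclusion is precisely the condition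
on nodes in the definition of packed sequences. Compactness of the completed tree makes it available
along a subsequence. -/
theorem exists_subseq_close (lam : ℕ → NodeBar) (M : ℕ → ℕ) :
    ∃ (φ : ℕ → ℕ) (l : NodeBar), StrictMono φ ∧
      ∀ i k, i < k → dist (lam (φ k)) l ≤ (2⁻¹ : ℝ) ^ M (φ i) := by
  obtain ⟨l, ψ, hψ, hl⟩ := CompactSpace.tendsto_subseq lam
  obtain ⟨θ, hθ, h⟩ := exists_strictMono_of_eventually
    (fun r r' => dist (lam (ψ r')) l ≤ (2⁻¹ : ℝ) ^ M (ψ r)) (by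
      intro r
      have := Metric.tendsto_atTop.1 hl ((2⁻¹ : ℝ) ^ M (ψ r)) (by positivity)
      obtain ⟨N, hN⟩ := this
      exact Filter.eventually_atTop.2 ⟨N, fun n hn => (hN n hn).le⟩)
  exact ⟨ψ ∘ θ, l, hψ.comp hθ, h⟩

/-! ### Lower estimates for block sequences -/

/-- The sequence satisfies lower `ℓ₁`-estimates on the members of the Schreier families. -/
def LowerEst (x : ℕ → C00 P) : Prop :=
  ∀ (j : ℕ+) (R : Finset ℕ) (a : ℕ → ℝ), (∀ k, 0 ≤ a k) → Schreier (P.n j) (R.image (lo x)) →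
    (98 / 100 : ℝ) * (P.m j : ℝ)⁻¹ * ∑ k ∈ R, a k ≤ ‖∑ k ∈ R, a k • x k‖

/-- The functional `m_j⁻¹ ∑ h k` is tested on the combination. As the supports are disjoint, `h k`
only sees `x k`. -/
theorem lowerEst_of {x : ℕ → C00 P} (hx : IsBlockSeq x) (h : ℕ → ℕ+ →₀ ℝ)
    (hsupp : ∀ k, (h k).support ⊆ (x k).coords.support)
    (hval : ∀ k, (98 / 100 : ℝ) ≤ C00.pair (h k) (x k))
    (hF : ∀ (j : ℕ+) (R : Finset ℕ), R.Nonempty → Schreier (P.n j) (R.image (lo x)) →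
      ∃ F ∈ NormingSet P, F.vec = (P.m j : ℝ)⁻¹ • ∑ k ∈ R, h k) : LowerEst x := by
  classical
  intro j R a ha hR
  rcases R.eq_empty_or_nonempty with rfl | hne
  · simp
  obtain ⟨F, hF, hv⟩ := hF j R hne hR
  refine le_trans ?_ ((le_abs_self _).trans (C00.abs_pair_le_norm hF _))
  have hm : (0 : ℝ) ≤ (P.m j : ℝ)⁻¹ := by positivity
  have hpair : ∀ k ∈ R, C00.pair F.vec (x k) = (P.m j : ℝ)⁻¹ * C00.pair (h k) (x k) := by
    intro k hk
    rw [hv, C00.pair_smul_left]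
    congr 1
    refine C00.pair_congr fun i hi => ?_
    rw [Finsupp.finsetSum_apply]
    refine Finset.sum_eq_single_of_mem k hk fun k' _ hne => ?_
    by_contra h0
    have hi' := hsupp k' (Finsupp.mem_support_iff.2 h0)
    rcases hne.lt_or_gt with hlt | hlt
    · exact lt_irrefl _ (hx.before _ _ hlt _ hi' _ hi)
    · exact lt_irrefl _ (hx.before _ _ hlt _ hi _ hi')
  rw [IsBlockSeq.pair_sum, Finset.mul_sum]
  refine Finset.sum_le_sum fun k hk => ?_
  rw [hpair k hk]
  have h1 := mul_le_mul_of_nonneg_left (hval k) (mul_nonneg hm (ha k))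
  linarith

theorem schreier_image_of_le {x : ℕ → C00 P} (hx : IsBlockSeq x) {n : ℕ} (hn : 1 ≤ n) {R : Finset ℕ}
    (hR : Schreier n (R.image (lo x))) (g : ℕ → ℕ+)
    (h : ∀ k, lo x k ≤ g k ∧ g k ≤ hi x k) : Schreier n (R.image g) := by
  classical
  have hg : StrictMono g := fun i k hik =>
    (h i).2.trans_lt ((hx.hi_lt_lo hik).trans_le (h k).1)
  refine Schreier.spread hn hR (fun a b => ∃ k, a = lo x k ∧ b = g k) ?_ ?_
  · intro b hb
    obtain ⟨k, hk, rfl⟩ := Finset.mem_image.1 hb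
    exact ⟨lo x k, Finset.mem_image_of_mem _ hk, (h k).1, k, rfl, rfl⟩
  · rintro a b a' b' ⟨k, rfl, rfl⟩ ⟨k', rfl, rfl⟩ hlt
    exact hx.lo_strictMono (hg.lt_iff_lt.1 hlt)

theorem sort_pairwise {R : Finset ℕ} {r : ℕ → ℕ → Prop} (h : ∀ i k, i < k → r i k) :
    (R.sort (· ≤ ·)).Pairwise r :=
  (Finset.sortedLT_sort R).pairwise.imp fun {a b} => h a b

theorem sum_sort_map {M : Type*} [AddCommMonoid M] (R : Finset ℕ) (h : ℕ → M) :
    ((R.sort (· ≤ ·)).map h).sum = ∑ k ∈ R, h k := by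
  rw [← List.sum_toFinset _ (Finset.sort_nodup R (· ≤ ·)), Finset.sort_toFinset]

/-- Near-norming functionals of rapidly increasing weights yield lower estimates. -/
theorem exists_lowerEst_of_fast {x : ℕ → C00 P} (hx : IsBlockSeq x) (f : ℕ → WFun)
    (hf : ∀ k, f k ∈ NormingSet P) (hsupp : ∀ k, (f k).vec.support ⊆ (x k).coords.support)
    (hval : ∀ k, (98 / 100 : ℝ) ≤ C00.pair (f k).vec (x k))
    (hw : ∀ i k, i < k → ((2 ^ maxSupp (f i).vec : ℕ) : ℕ∞) ≤ (f k).weight P) :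
    ∃ φ : ℕ → ℕ, StrictMono φ ∧ LowerEst fun k => x (φ k) := by
  classical
  obtain ⟨φ, l, hφ, hl⟩ := exists_subseq_close (fun k => ((f k).node : NodeBar))
    fun k => maxSupp (f k).vec
  refine ⟨φ, hφ, ?_⟩
  have hx' := hx.comp hφ
  refine lowerEst_of hx' (fun k => (f (φ k)).vec) (fun k => hsupp _) (fun k => hval _) ?_
  intro j R hne hR
  let L := (R.sort (· ≤ ·)).map fun k => f (φ k)
  have hmem : ∀ g ∈ L, ∃ k ∈ R, g = f (φ k) := by
    intro g hg
    obtain ⟨k, hk, rfl⟩ := List.mem_map.1 hg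
    exact ⟨k, by simpa using hk, rfl⟩
  have hsum : (L.map WFun.vec).sum = ∑ k ∈ R, (f (φ k)).vec := by
    rw [List.map_map, ← sum_sort_map]
    rfl
  refine ⟨⟨(P.m j : ℝ)⁻¹ • ∑ k ∈ R, (f (φ k)).vec, [j]⟩, IsPackedSum.mem ⟨L, ?_, ?_, ?_, ⟨l, ?_⟩, ?_⟩,
    rfl⟩
  · obtain ⟨k, hk⟩ := hne
    exact List.ne_nil_of_mem (List.mem_map.2 ⟨k, by simpa using hk, rfl⟩)
  · intro g hg
    obtain ⟨k, -, rfl⟩ := hmem g hg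
    exact hf _
  · rw [Successive, List.pairwise_map]
    exact sort_pairwise fun i k hik => (hx'.before i k hik).mono (hsupp _) (hsupp _)
  · refine ⟨?_, ?_, ?_⟩
    · have := schreier_image_of_le hx' (P.one_le_n j) hR (fun k => minSupp (f (φ k)).vec) (by
        intro k
        have h1 := minSupp_mem (vec_ne_zero (hf (φ k)))
        exact ⟨hx'.lo_le (hsupp _ h1), hx'.le_hi (hsupp _ h1)⟩)
      rw [Admissible]
      convert this
      ext i
      simp [L]
    · rw [FastGrowing, List.pairwise_map]
      exact sort_pairwise fun i k hik => hw _ _ (hφ hik)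
    · rw [List.pairwise_map]
      exact sort_pairwise fun i k hik => hl i k hik
  · simp [hsum, Params.prodM]

/-- Near-norming functionals of the same weight tuple yield lower estimates. -/
theorem exists_lowerEst_of_packed {x : ℕ → C00 P} (hx : IsBlockSeq x) {js : List ℕ+} (hjs : js ≠ [])
    (D : ℕ → List WFun) (lam : ℕ → NodeBar) (hD : ∀ k, ∀ g ∈ D k, g ∈ NormingSet P)
    (hs : ∀ k, Successive (D k)) (hp : ∀ k, Packed P js (lam k) (D k)) (hne : ∀ k, D k ≠ [])
    (hsupp : ∀ k, ∀ g ∈ D k, g.vec.support ⊆ (x k).coords.support)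
    (hw : ∀ k, ∀ g ∈ D k, ((2 ^ (lo x k : ℕ) : ℕ) : ℕ∞) ≤ g.weight P ∧
      g.distTo (lam k) ≤ 2 * (2⁻¹ : ℝ) ^ (lo x k : ℕ))
    (hval : ∀ k, (98 / 100 : ℝ) ≤ C00.pair (avg P js (D k)) (x k)) :
    ∃ φ : ℕ → ℕ, StrictMono φ ∧ LowerEst fun k => x (φ k) := by
  classical
  obtain ⟨φ, l, hφ, hl⟩ := exists_subseq_close lam fun k => maxSupp (x k).coords
  refine ⟨φ, hφ, ?_⟩
  have hx' := hx.comp hφ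
  have hmax : ∀ i k, i < k → ∀ f ∈ D (φ i), maxSupp f.vec < (lo x (φ k) : ℕ) := by
    intro i k hik f hf
    exact (maxSupp_mono (hsupp _ f hf)).trans_lt
      ((hx'.before i k hik).maxSupp_lt (hx'.ne_zero i) (hx'.ne_zero k))
  refine lowerEst_of hx' (fun k => avg P js (D (φ k))) ?_ (fun k => hval _) ?_
  · intro k i hi
    rw [support_avg] at hi
    obtain ⟨g, hg, hi⟩ := exists_mem_support_of_sum hi
    exact hsupp _ g hg hi
  intro j R hneR hR
  let B := (R.sort (· ≤ ·)).map fun k => (D (φ k), lam (φ k))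
  have hBmem : ∀ b ∈ B, ∃ k ∈ R, b = (D (φ k), lam (φ k)) := by
    intro g hg
    obtain ⟨k, hk, rfl⟩ := List.mem_map.1 hg
    exact ⟨k, by simpa using hk, rfl⟩
  have hLmem : ∀ g ∈ (B.map Prod.fst).flatten, ∃ k ∈ R, g ∈ D (φ k) := by
    intro g hg
    simp only [List.mem_flatten, List.mem_map] at hg
    obtain ⟨_, ⟨b, hb, rfl⟩, hg⟩ := hg
    obtain ⟨k, hk, rfl⟩ := hBmem b hb
    exact ⟨k, hk, hg⟩
  have hfast : FastGrowing P (B.map Prod.fst).flatten := by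
    rw [FastGrowing, pairwise_flatten_fst]
    constructor
    · intro b hb
      obtain ⟨k, -, rfl⟩ := hBmem b hb
      exact (isDecomp_of_packed (hD _) (hs _) (hp _)).fast
    · rw [List.pairwise_map]
      exact sort_pairwise fun i k hik f hf g hg =>
        two_pow_le_weight (hmax i k hik f hf).le (hw _ g hg).1
  have hpk : Packed P (j :: js) l (B.map Prod.fst).flatten := by
    match js, hjs, hp with
    | j' :: js, _, hp =>
      -- The tails `D (φ k)` become the blocks of a packed list for the tuple with the additional
      -- last entry `j`, with `lam (φ k)` as their nodes.
      refine ⟨hfast, B, rfl, ?_, ?_, ?_, ?_⟩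
      · intro b hb
        obtain ⟨k, -, rfl⟩ := hBmem b hb
        exact hne _
      · choose h t hht using fun k => List.exists_cons_of_ne_nil (hne k)
        have hhD : ∀ k, h k ∈ D k := fun k => by rw [hht k]; simp
        have := schreier_image_of_le hx' (P.one_le_n j) hR (fun k => minSupp (h (φ k)).vec) (by
          intro k
          have h1 := minSupp_mem (vec_ne_zero (hD _ _ (hhD (φ k))))
          exact ⟨hx'.lo_le (hsupp _ _ (hhD _) h1), hx'.le_hi (hsupp _ _ (hhD _) h1)⟩)
        rw [Admissible]
        convert this
        ext i
        simp only [List.mem_toFinset, List.mem_map, List.mem_filterMap, B, Finset.mem_image]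
        constructor
        · rintro ⟨f, ⟨b, ⟨k, hk, rfl⟩, hf⟩, rfl⟩
          refine ⟨k, by simpa using hk, ?_⟩
          rw [hht (φ k)] at hf
          have : h (φ k) = f := by simpa using hf
          rw [this]
        · rintro ⟨k, hk, rfl⟩
          refine ⟨h (φ k), ⟨_, ⟨k, by simpa using hk, rfl⟩, ?_⟩, rfl⟩
          simp [hht (φ k)]
      · intro b hb
        obtain ⟨k, -, rfl⟩ := hBmem b hb
        exact hp _
      · rw [List.pairwise_map]
        refine sort_pairwise fun i k hik f hf => ⟨fun g hg => ?_, ?_⟩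
        · refine (hw _ g hg).2.trans ?_
          -- The strict inequality between the end of `f` and the start of the later vector gains a
          -- factor 2, which absorbs the one in the bound on `distTo`.
          have h1 := half_pow_le_of_le (Nat.succ_le_of_lt (hmax i k hik f hf))
          rw [Nat.succ_eq_add_one, pow_succ] at h1
          linarith
        · exact (hl i k hik).trans (half_pow_le_of_le (maxSupp_mono (hsupp _ f hf)))
  have hsum : (((B.map Prod.fst).flatten).map WFun.vec).sum =
      ∑ k ∈ R, ((D (φ k)).map WFun.vec).sum := by
    rw [← sum_sort_map]
    simp only [B]
    generalize R.sort (· ≤ ·) = l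
    induction l with
    | nil => simp
    | cons a l ih =>
      simp only [List.map_cons, List.flatten_cons, List.map_append, List.sum_append, List.sum_cons,
        ih]
  refine ⟨⟨avg P (j :: js) (B.map Prod.fst).flatten, j :: js⟩,
    IsPackedSum.mem ⟨(B.map Prod.fst).flatten, ?_, ?_, ?_, ⟨l, hpk⟩, rfl⟩, ?_⟩
  · obtain ⟨k, hk⟩ := hneR
    obtain ⟨h, t, hht⟩ := List.exists_cons_of_ne_nil (hne (φ k))
    refine List.ne_nil_of_mem (a := h) (List.mem_flatten.2 ⟨D (φ k), List.mem_map.2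
      ⟨_, List.mem_map.2 ⟨k, by simpa using hk, rfl⟩, rfl⟩, ?_⟩)
    rw [hht]
    simp
  · intro g hg
    obtain ⟨k, -, hg⟩ := hLmem g hg
    exact hD _ g hg
  · rw [Successive, pairwise_flatten_fst]
    constructor
    · intro b hb
      obtain ⟨k, -, rfl⟩ := hBmem b hb
      exact hs _
    · rw [List.pairwise_map]
      exact sort_pairwise fun i k hik f hf g hg =>
        (hx'.before i k hik).mono (hsupp _ f hf) (hsupp _ g hg)
  · change avg P (j :: js) (B.map Prod.fst).flatten = _
    rw [avg, hsum, P.prodM_cons, Nat.cast_mul, mul_inv, Finset.smul_sum, Finset.smul_sum]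
    refine Finset.sum_congr rfl fun k _ => ?_
    rw [avg, smul_smul]

/-- Flat functionals of one weight tuple merge directly: by `Schreier.conv` the union of the sets `F
k` has the order that the tuple enlarged by `j` permits. No nodes are involved. -/
theorem lowerEst_of_flat {x : ℕ → C00 P} (hx : IsBlockSeq x) {js : List ℕ+} (hjs : js ≠ [])
    (F : ℕ → Finset ℕ+) (hF : ∀ k, Schreier (js.map P.n).sum (F k)) (hne : ∀ k, (F k).Nonempty)
    (hsupp : ∀ k, F k ⊆ (x k).coords.support)
    (hval : ∀ k, (98 / 100 : ℝ) ≤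
      C00.pair ((P.prodM js : ℝ)⁻¹ • ∑ i ∈ F k, Finsupp.single i (1 : ℝ)) (x k)) : LowerEst x := by
  classical
  refine lowerEst_of hx _ ?_ hval ?_
  · intro k i hi
    refine hsupp k ?_
    rw [Finsupp.mem_support_iff, Finsupp.smul_apply, sum_single_apply] at hi
    by_contra h
    simp [h] at hi
  intro j R hneR hR
  have hdisj : Set.PairwiseDisjoint (R : Set ℕ) F := by
    intro i _ k _ hik
    rw [Function.onFun, Finset.disjoint_left]
    intro a ha ha'
    rcases hik.lt_or_gt with h | h
    · exact lt_irrefl _ (hx.before _ _ h a (hsupp _ ha) a (hsupp _ ha'))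
    · exact lt_irrefl _ (hx.before _ _ h a (hsupp _ ha') a (hsupp _ ha))
  have hk : ∀ i ∈ R.biUnion F, ∃ k ∈ R, i ∈ F k := fun i hi => Finset.mem_biUnion.1 hi
  choose! q hqR hqF using hk
  have hG : Schreier ((j :: js).map P.n).sum (R.biUnion F) := by
    rw [List.map_cons, List.sum_cons, add_comm]
    refine Schreier.conv (one_le_sum_n P hjs) (P.one_le_n j) (fun i => lo x (q i)) ?_ ?_ ?_ hR
    · intro i hi
      exact ⟨hx.lo_le (hsupp _ (hqF i hi)), Finset.mem_image_of_mem _ (hqR i hi)⟩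
    · intro i hi k hk hik
      refine hx.lo_strictMono.monotone ?_
      rcases hik.lt_or_eq with h | rfl
      · exact hx.index_le (hsupp _ (hqF i hi)) (hsupp _ (hqF k hk)) h
      · exact le_rfl
    · intro r hr
      obtain ⟨k, -, rfl⟩ := Finset.mem_image.1 hr
      refine Schreier.subset (one_le_sum_n P hjs) (hF k) ?_
      intro i hi
      obtain ⟨hi, hik⟩ := Finset.mem_filter.1 hi
      rw [← hx.lo_strictMono.injective hik]
      exact hqF i hi
  refine ⟨⟨(P.prodM (j :: js) : ℝ)⁻¹ • ∑ i ∈ R.biUnion F, Finsupp.single i (1 : ℝ), j :: js⟩,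
    IsFlat.mem ⟨by simp, _, ?_, hG, rfl⟩, ?_⟩
  · obtain ⟨k, hk⟩ := hneR
    obtain ⟨i, hi⟩ := hne k
    exact ⟨i, Finset.mem_biUnion.2 ⟨k, hk, hi⟩⟩
  · change (P.prodM (j :: js) : ℝ)⁻¹ • ∑ i ∈ R.biUnion F, Finsupp.single i (1 : ℝ) = _
    rw [Finset.sum_biUnion hdisj, P.prodM_cons, Nat.cast_mul, mul_inv, Finset.smul_sum,
      Finset.smul_sum]
    refine Finset.sum_congr rfl fun k _ => ?_
    rw [smul_smul]

theorem Params.le_m (P : Params) (j : ℕ+) : (j : ℕ) ≤ P.m j := by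
  induction j using PNat.recOn with
  | one => rw [P.m_one]; norm_num
  | succ j ih =>
    have := P.m_strictMono (show j < j + 1 from PNat.lt_add_right j 1)
    rw [PNat.add_coe, PNat.one_coe]
    omega

/-- Because `m_j ≥ j` and all `m_j` are at least 100, a bound on the weight bounds both the indices
and the length of a tuple. Bounded weights can therefore be made constant along a subsequence. -/
theorem finite_prodM_lt (P : Params) (M : ℕ) : {js : List ℕ+ | P.prodM js < M}.Finite := by
  induction M with
  | zero => simp
  | succ M ih =>
    have hfin : {j : ℕ+ | (j : ℕ) ≤ M}.Finite :=
      (Set.finite_Iic M).preimage PNat.coe_injective.injOn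
    refine ((Set.finite_singleton []).union (hfin.image2 List.cons ih)).subset ?_
    intro js hjs
    match js, hjs with
    | [], _ => left; rfl
    | j :: js, hjs =>
      right
      rw [Set.mem_ofPred_eq, P.prodM_cons] at hjs
      have h1 := P.le_m j
      have h2 := P.hundred_le_m j
      have h3 := P.one_le_prodM js
      refine ⟨j, ?_, js, ?_, rfl⟩
      · rw [Set.mem_ofPred_eq]
        nlinarith
      · rw [Set.mem_ofPred_eq]
        nlinarith

theorem frequently_eq_of_finite {α : Type*} {S : Set α} (hS : S.Finite) {g : ℕ → α}
    (h : ∀ᶠ n in Filter.atTop, g n ∈ S) : ∃ y ∈ S, ∃ᶠ n in Filter.atTop, g n = y := by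
  by_contra! hc
  have h1 : ∀ y ∈ S, ∀ᶠ n in Filter.atTop, g n ≠ y := hc
  obtain ⟨n, hn, hn'⟩ := (((Filter.eventually_all_finite hS).2 h1).and h).exists
  exact hn _ hn' rfl

/-- Either the weights are unbounded, and a subsequence of them grows fast enough for packing, or
one weight tuple recurs infinitely often; in that case the flat and the packed functionals are
treated separately. -/
theorem exists_lowerEst_of_norming {x : ℕ → C00 P} (hx : IsBlockSeq x) (hn : ∀ k, ‖x k‖ = 1)
    (f : ℕ → WFun) (hf : ∀ k, f k ∈ NormingSet P)
    (hsupp : ∀ k, (f k).vec.support ⊆ (x k).coords.support)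
    (hval : ∀ k, (99 / 100 : ℝ) ≤ C00.pair (f k).vec (x k)) :
    ∃ φ : ℕ → ℕ, StrictMono φ ∧ LowerEst fun k => x (φ k) := by
  classical
  have hval' : ∀ k, (98 / 100 : ℝ) ≤ C00.pair (f k).vec (x k) := fun k => by
    have := hval k
    linarith
  by_cases h : ∀ M : ℕ, ∃ᶠ r in Filter.atTop, (M : ℕ∞) ≤ (f r).weight P
  · obtain ⟨ψ, hψ, hψw⟩ := Filter.extraction_forall_of_frequently h
    obtain ⟨θ, hθ, hθw⟩ := exists_strictMono_of_eventually
      (fun r r' => ((2 ^ maxSupp (f (ψ r)).vec : ℕ) : ℕ∞) ≤ (f (ψ r')).weight P) (by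
        intro r
        refine Filter.eventually_atTop.2 ⟨2 ^ maxSupp (f (ψ r)).vec, fun n hn => ?_⟩
        exact le_trans (by exact_mod_cast hn) (hψw n))
    obtain ⟨φ, hφ, hL⟩ := exists_lowerEst_of_fast (hx.comp (hψ.comp hθ)) (fun k => f (ψ (θ k)))
      (fun k => hf _) (fun k => hsupp _) (fun k => hval' _) hθw
    exact ⟨fun k => ψ (θ (φ k)), (hψ.comp hθ).comp hφ, hL⟩
  · push Not at h
    obtain ⟨M, hM⟩ := h
    have hM' : ∀ᶠ r in Filter.atTop, (f r).idx ∈ {js : List ℕ+ | js ≠ [] ∧ P.prodM js < M} := by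
      refine hM.mono fun r hr => ?_
      rw [WFun.weight] at hr
      split_ifs at hr with h0
      · exact absurd hr (by simp)
      · exact ⟨h0, by exact_mod_cast hr⟩
    obtain ⟨js, ⟨hjs, -⟩, hfr⟩ := frequently_eq_of_finite
      ((finite_prodM_lt P M).subset fun js h => h.2) hM'
    have hfr' : (∃ᶠ n in Filter.atTop, (f n).idx = js ∧ IsFlat P (f n)) ∨
        ∃ᶠ n in Filter.atTop, (f n).idx = js ∧ IsPackedSum P (f n) := by
      rw [← Filter.frequently_or_distrib]
      refine hfr.mono fun n hn => ?_
      rcases normingSet_cases (hf n) with h | h | h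
      · exact absurd (idx_eq_nil h) (by rwa [hn])
      · exact Or.inl ⟨hn, h⟩
      · exact Or.inr ⟨hn, h⟩
    rcases hfr' with hfr | hfr
    · obtain ⟨φ, hφ, hφ'⟩ := Filter.extraction_of_frequently_atTop hfr
      refine ⟨φ, hφ, ?_⟩
      have hidx : ∀ k, (f (φ k)).idx = js := fun k => (hφ' k).1
      choose F hne hF hv using fun k => (hφ' k).2.2
      simp only [hidx] at hF hv
      refine lowerEst_of_flat (hx.comp hφ) hjs F hF hne ?_ ?_
      · intro k i hi
        refine hsupp (φ k) ?_
        rw [hv k, Finsupp.mem_support_iff, Finsupp.smul_apply, sum_single_apply, if_pos hi,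
          smul_eq_mul, mul_one]
        exact (inv_pos.2 (P.prodM_pos js)).ne'
      · intro k
        rw [← hv k]
        exact hval' _
    · obtain ⟨ψ, hψ, hψ'⟩ := Filter.extraction_of_frequently_atTop hfr
      have hidx : ∀ k, (f (ψ k)).idx = js := fun k => (hψ' k).1
      have hex : ∀ k, ∃ (D : List WFun) (lam : NodeBar), (∀ g ∈ D, g ∈ NormingSet P) ∧
          Successive D ∧ Packed P js lam D ∧ D ≠ [] ∧
          (∀ g ∈ D, g.vec.support ⊆ (x (ψ k)).coords.support) ∧
          (∀ g ∈ D, ((2 ^ (lo x (ψ k) : ℕ) : ℕ) : ℕ∞) ≤ g.weight P ∧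
            g.distTo lam ≤ 2 * (2⁻¹ : ℝ) ^ (lo x (ψ k) : ℕ)) ∧
          (98 / 100 : ℝ) ≤ C00.pair (avg P js D) (x (ψ k)) := by
        intro k
        obtain ⟨L, -, hL, hs, ⟨lam, hp⟩, hv⟩ := (hψ' k).2
        -- The cut is at the start of `x (ψ k)`: `A` does not act, `B` costs at most `1 / 100`, and
        -- `D` retains the value `98 / 100`.
        obtain ⟨A, B, D, hsp, hD⟩ := exists_isSplit_of_packed hL hs hp hv (lo x (ψ k) : ℕ)
        have hv' := hsp.vec_eq
        have hmid := hsp.middle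
        rw [hidx k] at hv' hmid hD
        have hA : C00.pair (avg P js A) (x (ψ k)) = 0 :=
          pair_avg_eq_zero_of_lt hsp.left fun i hi => by exact_mod_cast hx.lo_le hi
        have hB := hmid (x (ψ k))
        rw [hn] at hB
        have htot : C00.pair (f (ψ k)).vec (x (ψ k)) = C00.pair (avg P js A) (x (ψ k)) +
            C00.pair (avg P js B) (x (ψ k)) + C00.pair (avg P js D) (x (ψ k)) := by
          rw [hv', avg_append, avg_append, C00.pair_add_left, C00.pair_add_left]
        have hDval : (98 / 100 : ℝ) ≤ C00.pair (avg P js D) (x (ψ k)) := by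
          have h1 := hval (ψ k)
          have h2 := (abs_le.1 hB).2
          rw [htot, hA] at h1
          linarith
        have hDne : D ≠ [] := by
          rintro rfl
          rw [avg_nil, C00.pair_zero_left] at hDval
          norm_num at hDval
        refine ⟨D, lam, fun g hg => hsp.decomp.mem g (by simp [hg]),
          List.Pairwise.sublist (List.sublist_append_right _ _) hsp.decomp.successive,
          hD.resolve_left hDne, hDne, ?_, hsp.right, hDval⟩
        intro g hg
        refine subset_trans ?_ (hsupp (ψ k))
        rw [hv', support_avg]
        exact hsp.decomp.successive.support_subset_sum (by simp [hg])
      choose D lam h1 h2 h3 h4 h5 h6 h7 using hex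
      obtain ⟨φ, hφ, hL⟩ := exists_lowerEst_of_packed (hx.comp hψ) hjs D lam h1 h2 h3 h4 h5 h6 h7
      exact ⟨fun k => ψ (φ k), hψ.comp hφ, hL⟩

/-- Every normalized block sequence has, after changes of sign, a subsequence with lower
estimates. -/
theorem exists_lowerEst {x : ℕ → C00 P} (hx : IsBlockSeq x) (hn : ∀ k, ‖x k‖ = 1) :
    ∃ (φ : ℕ → ℕ) (s : ℕ → ℝ), StrictMono φ ∧ (∀ k, s k = 1 ∨ s k = -1) ∧
      LowerEst fun k => s (φ k) • x (φ k) := by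
  classical
  have hex : ∀ k, ∃ (f : WFun) (s : ℝ), f ∈ NormingSet P ∧ (s = 1 ∨ s = -1) ∧
      f.vec.support ⊆ (x k).coords.support ∧ (99 / 100 : ℝ) ≤ C00.pair f.vec (s • x k) := by
    intro k
    obtain ⟨f, hf, hfx⟩ := C00.exists_lt_pair (x := x k) (r := 99 / 100) (by rw [hn]; norm_num)
    let E : Set ℕ+ := {i | i ∈ (x k).coords.support}
    have hpair : C00.pair (f.res E).vec (x k) = C00.pair f.vec (x k) := by
      refine C00.pair_congr fun i hi => ?_
      rw [WFun.res_vec]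
      exact Finsupp.filter_apply_pos _ _ hi
    have h0 : (f.res E).vec ≠ 0 := by
      intro h0
      rw [← hpair, h0, C00.pair_zero_left] at hfx
      norm_num at hfx
    have hsub : (f.res E).vec.support ⊆ (x k).coords.support := by
      intro i hi
      rw [WFun.res_vec, Finsupp.support_filter, Finset.mem_filter] at hi
      exact hi.2
    rcases le_total 0 (C00.pair f.vec (x k)) with h | h
    · refine ⟨f.res E, 1, res_mem hf h0, Or.inl rfl, hsub, ?_⟩
      rw [one_smul, hpair, ← abs_of_nonneg h]
      exact hfx.le
    · refine ⟨f.res E, -1, res_mem hf h0, Or.inr rfl, hsub, ?_⟩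
      rw [neg_one_smul, map_neg, hpair, ← abs_of_nonpos h]
      exact hfx.le
  choose f s hf hs hsupp hval using hex
  have hs0 : ∀ k, s k ≠ 0 := fun k => by rcases hs k with h | h <;> rw [h] <;> norm_num
  have hsup : ∀ k, (s k • x k).coords.support = (x k).coords.support := fun k => by
    rw [C00.coords_smul, Finsupp.support_smul_eq (hs0 k)]
  have hx' : IsBlockSeq fun k => s k • x k := by
    refine ⟨fun k => ?_, fun i k hik => (hx.before i k hik).mono (hsup i).subset (hsup k).subset⟩
    rw [C00.coords_smul]
    exact smul_ne_zero (hs0 k) (hx.ne_zero k)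
  obtain ⟨φ, hφ, hL⟩ := exists_lowerEst_of_norming hx' (fun k => by
    rw [norm_smul, hn, mul_one]
    rcases hs k with h | h <;> rw [h] <;> norm_num) f hf
    (fun k => (hsupp k).trans (hsup k).symm.subset) hval
  exact ⟨φ, s, hφ, hs, hL⟩

/-! ### Rapidly increasing sequences -/

theorem log_hundred_pos : 0 < Real.log 100 := Real.log_pos (by norm_num)

theorem hundred_pow_length_le (P : Params) (js : List ℕ+) : 100 ^ js.length ≤ P.prodM js := by
  induction js with
  | nil => simp [Params.prodM]
  | cons j js ih =>
    rw [P.prodM_cons, List.length_cons, pow_succ, mul_comm]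
    exact Nat.mul_le_mul (P.hundred_le_m j) ih

theorem m_le_prodM (P : Params) {js : List ℕ+} {j : ℕ+} (h : j ∈ js) : P.m j ≤ P.prodM js := by
  induction js with
  | nil => simp at h
  | cons i js ih =>
    rw [P.prodM_cons]
    rcases List.mem_cons.1 h with rfl | h
    · exact Nat.le_mul_of_pos_right _ (P.one_le_prodM js)
    · exact (ih h).trans (Nat.le_mul_of_pos_left _ (by have := P.hundred_le_m i; omega))

/-- Each factor of the weight is at least 100, so there are fewer than `4 log m_j / log 100`
factors, each contributing at most the predecessor of `n_j` in the sequence. The growth condition on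
the `n_j` is made for this. Hence functionals of small weight with small indices have order below
`n_j`. -/
theorem sum_n_lt (P : Params) {js : List ℕ+} {j : ℕ+} (h : ∀ i ∈ js, i < j)
    (hw : P.prodM js < P.m j ^ 4) : (js.map P.n).sum < P.n j := by
  by_cases hjs : js = []
  · subst hjs
    exact P.one_le_n j
  · obtain ⟨i0, hi0⟩ := List.exists_mem_of_ne_nil js hjs
    have hj : 1 < j := lt_of_le_of_lt one_le (h i0 hi0)
    obtain ⟨i, rfl⟩ : ∃ i, j = i + 1 := ⟨j - 1, (PNat.sub_add_of_lt hj).symm⟩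
    have h1 : (js.map P.n).sum ≤ js.length * P.n i := by
      have := List.sum_le_card_nsmul (js.map P.n) (P.n i) (by
        intro a ha
        obtain ⟨k, hk, rfl⟩ := List.mem_map.1 ha
        exact P.n_strictMono.monotone (PNat.lt_add_one_iff.1 (h k hk)))
      simpa using this
    have hm : (100 : ℝ) ≤ P.m (i + 1) := by exact_mod_cast P.hundred_le_m (i + 1)
    have h2 : (100 : ℝ) ^ js.length < (P.m (i + 1) : ℝ) ^ 4 := by
      exact_mod_cast (hundred_pow_length_le P js).trans_lt hw
    have h3 := Real.log_lt_log (by positivity) h2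
    rw [Real.log_pow, Real.log_pow] at h3
    have hlog := log_hundred_pos
    have h4 : (js.length : ℝ) < 4 / Real.log 100 * Real.log (P.m (i + 1)) := by
      rw [div_mul_eq_mul_div, lt_div_iff₀ hlog]
      exact_mod_cast h3
    have hn : (0 : ℝ) < P.n i := by exact_mod_cast P.one_le_n i
    have h5 := P.n_growth i
    have h6 : ((js.map P.n).sum : ℝ) < P.n (i + 1) := by
      calc ((js.map P.n).sum : ℝ) ≤ js.length * P.n i := by exact_mod_cast h1
        _ ≤ 4 / Real.log 100 * Real.log (P.m (i + 1)) * P.n i :=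
          mul_le_mul_of_nonneg_right h4.le hn.le
        _ = 4 / Real.log 100 * P.n i * Real.log (P.m (i + 1)) := by ring
        _ < P.n (i + 1) := h5
    exact_mod_cast h6

/-- This is the number of averaging steps of order `n_j` that fit into order `n_{j+1}`; the summand
1 is there because a singleton starts in order one. Growth gives `100 ^ (s + 1) > m_{j+1} ^ 4`, and
one factor 100 is given up against one factor `m_{j+1}`. -/
theorem exists_iterations (P : Params) (j : ℕ+) :
    ∃ s : ℕ, s * P.n j + 1 ≤ P.n (j + 1) ∧ P.m (j + 1) ^ 3 ≤ 100 ^ s := by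
  have hn := P.one_le_n j
  have hn' := P.one_le_n (j + 1)
  refine ⟨(P.n (j + 1) - 1) / P.n j, ?_, ?_⟩
  · have := Nat.div_mul_le_self (P.n (j + 1) - 1) (P.n j)
    omega
  · set s := (P.n (j + 1) - 1) / P.n j with hs
    have h1 : P.n (j + 1) ≤ (s + 1) * P.n j := by
      have := Nat.lt_mul_div_succ (P.n (j + 1) - 1) hn
      rw [← hs] at this
      rw [mul_comm]
      omega
    have h2 := P.n_growth j
    have hn0 : (0 : ℝ) < P.n j := by exact_mod_cast hn
    have hlog := log_hundred_pos
    have h3 : 4 / Real.log 100 * Real.log (P.m (j + 1)) < (s + 1 : ℕ) := by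
      have h4 : 4 / Real.log 100 * P.n j * Real.log (P.m (j + 1)) < (s + 1 : ℕ) * P.n j :=
        h2.trans_le (by exact_mod_cast h1)
      have h5 : 4 / Real.log 100 * Real.log (P.m (j + 1)) * P.n j < (s + 1 : ℕ) * P.n j := by
        linarith
      exact lt_of_mul_lt_mul_right h5 hn0.le
    rw [div_mul_eq_mul_div, div_lt_iff₀ hlog] at h3
    have hm : (100 : ℝ) ≤ P.m (j + 1) := by exact_mod_cast P.hundred_le_m (j + 1)
    have h6 : Real.log ((P.m (j + 1) : ℝ) ^ 4) < Real.log (100 ^ (s + 1)) := by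
      rw [Real.log_pow, Real.log_pow]
      exact_mod_cast h3
    have h7 := (Real.log_lt_log_iff (by positivity) (by positivity)).1 h6
    have h8 : P.m (j + 1) ^ 4 < 100 ^ (s + 1) := by exact_mod_cast h7
    have h9 := P.hundred_le_m (j + 1)
    have h10 : P.m (j + 1) ^ 3 * 100 ≤ P.m (j + 1) ^ 4 := by
      rw [pow_succ (P.m (j + 1)) 3]
      exact Nat.mul_le_mul_left _ h9
    rw [pow_succ 100 s] at h8
    omega

/-- A multiple of a convex combination of order `i n_j + 1` which has norm at most one although its
coefficients have the sum `100 ^ i`. -/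
structure IsAvg (z : ℕ → C00 P) (j : ℕ+) (i : ℕ) (R : Finset ℕ) (a : ℕ → ℝ) : Prop where
  nonneg : ∀ k, 0 ≤ a k
  sum_eq : ∑ k ∈ R, a k = 100 ^ i
  norm_le : ‖∑ k ∈ R, a k • z k‖ ≤ 1
  schreier : Schreier (i * P.n j + 1) (R.image (lo z))

theorem coords_sum_apply {z : ℕ → C00 P} (hz : IsBlockSeq z) {R : Finset ℕ} (a : ℕ → ℝ) {k : ℕ}
    (hk : k ∈ R) {i : ℕ+} (hi : i ∈ (z k).coords.support) :
    (∑ k ∈ R, a k • z k).coords i = a k * (z k).coords i := by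
  rw [C00.coords_sum, Finsupp.finsetSum_apply]
  rw [Finset.sum_eq_single_of_mem k hk, C00.coords_smul, Finsupp.smul_apply, smul_eq_mul]
  intro k' _ hne
  rw [C00.coords_smul, Finsupp.smul_apply]
  have : (z k').coords i = 0 := by
    by_contra h0
    have hi' := Finsupp.mem_support_iff.2 h0
    rcases hne.lt_or_gt with hlt | hlt
    · exact lt_irrefl _ (hz.before _ _ hlt _ hi' _ hi)
    · exact lt_irrefl _ (hz.before _ _ hlt _ hi _ hi')
  rw [this, smul_zero]

theorem exists_mem_support_sum {z : ℕ → C00 P} {R : Finset ℕ} {a : ℕ → ℝ} {i : ℕ+}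
    (hi : i ∈ (∑ k ∈ R, a k • z k).coords.support) : ∃ k ∈ R, i ∈ (z k).coords.support := by
  by_contra! h
  rw [Finsupp.mem_support_iff, C00.coords_sum, Finsupp.finsetSum_apply] at hi
  refine hi (Finset.sum_eq_zero fun k hk => ?_)
  rw [C00.coords_smul, Finsupp.smul_apply, Finsupp.notMem_support_iff.1 (h k hk), smul_zero]

theorem IsAvg.exists_pos {z : ℕ → C00 P} {j : ℕ+} {i : ℕ} {R : Finset ℕ}
    {a : ℕ → ℝ} (h : IsAvg z j i R a) : ∃ k ∈ R, 0 < a k := by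
  by_contra! h'
  have h1 : ∑ k ∈ R, a k ≤ 0 := Finset.sum_nonpos h'
  rw [h.sum_eq] at h1
  exact absurd h1 (not_le.2 (by positivity))

/-- The estimates on functionals of small weight that hold for the terms of a rapidly increasing
sequence. -/
def SmallWeightEst (W : ℕ) (x : C00 P) : Prop :=
  ∀ f ∈ NormingSet P, f.idx ≠ [] → P.prodM f.idx < W → |C00.pair f.vec x| ≤ 200 * f.invW P

/-- A functional of weight `w < W ≤ m_j` has order below `n_j`, so it acts on the combination by at
most `1 / W + 1 / w ≤ 2 / w`. Normalizing costs a factor of at most 100. -/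
theorem smallWeightEst_of_isSCC {u : ℕ → C00 P} (hu : IsBlockSeq u) (hn : ∀ q, ‖u q‖ ≤ 1) {j : ℕ+}
    {W : ℕ} (hW : W ≤ P.m j) (hW0 : 0 < W) {l : ℕ → ℕ+} {K : Finset ℕ} {c : ℕ → ℝ}
    (hc : IsSCC l (hi u) (P.n j) (1 / (2 * W)) K c)
    (hlow : 1 / 100 ≤ ‖∑ q ∈ K, c q • u q‖) :
    SmallWeightEst W (‖∑ q ∈ K, c q • u q‖⁻¹ • ∑ q ∈ K, c q • u q) := by
  intro f hf h0 hw
  obtain ⟨L, hL, hv⟩ := exists_isDecomp hf h0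
  have hp : (f.idx.map P.n).sum < P.n j := by
    have hm : P.prodM f.idx < P.m j := hw.trans_le hW
    refine sum_n_lt P (fun i hi => ?_) ?_
    · by_contra hlt
      exact absurd ((P.m_strictMono.monotone (not_lt.1 hlt)).trans (m_le_prodM P hi))
        (not_le.2 hm)
    · exact hm.trans_le (Nat.le_self_pow (by norm_num) _)
  have hw0 := P.prodM_pos f.idx
  have h1 := hu.abs_pair_avg_le hc (js := f.idx) hL.ne_zero hL.successive (one_le_sum_n P h0) hp
    hL.admissible (M := 1) (η := 1) zero_le_one zero_le_one (fun k _ => by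
      rw [← hv]
      exact (C00.abs_pair_le_norm hf _).trans (hn k)) (fun g hg => ⟨0, fun k _ _ =>
      (C00.abs_pair_le_norm (hL.mem g hg) _).trans (hn k)⟩)
  rw [← hv] at h1
  have hW' : (0 : ℝ) < W := by exact_mod_cast hW0
  have h2 : (W : ℝ)⁻¹ ≤ (P.prodM f.idx : ℝ)⁻¹ := inv_anti₀ hw0 (by exact_mod_cast hw.le)
  have h3 : 2 * 1 * (1 / (2 * (W : ℝ))) = (W : ℝ)⁻¹ := by
    field_simp
  rw [h3, mul_one] at h1
  have hinv : ‖∑ q ∈ K, c q • u q‖⁻¹ ≤ 100 := by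
    rw [inv_le_comm₀ (lt_of_lt_of_le (by norm_num) hlow) (by norm_num)]
    simpa using hlow
  rw [map_smul, smul_eq_mul, abs_mul, abs_of_nonneg (inv_nonneg.2 (norm_nonneg _)), WFun.invW,
    if_neg h0]
  calc _ ≤ 100 * (2 * (P.prodM f.idx : ℝ)⁻¹) :=
        mul_le_mul hinv (h1.trans (by linarith)) (abs_nonneg _) (by norm_num)
    _ = _ := by ring

/-- Either a normalized combination of flat averages satisfies the estimates on functionals of small
weight, or there are flat averages of the next order. -/
theorem IsAvg.step {z : ℕ → C00 P} (hz : IsBlockSeq z) {j : ℕ+} {i : ℕ} {W : ℕ} (hW : W ≤ P.m j)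
    (hW0 : 0 < W) (ih : ∀ N, ∃ R a, IsAvg z j i R a ∧ ∀ k ∈ R, N ≤ k) (N : ℕ) :
    (∃ (R : Finset ℕ) (a : ℕ → ℝ), (∀ k ∈ R, N ≤ k) ∧ (∑ k ∈ R, a k • z k) ≠ 0 ∧
      SmallWeightEst W (‖∑ k ∈ R, a k • z k‖⁻¹ • ∑ k ∈ R, a k • z k)) ∨
      ∃ R a, IsAvg z j (i + 1) R a ∧ ∀ k ∈ R, N ≤ k := by
  classical
  obtain ⟨s, hs0, hs⟩ := exists_seq_of_step
    (fun _ T (x : Finset ℕ × (ℕ → ℝ)) => IsAvg z j i x.1 x.2 ∧ ∀ k ∈ x.1, T ≤ k)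
    (fun _ x => x.1.sup id + 1) N (by
      intro _ T
      obtain ⟨R, a, h⟩ := ih T
      exact ⟨(R, a), h⟩)
  have hA : ∀ q, IsAvg z j i (s q).1 (s q).2 := by
    intro q
    cases q with
    | zero => exact hs0.1
    | succ q => exact (hs q).1
  have hne : ∀ q, (s q).1.Nonempty := fun q => by
    obtain ⟨k, hk, -⟩ := (hA q).exists_pos
    exact ⟨k, hk⟩
  have hstep : ∀ q, ∀ k ∈ (s q).1, ∀ k' ∈ (s (q + 1)).1, k < k' := by
    intro q k hk k' hk'
    exact (Nat.lt_succ_of_le (Finset.le_sup (f := id) hk)).trans_le ((hs q).2 k' hk')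
  have hsep : ∀ q q', q < q' → ∀ k ∈ (s q).1, ∀ k' ∈ (s q').1, k < k' := by
    intro q q' h
    induction q', Nat.succ_le_of_lt h using Nat.le_induction with
    | base => exact hstep q
    | succ q' hq' ih =>
      intro k hk k' hk'
      obtain ⟨m, hm⟩ := hne q'
      exact (ih (by omega) k hk m hm).trans (hstep q' m hm k' hk')
  have hN : ∀ q, ∀ k ∈ (s q).1, N ≤ k := by
    intro q k hk
    rcases Nat.eq_zero_or_pos q with rfl | h
    · exact hs0.2 k hk
    · obtain ⟨m, hm⟩ := hne 0
      exact (hs0.2 m hm).trans (hsep 0 q h m hm k hk).le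
  let u : ℕ → C00 P := fun q => ∑ k ∈ (s q).1, (s q).2 k • z k
  have hu : IsBlockSeq u := by
    constructor
    · intro q h0
      obtain ⟨k, hk, ha⟩ := (hA q).exists_pos
      have h1 := minSupp_mem (hz.ne_zero k)
      have h2 := coords_sum_apply hz (s q).2 hk h1
      change (u q).coords _ = _ at h2
      rw [h0, Finsupp.zero_apply] at h2
      exact mul_ne_zero ha.ne' (Finsupp.mem_support_iff.1 h1) h2.symm
    · intro q q' h a ha b hb
      obtain ⟨k, hk, hka⟩ := exists_mem_support_sum ha
      obtain ⟨k', hk', hkb⟩ := exists_mem_support_sum hb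
      exact hz.before _ _ (hsep q q' h k hk k' hk') a hka b hkb
  -- Coefficients may vanish, so the support of `u q` may start later than its first index suggests.
  -- The position is taken from the index set, because the Schreier condition in `IsAvg` concerns
  -- all indices.
  let l : ℕ → ℕ+ := fun q => lo z ((s q).1.min' (hne q))
  have hl : ∀ q, l q ≤ hi u q := by
    intro q
    have h1 := topSupp_mem (hu.ne_zero q)
    obtain ⟨k, hk, hka⟩ := exists_mem_support_sum h1
    exact (hz.lo_strictMono.monotone (Finset.min'_le _ _ hk)).trans (hz.lo_le hka)
  have hl' : ∀ q, hi u q < l (q + 1) := by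
    intro q
    have h1 := topSupp_mem (hu.ne_zero q)
    obtain ⟨k, hk, hka⟩ := exists_mem_support_sum h1
    exact (hz.le_hi hka).trans_lt (hz.hi_lt_lo (hstep q k hk _ (Finset.min'_mem _ (hne (q + 1)))))
  have hlm : StrictMono l := strictMono_nat_of_lt_succ fun q => (hl q).trans_lt (hl' q)
  have hW' : (0 : ℝ) < W := by exact_mod_cast hW0
  obtain ⟨K, c, -, hc⟩ := exists_isSCC hl hl' (P.one_le_n j) (1 / (2 * W)) (by positivity) 0
  let A : ℝ → ℕ → ℝ := fun b k => b * ∑ q ∈ K, if k ∈ (s q).1 then c q * (s q).2 k else 0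
  have hflat : ∀ b : ℝ, b • ∑ q ∈ K, c q • u q =
      ∑ k ∈ K.biUnion fun q => (s q).1, A b k • z k := by
    intro b
    simp only [u, A, Finset.mul_sum, Finset.sum_smul, Finset.smul_sum]
    rw [Finset.sum_comm]
    refine Finset.sum_congr rfl fun q hq => ?_
    simp only [mul_ite, mul_zero, ite_smul, zero_smul]
    rw [Finset.sum_ite_mem,
      Finset.inter_eq_right.2 (Finset.subset_biUnion_of_mem (fun q => (s q).1) hq)]
    refine Finset.sum_congr rfl fun k _ => ?_
    rw [smul_smul, smul_smul, mul_assoc]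
  have hKN : ∀ k ∈ K.biUnion fun q => (s q).1, N ≤ k := by
    intro k hk
    obtain ⟨q, -, hq⟩ := Finset.mem_biUnion.1 hk
    exact hN q k hq
  by_cases hlow : 1 / 100 ≤ ‖∑ q ∈ K, c q • u q‖
  · left
    have h1 := hflat 1
    rw [one_smul] at h1
    refine ⟨_, A 1, hKN, ?_, ?_⟩
    rotate_left
    · rw [← h1]
      exact smallWeightEst_of_isSCC hu (fun q => (hA q).norm_le) hW hW0 hc hlow
    · rw [← h1]
      intro h0
      rw [h0, norm_zero] at hlow
      norm_num at hlow
  · right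
    rw [not_le] at hlow
    -- The combination has norm below `1 / 100`. Multiplied by 100 it has norm at most one, and the
    -- coefficient sum has grown by the factor 100.
    refine ⟨_, A 100, ⟨fun k => ?_, ?_, ?_, ?_⟩, hKN⟩
    rotate_left
    rotate_left
    · rw [← hflat 100, norm_smul, Real.norm_of_nonneg (by norm_num)]
      linarith
    · rw [show (i + 1) * P.n j + 1 = (i * P.n j + 1) + P.n j by ring]
      have hk : ∀ b ∈ (K.biUnion fun q => (s q).1).image (lo z),
          ∃ q ∈ K, ∃ k ∈ (s q).1, b = lo z k := by
        intro b hb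
        obtain ⟨k, hk, rfl⟩ := Finset.mem_image.1 hb
        obtain ⟨q, hq, hk⟩ := Finset.mem_biUnion.1 hk
        exact ⟨q, hq, k, hk, rfl⟩
      choose! q hqK k hkq hbk using hk
      refine Schreier.conv (by omega) (P.one_le_n j) (fun b => l (q b)) ?_ ?_ ?_ hc.schreier
      · intro b hb
        refine ⟨?_, Finset.mem_image_of_mem _ (hqK b hb)⟩
        nth_rewrite 2 [hbk b hb]
        exact hz.lo_strictMono.monotone (Finset.min'_le _ _ (hkq b hb))
      · intro b hb b' hb' hbb
        refine hlm.monotone ?_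
        by_contra hlt
        have := hsep _ _ (not_le.1 hlt) _ (hkq b' hb') _ (hkq b hb)
        rw [hbk b hb, hbk b' hb'] at hbb
        exact absurd hbb (not_le.2 (hz.lo_strictMono this))
      · intro r hr
        obtain ⟨q0, -, rfl⟩ := Finset.mem_image.1 hr
        refine Schreier.subset (by omega) (hA q0).schreier ?_
        intro b hb
        obtain ⟨hb, hbq⟩ := Finset.mem_filter.1 hb
        have h1 := hlm.injective hbq
        rw [← h1]
        exact Finset.mem_image.2 ⟨k b, hkq b hb, (hbk b hb).symm⟩
    · exact mul_nonneg (by norm_num) (Finset.sum_nonneg fun q _ => by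
        split_ifs
        · exact mul_nonneg (hc.nonneg q) ((hA q).nonneg k)
        · exact le_rfl)
    · simp only [A]
      rw [← Finset.mul_sum, Finset.sum_comm, pow_succ, mul_comm]
      congr 1
      have : ∀ q ∈ K, ∑ k ∈ K.biUnion fun q => (s q).1,
          (if k ∈ (s q).1 then c q * (s q).2 k else 0) = c q * 100 ^ i := by
        intro q hq
        rw [Finset.sum_ite_mem,
          Finset.inter_eq_right.2 (Finset.subset_biUnion_of_mem (fun q => (s q).1) hq),
          ← Finset.mul_sum, (hA q).sum_eq]
      rw [Finset.sum_congr rfl this, ← Finset.sum_mul, hc.sum_eq, one_mul]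

theorem exists_smallWeightEst {z : ℕ → C00 P} (hz : IsBlockSeq z) (hn : ∀ k, ‖z k‖ = 1)
    (hlow : LowerEst z) (W N : ℕ) : ∃ x ∈ Submodule.span ℝ (Set.range z), ‖x‖ = 1 ∧
      (∀ i ∈ x.coords.support, N ≤ (i : ℕ)) ∧ SmallWeightEst W x := by
  classical
  let j : ℕ+ := W.succPNat
  have hW : W + 1 ≤ P.m j := P.le_m j
  by_cases hex : ∃ (R : Finset ℕ) (a : ℕ → ℝ), (∀ k ∈ R, N ≤ k) ∧ (∑ k ∈ R, a k • z k) ≠ 0 ∧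
      SmallWeightEst (W + 1) (‖∑ k ∈ R, a k • z k‖⁻¹ • ∑ k ∈ R, a k • z k)
  · obtain ⟨R, a, hR, h0, hest⟩ := hex
    refine ⟨_, ?_, ?_, ?_, fun f hf h1 h2 => hest f hf h1 (by omega)⟩
    · exact Submodule.smul_mem _ _ (Submodule.sum_mem _ fun k _ =>
        Submodule.smul_mem _ _ (Submodule.subset_span ⟨k, rfl⟩))
    · rw [norm_smul, norm_inv, norm_norm, inv_mul_cancel₀ (norm_ne_zero_iff.2 h0)]
    · intro i hi
      rw [C00.coords_smul] at hi
      obtain ⟨k, hk, hki⟩ := exists_mem_support_sum (Finsupp.support_smul hi)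
      have h1 : (lo z k : ℕ) ≤ i := by exact_mod_cast hz.lo_le hki
      exact ((hR k hk).trans (hz.le_lo k)).trans h1
  -- If no combination satisfied the estimates, averages of every level would exist. At level `s`
  -- their coefficient sum is `100 ^ s ≥ m_{j+1} ^ 3` on a set of order `n_{j+1}`. The lower
  -- estimate then gives norm at least `0.98 m_{j+1} ^ 2`, contradicting the bound one.
  · exfalso
    have hall : ∀ i N', N ≤ N' → ∃ R a, IsAvg z j i R a ∧ ∀ k ∈ R, N' ≤ k := by
      intro i
      induction i with
      | zero =>
        intro N' _
        refine ⟨{N'}, fun _ => 1, ⟨fun _ => zero_le_one, by simp, by simp [hn], ?_⟩, by simp⟩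
        rw [Finset.image_singleton]
        exact Schreier.singleton (by omega) _
      | succ i ih =>
        intro N' hN'
        have ih' : ∀ M, ∃ R a, IsAvg z j i R a ∧ ∀ k ∈ R, M ≤ k := by
          intro M
          obtain ⟨R, a, h1, h2⟩ := ih (max N M) (le_max_left _ _)
          exact ⟨R, a, h1, fun k hk => (le_max_right _ _).trans (h2 k hk)⟩
        rcases IsAvg.step hz hW (Nat.succ_pos W) ih' N' with ⟨R, a, h1, h2, h3⟩ | h
        · exact absurd ⟨R, a, fun k hk => hN'.trans (h1 k hk), h2, h3⟩ hex
        · exact h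
    obtain ⟨s, hs1, hs2⟩ := exists_iterations P j
    obtain ⟨R, a, hA, -⟩ := hall s N le_rfl
    have h1 := hlow (j + 1) R a hA.nonneg (Schreier.mono (by omega) hs1 hA.schreier)
    rw [hA.sum_eq] at h1
    have h2 := h1.trans hA.norm_le
    have hm : (100 : ℝ) ≤ P.m (j + 1) := by exact_mod_cast P.hundred_le_m (j + 1)
    have hs3 : (P.m (j + 1) : ℝ) ^ 3 ≤ 100 ^ s := by exact_mod_cast hs2
    have h3 : (98 / 100 : ℝ) * (P.m (j + 1) : ℝ)⁻¹ * (P.m (j + 1) : ℝ) ^ 3 ≤ 1 :=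
      (mul_le_mul_of_nonneg_left hs3 (by positivity)).trans h2
    have h4 : (98 / 100 : ℝ) * (P.m (j + 1) : ℝ)⁻¹ * (P.m (j + 1) : ℝ) ^ 3 =
        98 / 100 * (P.m (j + 1) : ℝ) ^ 2 := by
      field_simp
    rw [h4] at h3
    nlinarith

/-- Up to one exceptional term, a functional acts on the terms of the sequence as its weight
indicates. -/
def IsRIS (x : ℕ → C00 P) : Prop :=
  ∀ g ∈ NormingSet P, ∃ k0, ∀ k, k ≠ k0 →
    |C00.pair g.vec (x k)| ≤ 200 * g.invW P + (2⁻¹ : ℝ) ^ k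

/-- Thresholds `T k` are chosen with `T (k + 1) ≥ 2 ^ k ‖x k‖₁`. A functional of weight below `T k`
obeys the small weight estimate on `x k`; one of weight at least `T (k + 1)` has coefficients so
small that it is at most `2⁻ᵏ` there. The exceptional term is the one with the weight between its
two thresholds; for a unit functional it is the one whose support contains the coordinate. -/
theorem exists_isRIS {z : ℕ → C00 P} (hz : IsBlockSeq z) (hn : ∀ k, ‖z k‖ = 1)
    (hlow : LowerEst z) : ∃ x : ℕ → C00 P, IsBlockSeq x ∧ (∀ k, ‖x k‖ = 1) ∧
      (∀ k, x k ∈ Submodule.span ℝ (Set.range z)) ∧ IsRIS x := by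
  classical
  obtain ⟨x, hx0, hx⟩ := exists_seq_of_step
    (fun _ T (x : C00 P) => x ∈ Submodule.span ℝ (Set.range z) ∧ ‖x‖ = 1 ∧
      (∀ i ∈ x.coords.support, T + 1 ≤ (i : ℕ)) ∧ SmallWeightEst T x)
    (fun n x => max (maxSupp x.coords) ⌈2 ^ n * x.l1⌉₊) 0
    (fun _ T => exists_smallWeightEst hz hn hlow T (T + 1))
  let T : ℕ → ℕ := fun k => match k with
    | 0 => 0
    | k + 1 => max (maxSupp (x k).coords) ⌈2 ^ k * (x k).l1⌉₊
  have hxT : ∀ k, x k ∈ Submodule.span ℝ (Set.range z) ∧ ‖x k‖ = 1 ∧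
      (∀ i ∈ (x k).coords.support, T k + 1 ≤ (i : ℕ)) ∧ SmallWeightEst (T k) (x k) := by
    intro k
    cases k with
    | zero => exact hx0
    | succ k => exact hx k
  have hne : ∀ k, (x k).coords ≠ 0 := by
    intro k h0
    have h1 := (hxT k).2.1
    rw [C00.coords_eq_zero.1 h0, norm_zero] at h1
    exact zero_ne_one h1
  have hTsucc : ∀ k, ∀ i ∈ (x k).coords.support, (i : ℕ) ≤ T (k + 1) := fun k i hi =>
    (le_maxSupp hi).trans (le_max_left _ _)
  have hTl1 : ∀ k, 2 ^ k * (x k).l1 ≤ T (k + 1) := fun k =>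
    (Nat.le_ceil _).trans (Nat.cast_le.2 (le_max_right _ _))
  have hT : StrictMono T := strictMono_nat_of_lt_succ fun k => by
    have h1 := minSupp_mem (hne k)
    have h2 := (hxT k).2.2.1 _ h1
    have h3 := hTsucc k _ h1
    omega
  have hblock : IsBlockSeq x := isBlockSeq_of_succ hne fun k i hi i' hi' => by
    have h1 := hTsucc k i hi
    have h2 := (hxT (k + 1)).2.2.1 i' hi'
    have h3 : (i : ℕ) < i' := by omega
    exact_mod_cast h3
  refine ⟨x, hblock, fun k => (hxT k).2.1, fun k => (hxT k).1, ?_⟩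
  intro g hg
  by_cases h0 : g.idx = []
  · have hlev : g ∈ Level P 0 := by
      rcases normingSet_cases hg with h | h | h
      · exact h
      · exact absurd h0 h.1
      · exact absurd h0 h.idx_ne_nil
    obtain ⟨i, hi⟩ : ∃ i, ∀ a ∈ g.vec.support, a = i := by
      obtain ⟨-, i, h | h⟩ := hlev
      · refine ⟨i, fun a ha => ?_⟩
        rw [h] at ha
        exact Finset.mem_singleton.1 (Finsupp.support_single_subset ha)
      · refine ⟨i, fun a ha => ?_⟩
        rw [h] at ha
        exact Finset.mem_singleton.1 (Finsupp.support_single_subset ha)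
    have hz : ∀ k, i ∉ (x k).coords.support →
        |C00.pair g.vec (x k)| ≤ 200 * g.invW P + (2⁻¹ : ℝ) ^ k := by
      intro k hk
      rw [C00.pair_eq_zero fun a ha => by rwa [hi a ha], abs_zero]
      have := g.invW_nonneg (P := P)
      positivity
    by_cases hex : ∃ k, i ∈ (x k).coords.support
    · obtain ⟨k0, hk0⟩ := hex
      refine ⟨k0, fun k hk => hz k fun hk' => ?_⟩
      rcases hk.lt_or_gt with h | h
      · exact lt_irrefl _ (hblock.before _ _ h _ hk' _ hk0)
      · exact lt_irrefl _ (hblock.before _ _ h _ hk0 _ hk')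
    · push Not at hex
      exact ⟨0, fun k _ => hz k (hex k)⟩
  · have hmain : ∀ k, ¬ (T k ≤ P.prodM g.idx ∧ P.prodM g.idx < T (k + 1)) →
        |C00.pair g.vec (x k)| ≤ 200 * g.invW P + (2⁻¹ : ℝ) ^ k := by
      intro k hk
      have hpos : (0 : ℝ) < 2⁻¹ ^ k := by positivity
      rcases lt_or_ge (P.prodM g.idx) (T k) with h | h
      · have := (hxT k).2.2.2 g hg h0 h
        linarith
      · have h1 : T (k + 1) ≤ P.prodM g.idx := by
          by_contra hlt
          exact hk ⟨h, not_le.1 hlt⟩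
        have h2 := C00.abs_pair_le_l1 (abs_vec_le_inv hg h0) (x k)
        have h3 : 2 ^ k * (x k).l1 ≤ P.prodM g.idx := (hTl1 k).trans (by exact_mod_cast h1)
        have h4 : (P.prodM g.idx : ℝ)⁻¹ * (x k).l1 ≤ 2⁻¹ ^ k := by
          rw [inv_mul_le_iff₀ (P.prodM_pos _), inv_pow, ← div_eq_mul_inv,
            le_div_iff₀ (by positivity)]
          linarith
        have := g.invW_nonneg (P := P)
        linarith
    by_cases hex : ∃ k : ℕ, T k ≤ P.prodM g.idx ∧ P.prodM g.idx < T (k + 1)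
    · obtain ⟨k0, hk0⟩ := hex
      refine ⟨k0, fun k hk => hmain k fun hk' => ?_⟩
      rcases hk.lt_or_gt with h | h
      · have := hT.monotone (Nat.succ_le_of_lt h)
        simp only [Nat.succ_eq_add_one] at this
        omega
      · have := hT.monotone (Nat.succ_le_of_lt h)
        simp only [Nat.succ_eq_add_one] at this
        omega
    · push Not at hex
      exact ⟨0, fun k _ => hmain k fun h => absurd h.2 (not_lt.2 (hex k h.1))⟩

/-- Every block subspace contains a rapidly increasing sequence with lower estimates. -/
theorem exists_isRIS_lowerEst {u : ℕ → C00 P} (hu : IsBlockSeq u) :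
    ∃ x : ℕ → C00 P, IsBlockSeq x ∧ (∀ k, ‖x k‖ = 1) ∧
      (∀ k, x k ∈ Submodule.span ℝ (Set.range u)) ∧ IsRIS x ∧ LowerEst x := by
  have hnorm : ∀ k, ‖u k‖ ≠ 0 := fun k => norm_ne_zero_iff.2 fun h => hu.ne_zero k h
  have hscale : ∀ {v : ℕ → C00 P}, IsBlockSeq v → ∀ s : ℕ → ℝ, (∀ k, s k ≠ 0) →
      IsBlockSeq fun k => s k • v k := by
    intro v hv s hs
    refine ⟨fun k => ?_, fun i k hik => (hv.before i k hik).mono ?_ ?_⟩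
    · rw [C00.coords_smul]
      exact smul_ne_zero (hs k) (hv.ne_zero k)
    · exact Finsupp.support_smul
    · exact Finsupp.support_smul
  have hpm : ∀ {a : ℝ}, a = 1 ∨ a = -1 → a ≠ 0 ∧ |a| = 1 := by
    rintro a (rfl | rfl) <;> norm_num
  have hz := hscale hu (fun k => ‖u k‖⁻¹) fun k => inv_ne_zero (hnorm k)
  have hz1 : ∀ k, ‖‖u k‖⁻¹ • u k‖ = 1 := fun k => by
    rw [norm_smul, norm_inv, norm_norm, inv_mul_cancel₀ (hnorm k)]
  obtain ⟨φ, s, hφ, hs, hL⟩ := exists_lowerEst hz hz1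
  obtain ⟨x, hx, hx1, hxs, hR⟩ := exists_isRIS
    ((hscale hz s fun k => (hpm (hs k)).1).comp hφ)
    (fun k => by rw [norm_smul, hz1, mul_one, Real.norm_eq_abs, (hpm (hs _)).2]) hL
  -- The new vectors need lower estimates of their own, so the extraction is repeated. The estimates
  -- of a rapidly increasing sequence survive, since `ψ k ≥ k` and signs do not matter.
  obtain ⟨ψ, s', hψ, hs', hL'⟩ := exists_lowerEst hx hx1
  refine ⟨_, (hscale hx s' fun k => (hpm (hs' k)).1).comp hψ, fun k => ?_, fun k => ?_, ?_, hL'⟩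
  · rw [norm_smul, hx1, mul_one, Real.norm_eq_abs, (hpm (hs' _)).2]
  · refine Submodule.smul_mem _ _ (Submodule.span_le.2 ?_ (hxs (ψ k)))
    rintro _ ⟨i, rfl⟩
    exact Submodule.smul_mem _ _ (Submodule.smul_mem _ _ (Submodule.subset_span ⟨_, rfl⟩))
  · intro g hg
    obtain ⟨k0, hk0⟩ := hR g hg
    have hmain : ∀ k, ψ k ≠ k0 → |C00.pair g.vec (s' (ψ k) • x (ψ k))| ≤
        200 * g.invW P + (2⁻¹ : ℝ) ^ k := by
      intro k hk
      rw [map_smul, smul_eq_mul, abs_mul, (hpm (hs' _)).2, one_mul]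
      have h1 := hk0 _ hk
      have h2 := half_pow_le_of_le (hψ.le_apply (x := k))
      linarith
    by_cases hex : ∃ k, ψ k = k0
    · obtain ⟨k1, rfl⟩ := hex
      exact ⟨k1, fun k hk => hmain k fun h => hk (hψ.injective h)⟩
    · push Not at hex
      exact ⟨0, fun k _ => hmain k (hex k)⟩

/-! ### Exact vectors -/

/-- The largest index of a weight tuple (`0` for the empty tuple). -/
def maxIdx (js : List ℕ+) : ℕ := js.foldr (fun j a => max (j : ℕ) a) 0

theorem le_maxIdx {js : List ℕ+} {j : ℕ+} (h : j ∈ js) : (j : ℕ) ≤ maxIdx js := by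
  induction js with
  | nil => simp at h
  | cons i js ih =>
    rcases List.mem_cons.1 h with rfl | h
    · exact le_max_left _ _
    · exact (ih h).trans (le_max_right _ _)

theorem exists_mem_eq_maxIdx {js : List ℕ+} (h : js ≠ []) : ∃ j ∈ js, (j : ℕ) = maxIdx js := by
  induction js with
  | nil => exact absurd rfl h
  | cons i js ih =>
    change ∃ j ∈ i :: js, (j : ℕ) = max (i : ℕ) (maxIdx js)
    rcases le_total (maxIdx js) i with h' | h'
    · exact ⟨i, by simp, (max_eq_left h').symm⟩
    · by_cases h0 : js = []
      · subst h0
        refine ⟨i, by simp, ?_⟩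
        simp [maxIdx]
      · obtain ⟨j, hj, hj'⟩ := ih h0
        exact ⟨j, List.mem_cons_of_mem _ hj, by rw [hj', max_eq_right h']⟩

/-- A tuple of weight less than `j² m_j²` and largest index different from `j` only has indices
smaller than `j`. -/
theorem sum_n_lt_of_maxIdx_ne {js : List ℕ+} {j : ℕ+} (h : maxIdx js ≠ j)
    (hw : P.prodM js < (j : ℕ) ^ 2 * P.m j ^ 2) : (js.map P.n).sum < P.n j := by
  refine sum_n_lt P (fun i hi => ?_) (hw.trans_le ?_)
  · have hne : js ≠ [] := List.ne_nil_of_mem hi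
    have h1 : maxIdx js < j := by
      by_contra hlt
      obtain ⟨k, hk, hk'⟩ := exists_mem_eq_maxIdx hne
      have h2 : j < k := by
        have : (j : ℕ) < k := by omega
        exact_mod_cast this
      -- An index above `j` would by itself make the weight at least `m_{j+1} ≥ j² m_j²`.
      have h3 := P.m_strictMono.monotone (PNat.add_one_le_iff.2 h2)
      exact absurd (((P.m_growth j).trans h3).trans (m_le_prodM P hk)) (not_le.2 hw)
    have h2 : (i : ℕ) < j := (le_maxIdx hi).trans_lt h1
    exact_mod_cast h2
  · have h1 := P.le_m j
    calc (j : ℕ) ^ 2 * P.m j ^ 2 ≤ P.m j ^ 2 * P.m j ^ 2 :=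
          Nat.mul_le_mul_right _ (Nat.pow_le_pow_left h1 2)
      _ = P.m j ^ 4 := by ring

/-- A vector on which only the functionals of largest weight index `j` act substantially. -/
def IsExact (j : ℕ+) (κ : ℝ) (y : C00 P) : Prop :=
  ∀ h ∈ NormingSet P, h.idx ≠ [] → ∀ L, IsDecomp P h.idx L → h.vec = avg P h.idx L →
    maxIdx h.idx ≠ j → ∀ t : ℕ,
    (∀ g ∈ L, maxIdx g.idx ≠ j ∧ ((2 ^ t : ℕ) : ℕ∞) ≤ g.weight P) →
    |C00.pair h.vec y| ≤ κ + (2⁻¹ : ℝ) ^ t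

section

variable {x : ℕ → C00 P} {j : ℕ+} {ε : ℝ} {K : Finset ℕ} {c : ℕ → ℝ} {T : ℕ}

/-- The exceptional term costs one coefficient, at most `ε`; the errors `2⁻ᵏ` average to at most
`ε`, since `k ≥ T`. -/
theorem abs_pair_ris_le (hn : ∀ k, ‖x k‖ = 1) (hR : IsRIS x)
    (hc : IsSCC (lo x) (hi x) (P.n j) ε K c) (hT : (2⁻¹ : ℝ) ^ T ≤ ε) (hK : ∀ k ∈ K, T ≤ k)
    {g : WFun} (hg : g ∈ NormingSet P) :
    |C00.pair g.vec (∑ k ∈ K, c k • x k)| ≤ 200 * g.invW P + 2 * ε := by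
  classical
  obtain ⟨e, he⟩ := hR g hg
  rw [IsBlockSeq.pair_sum]
  refine (Finset.abs_sum_le_sum_abs _ _).trans ?_
  have hi := g.invW_nonneg (P := P)
  have hε : 0 ≤ ε := le_trans (by positivity) hT
  have hterm : ∀ k ∈ K, |c k * C00.pair g.vec (x k)| ≤
      c k * (200 * g.invW P + ε) + if k = e then ε else 0 := by
    intro k hk
    have hck := hc.nonneg k
    rw [abs_mul, abs_of_nonneg hck]
    split_ifs with h
    · have h1 : |C00.pair g.vec (x k)| ≤ 1 := (C00.abs_pair_le_norm hg _).trans (hn k).le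
      have h2 := mul_le_mul_of_nonneg_left h1 hck
      have h3 := hc.le k hk
      have h4 : 0 ≤ c k * (200 * g.invW P + ε) := by positivity
      linarith
    · rw [add_zero]
      refine mul_le_mul_of_nonneg_left ((he k h).trans ?_) hck
      have := half_pow_le_of_le (hK k hk)
      linarith
  refine (Finset.sum_le_sum hterm).trans ?_
  rw [Finset.sum_add_distrib, ← Finset.sum_mul, hc.sum_eq, one_mul, Finset.sum_ite_eq']
  split_ifs <;> linarith

/-- Only the first constituent `b` that reaches `T` can have small weight; all later ones have
weight at least `2 ^ T` and act on nonexceptional terms by at most `201 ε`. The tail is a difference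
of two functionals bounded by one on each `x k`, hence `M = 2`, and `2 · 2 ε + 201 ε = 205 ε`. -/
theorem abs_pair_first_le (hx : IsBlockSeq x) (hn : ∀ k, ‖x k‖ = 1) (hR : IsRIS x)
    (hc : IsSCC (lo x) (hi x) (P.n j) ε K c) (hT : (2⁻¹ : ℝ) ^ T ≤ ε) (hK : ∀ k ∈ K, T ≤ k)
    {h : WFun} (hh : h ∈ NormingSet P) (h0 : h.idx ≠ [])
    {L : List WFun} (hL : IsDecomp P h.idx L) (hv : h.vec = avg P h.idx L)
    (hp : (h.idx.map P.n).sum < P.n j) :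
    |C00.pair h.vec (∑ k ∈ K, c k • x k)| ≤ 205 * ε ∨
    ∃ b ∈ L, |C00.pair h.vec (∑ k ∈ K, c k • x k)| ≤
      (P.prodM h.idx : ℝ)⁻¹ * |C00.pair b.vec (∑ k ∈ K, c k • x k)| + 205 * ε := by
  have hε : 0 ≤ ε := le_trans (by positivity) hT
  have hsx : ∀ k ∈ K, ∀ i ∈ (x k).coords.support, T ≤ (i : ℕ) := by
    intro k hk i hi
    have h1 : (lo x k : ℕ) ≤ i := by exact_mod_cast hx.lo_le hi
    exact ((hK k hk).trans (hx.le_lo k)).trans h1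
  have hsv : ∀ i ∈ (∑ k ∈ K, c k • x k).coords.support, T ≤ (i : ℕ) := by
    intro i hi
    obtain ⟨k, hk, hki⟩ := exists_mem_support_sum hi
    exact hsx k hk i hki
  rcases exists_first (fun g : WFun => T ≤ maxSupp g.vec) L with hA | ⟨A, b, D, rfl, hA, hb⟩
  · left
    rw [hv, pair_avg_eq_zero_of_lt (fun g hg => not_le.1 (hA g hg)) hsv, abs_zero]
    positivity
  · right
    refine ⟨b, by simp, ?_⟩
    have hw := P.prodM_pos h.idx
    have hw1 : (P.prodM h.idx : ℝ)⁻¹ ≤ 1 := Nat.cast_inv_le_one _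
    have hbv : ∀ v : C00 P, C00.pair (avg P h.idx [b]) v =
        (P.prodM h.idx : ℝ)⁻¹ * C00.pair b.vec v := by
      intro v
      rw [avg, C00.pair_smul_left]
      simp
    have hsplit : ∀ v : C00 P, (∀ i ∈ v.coords.support, T ≤ (i : ℕ)) → C00.pair h.vec v =
        (P.prodM h.idx : ℝ)⁻¹ * C00.pair b.vec v + C00.pair (avg P h.idx D) v := by
      intro v hTv
      rw [hv, show A ++ b :: D = A ++ ([b] ++ D) by simp, avg_append, avg_append,
        C00.pair_add_left, C00.pair_add_left,
        pair_avg_eq_zero_of_lt (fun g hg => not_le.1 (hA g hg)) hTv, zero_add, hbv]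
    have hDL : D.Sublist (A ++ b :: D) :=
      (List.sublist_cons_self b D).trans (List.sublist_append_right _ _)
    have hD := hL.sublist h0 hDL
    have hbN : b ∈ NormingSet P := hL.mem b (by simp)
    have hDw : ∀ g ∈ D, g.invW P ≤ ε := by
      intro g hg
      have h1 := (List.pairwise_cons.1 (List.pairwise_append.1 hL.fast).2.1).1 g hg
      exact (g.invW_le_half_pow (two_pow_le_weight hb h1)).trans hT
    have hmain := hx.abs_pair_avg_le hc hD.ne_zero hD.successive (one_le_sum_n P h0) hp hD.admissible
      (M := 2) (η := 201 * ε) (js := h.idx) (by norm_num) (by positivity) (by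
        intro k hk
        have h1 := hsplit (x k) (hsx k hk)
        have h2 := (C00.abs_pair_le_norm hh (x k)).trans (hn k).le
        have h3 := (C00.abs_pair_le_norm hbN (x k)).trans (hn k).le
        have h4 : |(P.prodM h.idx : ℝ)⁻¹ * C00.pair b.vec (x k)| ≤ 1 := by
          rw [abs_mul, abs_of_pos (inv_pos.2 hw)]
          exact mul_le_one₀ hw1 (abs_nonneg _) h3
        have h5 : C00.pair (avg P h.idx D) (x k) = C00.pair h.vec (x k) -
            (P.prodM h.idx : ℝ)⁻¹ * C00.pair b.vec (x k) := by linarith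
        rw [h5]
        exact (abs_sub _ _).trans (by linarith)) (by
        intro g hg
        obtain ⟨e, he⟩ := hR g (hD.mem g hg)
        refine ⟨e, fun k hk hke => (he k hke).trans ?_⟩
        have h1 := half_pow_le_of_le (hK k hk)
        have h2 := hDw g hg
        linarith)
    rw [hsplit _ hsv]
    refine (abs_add_le _ _).trans ?_
    rw [abs_mul, abs_of_pos (inv_pos.2 hw)]
    have h6 : (P.prodM h.idx : ℝ)⁻¹ * (201 * ε) ≤ 201 * ε :=
      mul_le_of_le_one_left (by positivity) hw1
    linarith

end

/-- The vector is a normalized special convex combination `v` of order `n_j`; the lower estimate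
bounds the normalizing factor by `2 m_j`. Functionals of weight at least `j² m_j²` remain small
after normalization. Lighter ones with largest index different from `j` have order below `n_j` and
reduce to a single constituent. -/
theorem exists_isExact {x : ℕ → C00 P} (hx : IsBlockSeq x) (hn : ∀ k, ‖x k‖ = 1) (hR : IsRIS x)
    (hL : LowerEst x) {κ : ℝ} (hκ : 0 < κ) : ∃ J : ℕ, ∀ j : ℕ+, J ≤ j → ∀ N : ℕ,
    ∃ y ∈ Submodule.span ℝ (Set.range x), ‖y‖ = 1 ∧ (∀ i ∈ y.coords.support, N ≤ (i : ℕ)) ∧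
      IsExact j κ y := by
  -- With this bound on `j` the term `2 m_j · 200 / (j² m_j²)` is at most `κ / 4`.
  obtain ⟨J, hJ⟩ := exists_nat_gt (1600 / κ)
  refine ⟨J, fun j hj N => ?_⟩
  have hm : (100 : ℝ) ≤ P.m j := by exact_mod_cast P.hundred_le_m j
  have hm0 : (0 : ℝ) < P.m j := by linarith
  set ε : ℝ := κ / (1000 * P.m j) with hε
  have hε0 : 0 < ε := by positivity
  have hεm : P.m j * ε = κ / 1000 := by
    rw [hε]
    field_simp
  obtain ⟨T0, hT0⟩ := exists_pow_lt_of_lt_one hε0 (by norm_num : (2⁻¹ : ℝ) < 1)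
  set T := max N T0
  have hT : (2⁻¹ : ℝ) ^ T ≤ ε := (half_pow_le_of_le (le_max_right N T0)).trans hT0.le
  obtain ⟨K, c, hK, hc⟩ := hx.exists_isSCC (P.one_le_n j) hε0 T
  set v := ∑ k ∈ K, c k • x k with hv
  have hlow := hL j K c hc.nonneg hc.schreier
  rw [hc.sum_eq, mul_one, ← hv] at hlow
  have hv0 : 0 < ‖v‖ := lt_of_lt_of_le (by positivity) hlow
  have hθ : ‖v‖⁻¹ ≤ 2 * P.m j := by
    rw [inv_le_comm₀ hv0 (by positivity)]
    refine le_trans ?_ hlow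
    rw [mul_inv]
    have : 0 < (P.m j : ℝ)⁻¹ := by positivity
    linarith
  have hθ0 : 0 < ‖v‖⁻¹ := inv_pos.2 hv0
  have hy1 : ‖‖v‖⁻¹ • v‖ = 1 := by rw [norm_smul, norm_inv, norm_norm, inv_mul_cancel₀ hv0.ne']
  have hpy : ∀ g : WFun, |C00.pair g.vec (‖v‖⁻¹ • v)| = ‖v‖⁻¹ * |C00.pair g.vec v| := by
    intro g
    rw [map_smul, smul_eq_mul, abs_mul, abs_of_pos hθ0]
  refine ⟨‖v‖⁻¹ • v, ?_, hy1, ?_, ?_⟩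
  · exact Submodule.smul_mem _ _ (Submodule.sum_mem _ fun k _ =>
      Submodule.smul_mem _ _ (Submodule.subset_span ⟨k, rfl⟩))
  · intro i hi
    rw [C00.coords_smul] at hi
    obtain ⟨k, hk, hki⟩ := exists_mem_support_sum (Finsupp.support_smul hi)
    have h1 : (lo x k : ℕ) ≤ i := by exact_mod_cast hx.lo_le hki
    exact (((le_max_left N T0).trans (hK k hk)).trans (hx.le_lo k)).trans h1
  have hjm : 400 * (P.m j * (((j : ℕ) : ℝ) ^ 2 * (P.m j : ℝ) ^ 2)⁻¹) ≤ κ / 4 := by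
    have hj1 : (1 : ℝ) ≤ ((j : ℕ) : ℝ) := by exact_mod_cast j.pos
    have h1 : (P.m j : ℝ) * (((j : ℕ) : ℝ) ^ 2 * (P.m j : ℝ) ^ 2)⁻¹ =
        (((j : ℕ) : ℝ) ^ 2 * P.m j)⁻¹ := by
      field_simp
    have h2 : 1600 / κ ≤ ((j : ℕ) : ℝ) ^ 2 * P.m j := by
      have h3 : (J : ℝ) ≤ ((j : ℕ) : ℝ) := by exact_mod_cast hj
      have h4 : ((j : ℕ) : ℝ) ≤ ((j : ℕ) : ℝ) ^ 2 * P.m j := by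
        have h5 : ((j : ℕ) : ℝ) ≤ ((j : ℕ) : ℝ) ^ 2 := le_self_pow₀ hj1 (by norm_num)
        have h6 : ((j : ℕ) : ℝ) ^ 2 ≤ ((j : ℕ) : ℝ) ^ 2 * P.m j :=
          le_mul_of_one_le_right (by positivity) (by linarith)
        linarith
      linarith
    rw [h1]
    have h3 := inv_anti₀ (by positivity) h2
    rw [inv_div] at h3
    linarith
  have hbig : ∀ g ∈ NormingSet P, g.invW P ≤ (((j : ℕ) : ℝ) ^ 2 * (P.m j : ℝ) ^ 2)⁻¹ →
      |C00.pair g.vec (‖v‖⁻¹ • v)| ≤ κ / 2 := by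
    intro g hg hgw
    rw [hpy]
    have h1 := abs_pair_ris_le hn hR hc hT hK hg
    rw [← hv] at h1
    calc ‖v‖⁻¹ * |C00.pair g.vec v|
        ≤ (2 * P.m j) * (200 * (((j : ℕ) : ℝ) ^ 2 * (P.m j : ℝ) ^ 2)⁻¹ + 2 * ε) :=
          mul_le_mul hθ (h1.trans (by linarith)) (abs_nonneg _) (by positivity)
      _ = 400 * (P.m j * (((j : ℕ) : ℝ) ^ 2 * (P.m j : ℝ) ^ 2)⁻¹) + 4 * (P.m j * ε) := by ring
      _ ≤ κ / 2 := by
        rw [hεm]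
        linarith
  have hsmall : ∀ h ∈ NormingSet P, h.idx ≠ [] → ∀ L, IsDecomp P h.idx L →
      h.vec = avg P h.idx L → maxIdx h.idx ≠ j → P.prodM h.idx < (j : ℕ) ^ 2 * P.m j ^ 2 →
      |C00.pair h.vec (‖v‖⁻¹ • v)| ≤ κ / 2 ∨ ∃ b ∈ L, |C00.pair h.vec (‖v‖⁻¹ • v)| ≤
        (P.prodM h.idx : ℝ)⁻¹ * |C00.pair b.vec (‖v‖⁻¹ • v)| + κ / 2 := by
    intro h hh h0 L hL hvec hidx hw
    have hθε : ‖v‖⁻¹ * (205 * ε) ≤ κ / 2 := by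
      calc ‖v‖⁻¹ * (205 * ε) ≤ (2 * P.m j) * (205 * ε) :=
            mul_le_mul_of_nonneg_right hθ (by positivity)
        _ = 410 * (P.m j * ε) := by ring
        _ ≤ κ / 2 := by
          rw [hεm]
          linarith
    rcases abs_pair_first_le hx hn hR hc hT hK hh h0 hL hvec (sum_n_lt_of_maxIdx_ne hidx hw) with
      h1 | ⟨b, hb, h1⟩
    · left
      rw [hpy]
      exact (mul_le_mul_of_nonneg_left h1 hθ0.le).trans hθε
    · right
      refine ⟨b, hb, ?_⟩
      rw [hpy, hpy]
      have h2 := mul_le_mul_of_nonneg_left h1 hθ0.le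
      rw [← hv] at h2
      calc _ ≤ _ := h2
        _ = (P.prodM h.idx : ℝ)⁻¹ * (‖v‖⁻¹ * |C00.pair b.vec v|) + ‖v‖⁻¹ * (205 * ε) := by ring
        _ ≤ _ := by linarith
  have hinv : ∀ g : WFun, g.idx ≠ [] → ¬ P.prodM g.idx < (j : ℕ) ^ 2 * P.m j ^ 2 →
      g.invW P ≤ (((j : ℕ) : ℝ) ^ 2 * (P.m j : ℝ) ^ 2)⁻¹ := by
    intro g h0 hw
    rw [WFun.invW, if_neg h0]
    have hj1 : (0 : ℝ) < ((j : ℕ) : ℝ) := by exact_mod_cast j.pos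
    exact inv_anti₀ (by positivity) (by exact_mod_cast not_lt.1 hw)
  intro h hh h0 L hL hvec hidx t hg
  have ht : (0 : ℝ) < 2⁻¹ ^ t := by positivity
  by_cases hw : P.prodM h.idx < (j : ℕ) ^ 2 * P.m j ^ 2
  · rcases hsmall h hh h0 L hL hvec hidx hw with h1 | ⟨b, hb, h1⟩
    · linarith
    · have hw1 : (P.prodM h.idx : ℝ)⁻¹ ≤ 1 := Nat.cast_inv_le_one _
      have hbN := hL.mem b hb
      have h2 : |C00.pair b.vec (‖v‖⁻¹ • v)| ≤ κ / 2 + 2⁻¹ ^ t := by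
        by_cases hb0 : b.idx = []
        · have h3 := hbig b hbN (by
            rw [WFun.invW, if_pos hb0]
            positivity)
          linarith
        · by_cases hbw : P.prodM b.idx < (j : ℕ) ^ 2 * P.m j ^ 2
          -- The reduction is applied a second time, now to the constituent `b`. Its own constituent
          -- is bounded by one, and the weight of `b` supplies the factor `2⁻ᵗ`.
          · obtain ⟨L', hL', hv'⟩ := exists_isDecomp hbN hb0
            rcases hsmall b hbN hb0 L' hL' hv' (hg b hb).1 hbw with h3 | ⟨b', hb', h3⟩
            · linarith
            · have h4 := (C00.abs_pair_le_norm (hL'.mem b' hb') (‖v‖⁻¹ • v)).trans hy1.le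
              have h5 := b.invW_le_half_pow (hg b hb).2
              rw [WFun.invW, if_neg hb0] at h5
              have h6 : (P.prodM b.idx : ℝ)⁻¹ * |C00.pair b'.vec (‖v‖⁻¹ • v)| ≤
                  (P.prodM b.idx : ℝ)⁻¹ :=
                mul_le_of_le_one_right (inv_pos.2 (P.prodM_pos _)).le h4
              linarith
          · have h3 := hbig b hbN (hinv b hb0 hbw)
            linarith
      have h3 : (P.prodM h.idx : ℝ)⁻¹ * |C00.pair b.vec (‖v‖⁻¹ • v)| ≤
          |C00.pair b.vec (‖v‖⁻¹ • v)| := mul_le_of_le_one_left (abs_nonneg _) hw1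
      linarith
  · have h1 := hbig h hh (hinv h h0 hw)
    linarith

/-! ### The enumeration of the tree -/

/-- The number of a node, counted from the number `k` of the node at which the path starts. -/
def numFrom (k : ℕ) (l : List Bool) : ℕ := l.foldl (fun k b => 2 * k + 1 + b.toNat) k

/-- The number of a node in the lexicographic enumeration. -/
def num (l : List Bool) : ℕ := numFrom 0 l

theorem enum_two_mul (k : ℕ) (b : Bool) :
    Node.enum (2 * k + 1 + b.toNat) = Node.enum k ++ [b] := by
  cases b
  · rw [show 2 * k + 1 + false.toNat = 2 * k + 1 by rfl, Node.enum]
    rw [show 2 * k / 2 = k by omega, show 2 * k % 2 = 0 by omega]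
    simp
  · rw [show 2 * k + 1 + true.toNat = (2 * k + 1) + 1 by rfl, Node.enum]
    rw [show (2 * k + 1) / 2 = k by omega, show (2 * k + 1) % 2 = 1 by omega]
    simp

theorem enum_numFrom (l : List Bool) : ∀ k, Node.enum (numFrom k l) = Node.enum k ++ l := by
  induction l with
  | nil => intro k; simp [numFrom]
  | cons b l ih =>
    intro k
    change Node.enum (numFrom (2 * k + 1 + b.toNat) l) = _
    rw [ih, enum_two_mul]
    simp

theorem enum_num (l : List Bool) : Node.enum (num l) = l := by
  rw [num, enum_numFrom]
  simp [Node.enum]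

theorem num_injective : Function.Injective num := Function.LeftInverse.injective enum_num

/-- The descendants of node `k` at relative depth `d` have the numbers from `(k + 1) 2ᵈ - 1` to `(k
+ 2) 2ᵈ - 2`. Comparing such intervals orders nodes of different heights, and nodes of equal height
at their first difference. -/
theorem numFrom_bounds (l : List Bool) : ∀ k, (k + 1) * 2 ^ l.length ≤ numFrom k l + 1 ∧
    numFrom k l + 1 < (k + 2) * 2 ^ l.length := by
  induction l with
  | nil => intro k; simp [numFrom]
  | cons b l ih =>
    intro k
    change _ ≤ numFrom (2 * k + 1 + b.toNat) l + 1 ∧ numFrom (2 * k + 1 + b.toNat) l + 1 < _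
    obtain ⟨h1, h2⟩ := ih (2 * k + 1 + b.toNat)
    have hb : b.toNat ≤ 1 := Bool.toNat_le b
    rw [List.length_cons, pow_succ]
    have h3 : 0 < 2 ^ l.length := by positivity
    constructor <;> nlinarith

theorem numFrom_lt_of_lex {s t : List Bool} (h : List.Lex (· < ·) s t) :
    s.length = t.length → ∀ k, numFrom k s < numFrom k t := by
  induction h with
  | nil => intro h; simp at h
  | cons h ih =>
    intro hl k
    exact ih (by simpa using hl) _
  | @rel a s b t hab =>
    intro hl k
    obtain ⟨rfl, rfl⟩ := Bool.lt_iff.1 hab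
    change numFrom (2 * k + 1 + false.toNat) s < numFrom (2 * k + 1 + true.toNat) t
    have h1 := (numFrom_bounds s (2 * k + 1 + false.toNat)).2
    have h2 := (numFrom_bounds t (2 * k + 1 + true.toNat)).1
    have hl' : s.length = t.length := by simpa using hl
    rw [hl'] at h1
    simp only [Bool.toNat_false, Bool.toNat_true] at h1 h2 ⊢
    have h3 : 2 * k + 1 + 0 + 2 = 2 * k + 1 + 1 + 1 := by ring
    rw [h3] at h1
    omega

theorem num_lt_of_lexLT {l l' : Node} (h : Node.LexLT l l') : num l < num l' := by
  rcases List.shortlex_def.1 h with h1 | ⟨h1, h2⟩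
  · have h3 := (numFrom_bounds l 0).2
    have h4 := (numFrom_bounds l' 0).1
    have h5 := Nat.pow_le_pow_right (show 0 < 2 by norm_num) (Nat.succ_le_of_lt h1)
    rw [Nat.succ_eq_add_one, pow_succ] at h5
    change numFrom 0 l < numFrom 0 l'
    omega
  · exact numFrom_lt_of_lex h2 h1 0

theorem length_le_num (l : List Bool) : l.length ≤ num l := by
  have h1 := (numFrom_bounds l 0).1
  have h2 := Nat.lt_two_pow_self (n := l.length)
  rw [num]
  omega

theorem le_meetHeight_of_dist_le {a b : Node} {n : ℕ} (h : dist a b ≤ (2⁻¹ : ℝ) ^ n) (hne : a ≠ b) :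
    n ≤ Node.meetHeight a b := by
  classical
  rw [Node.dist_def, if_neg hne] at h
  exact (pow_le_pow_iff_right_of_lt_one₀ (by norm_num) (by norm_num)).1 h

theorem take_eq_of_le_meetHeight : ∀ {n : ℕ} {a b : List Bool}, n ≤ Node.meetHeight a b →
    a.take n = b.take n
  | 0, _, _, _ => by simp
  | n + 1, [], [], _ => rfl
  | n + 1, [], _ :: _, h => by simp [Node.meetHeight] at h
  | n + 1, _ :: _, [], h => by simp [Node.meetHeight] at h
  | n + 1, a :: s, b :: t, h => by
    rw [Node.meetHeight] at h
    split_ifs at h with hab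
    · rw [List.take_succ_cons, List.take_succ_cons, hab,
        take_eq_of_le_meetHeight (a := s) (b := t) (n := n) (by omega)]
    · omega

theorem take_eq_of_dist_le {a b : Node} {n : ℕ} (h : dist a b ≤ (2⁻¹ : ℝ) ^ n) :
    List.take n (show List Bool from a) = List.take n (show List Bool from b) := by
  by_cases hne : a = b
  · rw [hne]
  · exact take_eq_of_le_meetHeight (le_meetHeight_of_dist_le h hne)

/-! ### The tree of exact vectors -/

/-- A collection of normalized exact vectors, indexed by the tree, the weight indices of which
follow the nodes. -/
structure IsExactTree (y : Node → C00 P) (w : Node → ℕ+) : Prop where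
  norm_eq : ∀ l, ‖y l‖ = 1
  before : ∀ l l', num l < num l' → Before (y l).coords (y l').coords
  le_support : ∀ l : Node, ∀ i ∈ (y l).coords.support, List.length (α := Bool) l + 10 ≤ (i : ℕ)
  le_node : ∀ l : Node, (show List Bool from l) <+: Node.enum (w l)
  exact : ∀ l, IsExact (w l) ((2⁻¹ : ℝ) ^ num l / 40) (y l)

/-- Padding with zeros gives arbitrarily late nodes above `l`. Exactness is available only for large
indices, so the index of `y_λ` has to be the number of such a descendant. -/
theorem exists_index_ge (l : List Bool) (J : ℕ) : ∃ j : ℕ+, J ≤ j ∧ l <+: Node.enum j := by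
  let l' := l ++ List.replicate (J + 1) false
  have h := length_le_num l'
  rw [List.length_append, List.length_replicate] at h
  refine ⟨⟨num l', by omega⟩, ?_, ?_⟩
  · change J ≤ num l'
    omega
  · change l <+: Node.enum (num l')
    rw [enum_num]
    exact List.prefix_append _ _

theorem exists_isExactTree {u : ℕ → C00 P} (hu : IsBlockSeq u) :
    ∃ (y : Node → C00 P) (w : Node → ℕ+), IsExactTree y w ∧
      ∀ l, y l ∈ Submodule.span ℝ (Set.range u) := by
  obtain ⟨x, hx, hn, hxu, hR, hL⟩ := exists_isRIS_lowerEst hu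
  have hsub : Submodule.span ℝ (Set.range x) ≤ Submodule.span ℝ (Set.range u) := by
    rw [Submodule.span_le]
    rintro _ ⟨k, rfl⟩
    exact hxu k
  obtain ⟨s, hs0, hs⟩ := exists_seq_of_step
    (fun n T (y : C00 P) => y ∈ Submodule.span ℝ (Set.range u) ∧ ‖y‖ = 1 ∧
      (∀ i ∈ y.coords.support, T + n + 10 ≤ (i : ℕ)) ∧
      ∃ j : ℕ+, Node.enum n <+: Node.enum j ∧ IsExact j ((2⁻¹ : ℝ) ^ n / 40) y)
    (fun _ y => maxSupp y.coords) 0 (by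
      intro n T
      obtain ⟨J, hJ⟩ := exists_isExact hx hn hR hL (κ := (2⁻¹ : ℝ) ^ n / 40) (by positivity)
      obtain ⟨j, hj, hpre⟩ := exists_index_ge (Node.enum n) J
      -- The margin `n + 10` keeps vectors above height `N` supported from `N + 10` on, where
      -- functionals will be cut; the number of a node is at least its height.
      obtain ⟨y, hy1, hy2, hy3, hy4⟩ := hJ j hj (T + n + 10)
      exact ⟨y, hsub hy1, hy2, hy3, j, hpre, hy4⟩)
  have hall : ∀ n, s n ∈ Submodule.span ℝ (Set.range u) ∧ ‖s n‖ = 1 ∧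
      (∀ i ∈ (s n).coords.support, n + 10 ≤ (i : ℕ)) ∧
      ∃ j : ℕ+, Node.enum n <+: Node.enum j ∧ IsExact j ((2⁻¹ : ℝ) ^ n / 40) (s n) := by
    intro n
    cases n with
    | zero =>
      obtain ⟨h1, h2, h3, h4⟩ := hs0
      exact ⟨h1, h2, fun i hi => by have := h3 i hi; omega, h4⟩
    | succ n =>
      obtain ⟨h1, h2, h3, h4⟩ := hs n
      exact ⟨h1, h2, fun i hi => by have := h3 i hi; omega, h4⟩
  have hblock : IsBlockSeq s := by
    refine isBlockSeq_of_succ (fun k h0 => ?_) fun k i hi i' hi' => ?_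
    · have h1 := (hall k).2.1
      rw [C00.coords_eq_zero.1 h0, norm_zero] at h1
      exact zero_ne_one h1
    · have h1 := (hs k).2.2.1 i' hi'
      have h2 := le_maxSupp hi
      have h3 : (i : ℕ) < i' := by omega
      exact_mod_cast h3
  choose h1 h2 h3 j h4 h5 using hall
  refine ⟨fun l => s (num l), fun l => j (num l), ⟨fun l => h2 _, fun l l' h => hblock.before _ _ h,
    fun l i hi => ?_, fun l => ?_, fun l => h5 _⟩, fun l => h1 _⟩
  · have h6 := h3 _ i hi
    have h7 := length_le_num l
    omega
  · have h6 := h4 (num l)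
    have h7 : Node.enum (num l) = l := enum_num l
    rwa [h7] at h6

/-! ### Estimates on fronts of the tree of exact vectors -/

theorem avg_sublist_eq_res {f : WFun} (h0 : f.idx ≠ []) {A D : List WFun}
    (hL : IsDecomp P f.idx (A ++ D)) (hv : f.vec = avg P f.idx (A ++ D)) :
    (f.res {i | ∃ g ∈ D, i ∈ g.vec.support}).vec = avg P f.idx D := by
  classical
  have hD := hL.sublist h0 (List.sublist_append_right A D)
  rw [WFun.res_vec]
  ext i
  rw [Finsupp.filter_apply]
  split_ifs with h
  · obtain ⟨g, hg, hi⟩ := h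
    rw [hv, avg, avg, Finsupp.smul_apply, Finsupp.smul_apply,
      hL.successive.sum_apply (List.mem_append_right _ hg) hi, hD.successive.sum_apply hg hi]
  · symm
    rw [← Finsupp.notMem_support_iff, support_avg]
    exact fun hi => h (exists_mem_support_of_sum hi)

/-- Codes that extend nodes above different sequences of length `N` already differ in their first
`N` entries. This turns closeness of nodes into uniqueness of the matched term. -/
theorem eq_of_take_eq {N : ℕ} {μ : (Fin N → Bool) → Node} (hμ : ∀ l, Node.ofFn l ≤ μ l)
    {l l' : Fin N → Bool} {c c' : List Bool} (h : (show List Bool from μ l) <+: c)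
    (h' : (show List Bool from μ l') <+: c') (hc : c.take N = c'.take N) : l = l' := by
  have h1 : ∀ (l : Fin N → Bool) (c : List Bool), (show List Bool from μ l) <+: c →
      List.ofFn l = c.take N := by
    intro l c h
    have h2 : List.ofFn l <+: c := List.IsPrefix.trans (hμ l) h
    have h3 := List.prefix_iff_eq_take.1 h2
    rwa [List.length_ofFn] at h3
  exact List.ofFn_injective ((h1 l c h).trans (hc.trans (h1 l' c' h').symm))

theorem sum_ite_le_of_subsingleton {ι : Type*} [Fintype ι] (p : ι → Prop) [DecidablePred p]
    (hp : ∀ i j, p i → p j → i = j) {M : ℝ} (hM : 0 ≤ M) :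
    ∑ i, (if p i then M else 0) ≤ M := by
  rw [← Finset.sum_filter, Finset.sum_const, nsmul_eq_mul]
  have : (Finset.univ.filter p).card ≤ 1 := by
    rw [Finset.card_le_one]
    intro i hi j hj
    exact hp i j (Finset.mem_filter.1 hi).2 (Finset.mem_filter.1 hj).2
  have h : ((Finset.univ.filter p).card : ℝ) ≤ 1 := by exact_mod_cast this
  exact mul_le_of_le_one_left hM h

namespace IsExactTree

variable {y : Node → C00 P} {w : Node → ℕ+} {N : ℕ} {μ : (Fin N → Bool) → Node}

theorem eq_of_mem_support (hy : IsExactTree y w) {l l' : Node} {i : ℕ+}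
    (h : i ∈ (y l).coords.support) (h' : i ∈ (y l').coords.support) : l = l' := by
  by_contra hne
  rcases (num_injective.ne hne).lt_or_gt with hlt | hlt
  · exact lt_irrefl _ (hy.before _ _ hlt _ h _ h')
  · exact lt_irrefl _ (hy.before _ _ hlt _ h' _ h)

theorem injective_of_le (hμ : ∀ l, Node.ofFn l ≤ μ l) : Function.Injective μ := by
  intro l l' h
  refine eq_of_take_eq hμ (List.prefix_refl _) (List.prefix_refl _) ?_
  rw [h]

theorem pair_sum (f : ℕ+ →₀ ℝ) (a : (Fin N → Bool) → ℝ) :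
    C00.pair f (∑ l, a l • y (μ l)) = ∑ l, a l * C00.pair f (y (μ l)) := by
  rw [map_sum]
  exact Finset.sum_congr rfl fun l _ => by rw [map_smul, smul_eq_mul]

/-- Projecting onto the support of a single `y (μ l)` is contractive and isolates the term `a l • y
(μ l)`. -/
theorem abs_le_norm (hy : IsExactTree y w) (hμ : ∀ l, Node.ofFn l ≤ μ l)
    (a : (Fin N → Bool) → ℝ) (l : Fin N → Bool) : |a l| ≤ ‖∑ l, a l • y (μ l)‖ := by
  classical
  have h : C00.res {i | i ∈ (y (μ l)).coords.support} (∑ l, a l • y (μ l)) = a l • y (μ l) := by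
    change (C00.res {i | i ∈ (y (μ l)).coords.support} (∑ l, a l • y (μ l))).coords =
      (a l • y (μ l)).coords
    rw [C00.coords_res, C00.coords_sum]
    ext i
    rw [Finsupp.filter_apply, Finsupp.finsetSum_apply]
    split_ifs with hi
    · refine Finset.sum_eq_single_of_mem l (Finset.mem_univ _) fun l' _ hne => ?_
      rw [C00.coords_smul, Finsupp.smul_apply]
      have : (y (μ l')).coords i = 0 := by
        by_contra h0
        exact hne (injective_of_le hμ (hy.eq_of_mem_support (Finsupp.mem_support_iff.2 h0) hi))
      rw [this, smul_zero]
    · have : (y (μ l)).coords i = 0 := Finsupp.notMem_support_iff.1 hi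
      rw [C00.coords_smul, Finsupp.smul_apply, this, smul_zero]
  have h1 := C00.norm_res_le {i | i ∈ (y (μ l)).coords.support} (∑ l, a l • y (μ l))
  rwa [h, norm_smul, hy.norm_eq, mul_one, Real.norm_eq_abs] at h1

theorem sum_half_pow_num_le (hμ : ∀ l, Node.ofFn l ≤ μ l) :
    ∑ l, (2⁻¹ : ℝ) ^ num (μ l) ≤ 2 := by
  classical
  have hinj : Function.Injective fun l => num (μ l) := num_injective.comp (injective_of_le hμ)
  rw [← Finset.sum_image (f := fun n => (2⁻¹ : ℝ) ^ n) (g := fun l => num (μ l))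
    (fun l _ l' _ h => hinj h)]
  have h := summable_geometric_two
  have h2 := tsum_geometric_two
  rw [one_div] at h h2
  exact (h.sum_le_tsum _ fun n _ => by positivity).trans h2.le

theorem sum_abs_pair_le (hy : IsExactTree y w) (hμ : ∀ l, Node.ofFn l ≤ μ l)
    {a : (Fin N → Bool) → ℝ} {M : ℝ} (ha : ∀ l, |a l| ≤ M) {h : WFun} (hh : h ∈ NormingSet P)
    (h0 : h.idx ≠ []) {D : List WFun} (hD : IsDecomp P h.idx D) (hv : h.vec = avg P h.idx D)
    {lam : NodeBar} (hr : ∀ g ∈ D, ((2 ^ (N + 10) : ℕ) : ℕ∞) ≤ g.weight P ∧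
      g.distTo lam ≤ 2 * (2⁻¹ : ℝ) ^ (N + 10)) :
    |C00.pair h.vec (∑ l, a l • y (μ l))| ≤ 21 / 10 * M := by
  classical
  have hM : 0 ≤ M := (abs_nonneg _).trans (ha fun _ => false)
  let p1 : (Fin N → Bool) → Prop := fun l => maxIdx h.idx = w (μ l)
  let p2 : (Fin N → Bool) → Prop := fun l => ∃ g ∈ D, maxIdx g.idx = w (μ l)
  have hp1 : ∀ l l', p1 l → p1 l' → l = l' := by
    intro l l' h1 h2
    refine eq_of_take_eq hμ (hy.le_node _) (hy.le_node _) ?_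
    rw [← show maxIdx h.idx = w (μ l) from h1, ← show maxIdx h.idx = w (μ l') from h2]
  -- Two nodes within `2 · 2⁻⁽ᴺ⁺¹⁰⁾` of the same point are within `2⁻ᴺ` of each other, and so agree
  -- in their first `N` entries.
  have hp2 : ∀ l l', p2 l → p2 l' → l = l' := by
    rintro l l' ⟨g, hg, h1⟩ ⟨g', hg', h2⟩
    refine eq_of_take_eq hμ (hy.le_node _) (hy.le_node _) ?_
    rw [← h1, ← h2]
    refine take_eq_of_dist_le (a := g.node) (b := g'.node) ?_
    rw [← UniformSpace.Completion.dist_eq]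
    have h3 := (hr g hg).2
    have h4 := (hr g' hg').2
    have h5 : dist (g.node : NodeBar) (g'.node : NodeBar) ≤ g.distTo lam + g'.distTo lam :=
      dist_triangle_right _ _ _
    have h6 : (2⁻¹ : ℝ) ^ (N + 10) = 2⁻¹ ^ N * 2⁻¹ ^ 10 := pow_add _ _ _
    have h7 : (0 : ℝ) < 2⁻¹ ^ N := by positivity
    have h8 : (2⁻¹ : ℝ) ^ 10 ≤ 1 / 4 := by norm_num
    have h9 : (2⁻¹ : ℝ) ^ N * 2⁻¹ ^ 10 ≤ 2⁻¹ ^ N * (1 / 4) :=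
      mul_le_mul_of_nonneg_left h8 h7.le
    linarith
  have hterm : ∀ l, |a l * C00.pair h.vec (y (μ l))| ≤
      ((if p1 l then M else 0) + (if p2 l then M else 0)) +
        M * ((2⁻¹ : ℝ) ^ num (μ l) / 40 + 2⁻¹ ^ (N + 10)) := by
    intro l
    rw [abs_mul]
    have h1 : |C00.pair h.vec (y (μ l))| ≤ 1 :=
      (C00.abs_pair_le_norm hh _).trans (hy.norm_eq _).le
    have h2 : |a l| * |C00.pair h.vec (y (μ l))| ≤ M :=
      (mul_le_mul (ha l) h1 (abs_nonneg _) hM).trans (mul_one M).le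
    have h3 : 0 ≤ M * ((2⁻¹ : ℝ) ^ num (μ l) / 40 + 2⁻¹ ^ (N + 10)) := by positivity
    by_cases hl1 : p1 l
    · rw [if_pos hl1]
      split_ifs <;> linarith
    · by_cases hl2 : p2 l
      · rw [if_pos hl2, if_neg hl1]
        linarith
      · rw [if_neg hl1, if_neg hl2, zero_add, zero_add]
        refine mul_le_mul (ha l) ?_ (abs_nonneg _) hM
        exact hy.exact (μ l) h hh h0 D hD hv hl1 (N + 10) fun g hg =>
          ⟨fun hg' => hl2 ⟨g, hg, hg'⟩, (hr g hg).1⟩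
  rw [pair_sum]
  refine (Finset.abs_sum_le_sum_abs _ _).trans ((Finset.sum_le_sum fun l _ => hterm l).trans ?_)
  rw [Finset.sum_add_distrib, Finset.sum_add_distrib, ← Finset.mul_sum, Finset.sum_add_distrib,
    ← Finset.sum_div, Finset.sum_const, Finset.card_univ, Fintype.card_fun, Fintype.card_bool,
    Fintype.card_fin, nsmul_eq_mul]
  -- The two matched terms cost `M` each. The exactness errors add up to at most `2 / 40`, and the
  -- `2ᴺ` weight errors to at most `1 / 40`, which is within the allowance `1 / 10`.
  have h1 := sum_ite_le_of_subsingleton p1 hp1 hM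
  have h2 := sum_ite_le_of_subsingleton p2 hp2 hM
  have h3 := sum_half_pow_num_le hμ
  have h4 : ((2 ^ N : ℕ) : ℝ) * (2⁻¹ : ℝ) ^ (N + 10) ≤ 1 / 40 := by
    rw [Nat.cast_pow, Nat.cast_ofNat, pow_add, ← mul_assoc, ← mul_pow]
    norm_num
  have h5 : M * ((∑ l, (2⁻¹ : ℝ) ^ num (μ l)) / 40 + ((2 ^ N : ℕ) : ℝ) * (2⁻¹ : ℝ) ^ (N + 10)) ≤
      M * (1 / 10) := mul_le_mul_of_nonneg_left (by linarith) hM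
  linarith

theorem norm_sum_le (hy : IsExactTree y w) (hμ : ∀ l, Node.ofFn l ≤ μ l)
    {a : (Fin N → Bool) → ℝ} {M : ℝ} (ha : ∀ l, |a l| ≤ M) :
    ‖∑ l, a l • y (μ l)‖ ≤ 3 * M := by
  classical
  have hM : 0 ≤ M := (abs_nonneg _).trans (ha fun _ => false)
  set v := ∑ l, a l • y (μ l) with hv
  have hsv : ∀ i ∈ v.coords.support, N + 10 ≤ (i : ℕ) := by
    intro i hi
    rw [hv, C00.coords_sum] at hi
    obtain ⟨l, -, hl⟩ := Finset.mem_biUnion.1 (Finsupp.support_finsetSum hi)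
    have h1 := hy.le_support (μ l) i (Finsupp.support_smul hl)
    have h2 : (Node.ofFn l : List Bool).length ≤ List.length (α := Bool) (μ l) := (hμ l).length_le
    rw [Node.ofFn, List.length_ofFn] at h2
    omega
  have hmain : ∀ f ∈ NormingSet P, |C00.pair f.vec v| ≤ ‖v‖ / 100 + 21 / 10 * M := by
    intro f hf
    have hv0 : 0 ≤ ‖v‖ / 100 := by positivity
    by_cases h0 : f.idx = []
    · have hlev : f ∈ Level P 0 := by
        rcases normingSet_cases hf with h | h | h
        · exact h
        · exact absurd h0 h.1
        · exact absurd h0 h.idx_ne_nil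
      obtain ⟨i, hi⟩ : ∃ i, ∀ b ∈ f.vec.support, b = i := by
        obtain ⟨-, i, h | h⟩ := hlev
        all_goals
          refine ⟨i, fun b hb => ?_⟩
          rw [h] at hb
          exact Finset.mem_singleton.1 (Finsupp.support_single_subset hb)
      have h1 : |C00.pair f.vec v| ≤ M := by
        rw [hv, pair_sum]
        refine (Finset.abs_sum_le_sum_abs _ _).trans (le_trans (Finset.sum_le_sum fun l _ => ?_)
          (sum_ite_le_of_subsingleton (fun l => i ∈ (y (μ l)).coords.support) (fun l l' h h' =>
            injective_of_le hμ (hy.eq_of_mem_support h h')) hM))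
        rw [abs_mul]
        split_ifs with h
        · have h1 : |C00.pair f.vec (y (μ l))| ≤ 1 :=
            (C00.abs_pair_le_norm hf _).trans (hy.norm_eq _).le
          exact (mul_le_mul (ha l) h1 (abs_nonneg _) hM).trans (mul_one M).le
        · rw [C00.pair_eq_zero fun b hb => by rwa [hi b hb], abs_zero, mul_zero]
      linarith
    · obtain ⟨A, B, D, lam, hsp⟩ := exists_isSplit hf h0 (N + 10)
      have hpf : C00.pair f.vec v = C00.pair (avg P f.idx B) v + C00.pair (avg P f.idx D) v := by
        rw [hsp.vec_eq, avg_append, avg_append, C00.pair_add_left, C00.pair_add_left,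
          pair_avg_eq_zero_of_lt hsp.left hsv, zero_add]
      have hB := hsp.middle v
      have hDv : |C00.pair (avg P f.idx D) v| ≤ 21 / 10 * M := by
        rcases D.eq_nil_or_concat with rfl | hne
        · rw [avg_nil, C00.pair_zero_left, abs_zero]
          positivity
        · have hD := hsp.decomp.sublist h0 (List.sublist_append_right (A ++ B) D)
          -- The tail average is a restriction of `f`. It belongs to the norming set with the same
          -- weight tuple, so exactness applies to it.
          have hres := avg_sublist_eq_res h0 hsp.decomp hsp.vec_eq
          have hne0 : avg P f.idx D ≠ 0 := by
            obtain ⟨D', g, rfl⟩ := hne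
            intro hz
            have h1 := hD.successive.support_subset_sum (g := g) (by simp)
              (minSupp_mem (hD.ne_zero g (by simp)))
            rw [← support_avg (P := P) f.idx, hz] at h1
            simp at h1
          have hmem := res_mem hf (by rwa [hres])
          have := hy.sum_abs_pair_le hμ ha hmem h0 hD hres hsp.right
          rwa [hres, ← hv] at this
      rw [hpf]
      refine (abs_add_le _ _).trans ?_
      linarith
  -- The term `‖v‖ / 100` is absorbed on the left, and `2.1 / 0.99 < 3`.
  have := C00.norm_le hmain
  linarith

end IsExactTree

/-! ### Block sequences close to a given subspace -/

/-- The coordinates up to `T`, as a continuous linear map. -/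
def initialCoords (P : Params) (T : ℕ+) : C00 P →L[ℝ] (Set.Iic T → ℝ) :=
  LinearMap.mkContinuous
    { toFun := fun x i => x.coords i
      map_add' := fun _ _ => rfl
      map_smul' := fun _ _ => rfl } 1 fun x => by
    rw [one_mul]
    exact (pi_norm_le_iff_of_nonneg (norm_nonneg x)).2 fun i => C00.abs_coords_le x i

/-- The coordinates up to `T`, extended to the completion. -/
def initialCoordsBar (P : Params) (T : ℕ+) : XD P →L[ℝ] (Set.Iic T → ℝ) :=
  (initialCoords P T).extend (UniformSpace.Completion.toComplL : C00 P →L[ℝ] XD P)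

theorem initialCoordsBar_coe (T : ℕ+) (x : C00 P) :
    initialCoordsBar P T (x : XD P) = initialCoords P T x :=
  ContinuousLinearMap.extend_eq _ UniformSpace.Completion.denseRange_coe
    (UniformSpace.Completion.isUniformInducing_coe _) x

theorem norm_initialCoordsBar_le (T : ℕ+) (x : XD P) : ‖initialCoordsBar P T x‖ ≤ ‖x‖ := by
  induction x using UniformSpace.Completion.induction_on with
  | hp => exact isClosed_le (by fun_prop) (by fun_prop)
  | ih x =>
    rw [initialCoordsBar_coe, UniformSpace.Completion.norm_coe]
    exact (pi_norm_le_iff_of_nonneg (norm_nonneg x)).2 fun i => C00.abs_coords_le x i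

theorem exists_norm_one_initialCoordsBar_eq_zero {Z : Submodule ℝ (XD P)}
    (hZ : ¬ FiniteDimensional ℝ Z) (T : ℕ+) :
    ∃ z ∈ Z, ‖z‖ = 1 ∧ initialCoordsBar P T z = 0 := by
  have hinj : ¬ Function.Injective ((initialCoordsBar P T).toLinearMap.comp Z.subtype) :=
    fun h => hZ (Module.Finite.of_injective _ h)
  rw [← LinearMap.ker_eq_bot, Submodule.eq_bot_iff] at hinj
  push Not at hinj
  obtain ⟨z, hz, h0⟩ := hinj
  have h1 : ‖(z : XD P)‖ ≠ 0 := by simpa using h0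
  refine ⟨‖(z : XD P)‖⁻¹ • z, Z.smul_mem _ z.2, ?_, ?_⟩
  · rw [norm_smul, norm_inv, norm_norm, inv_mul_cancel₀ h1]
  · rw [map_smul]
    have : initialCoordsBar P T z = 0 := hz
    rw [this, smul_zero]

/-- Gliding hump: a unit vector of `Z` with vanishing first coordinates is approximated by a
finitely supported vector, whose small initial part is then removed. -/
theorem exists_block_near {Z : Submodule ℝ (XD P)} (hZ : ¬ FiniteDimensional ℝ Z) (T : ℕ)
    {ε : ℝ} (hε : 0 < ε) (hε' : ε ≤ 1 / 2) :
    ∃ u : C00 P, ∃ z ∈ Z, (∀ i ∈ u.coords.support, T < (i : ℕ)) ∧ 1 / 2 ≤ ‖u‖ ∧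
      ‖(u : XD P) - z‖ ≤ ε := by
  classical
  let T' : ℕ+ := T.succPNat
  obtain ⟨z, hzZ, hz1, hz0⟩ := exists_norm_one_initialCoordsBar_eq_zero hZ T'
  have hT : (0 : ℝ) < T + 2 := by positivity
  -- Each of the `T + 1` removed coordinates costs at most `ε / (T + 2)`, and so does the
  -- approximation; together this is `ε`.
  obtain ⟨_, hx, ⟨x, rfl⟩⟩ := Metric.dense_iff.1
    (UniformSpace.Completion.denseRange_coe (α := C00 P)) z (ε / (T + 2)) (by positivity)
  rw [Metric.mem_ball, dist_eq_norm] at hx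
  have hc : ∀ i ∈ Set.Iic T', |x.coords i| ≤ ε / (T + 2) := by
    intro i hi
    have h1 := (norm_initialCoordsBar_le T' ((x : XD P) - z)).trans hx.le
    rw [map_sub, hz0, sub_zero, initialCoordsBar_coe] at h1
    exact (norm_le_pi_norm (initialCoords P T' x) ⟨i, hi⟩).trans h1
  have hres : ‖C00.res (Set.Iic T') x‖ ≤ (T + 1) * (ε / (T + 2)) := by
    refine (C00.norm_le_l1 _).trans ?_
    rw [C00.l1, C00.coords_res, Finsupp.support_filter]
    have h1 : ∀ i ∈ x.coords.support.filter (· ∈ Set.Iic T'),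
        |Finsupp.filter (· ∈ Set.Iic T') x.coords i| ≤ ε / (T + 2) := by
      intro i hi
      have hi' := (Finset.mem_filter.1 hi).2
      rw [Finsupp.filter_apply_pos _ _ hi']
      exact hc i hi'
    refine (Finset.sum_le_card_nsmul _ _ _ h1).trans ?_
    rw [nsmul_eq_mul]
    refine mul_le_mul_of_nonneg_right ?_ (by positivity)
    have h2 : x.coords.support.filter (· ∈ Set.Iic T') ⊆ Finset.Icc 1 T' := fun i hi =>
      Finset.mem_Icc.2 ⟨one_le, (Finset.mem_filter.1 hi).2⟩
    have h3 := Finset.card_le_card h2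
    rw [PNat.card_Icc] at h3
    have h4 : (T' : ℕ) = T + 1 := rfl
    rw [h4] at h3
    exact_mod_cast h3.trans (by simp)
  have hsplit : C00.res (Set.Iic T')ᶜ x = x - C00.res (Set.Iic T') x := by
    have h1 : C00.res (Set.Iic T') x + C00.res (Set.Iic T')ᶜ x = x := by
      change (C00.res (Set.Iic T') x).coords + (C00.res (Set.Iic T')ᶜ x).coords = x.coords
      rw [C00.coords_res, C00.coords_res]
      exact Finsupp.filter_add_filter_not _ _
    rw [eq_sub_iff_add_eq', h1]
  have hclose : ‖((C00.res (Set.Iic T')ᶜ x : C00 P) : XD P) - z‖ ≤ ε := by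
    rw [hsplit, UniformSpace.Completion.coe_sub, sub_right_comm]
    refine (norm_sub_le _ _).trans ?_
    rw [UniformSpace.Completion.norm_coe]
    have h1 : ε / (T + 2) * (T + 2) = ε := by field_simp
    nlinarith
  refine ⟨C00.res (Set.Iic T')ᶜ x, z, hzZ, fun i hi => ?_, ?_, hclose⟩
  · rw [C00.coords_res, Finsupp.support_filter] at hi
    have h1 := (Finset.mem_filter.1 hi).2
    rw [Set.mem_compl_iff, Set.mem_Iic, not_le] at h1
    have h2 : (T' : ℕ) < i := by exact_mod_cast h1
    exact lt_trans (Nat.lt_succ_self T) h2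
  · have h1 := norm_sub_norm_le z ((C00.res (Set.Iic T')ᶜ x : C00 P) : XD P)
    rw [norm_sub_rev, UniformSpace.Completion.norm_coe] at h1
    linarith

theorem coe_linearCombination (u : ℕ → C00 P) (b : ℕ →₀ ℝ) :
    ((Finsupp.linearCombination ℝ u b : C00 P) : XD P) =
      Finsupp.linearCombination ℝ (fun r => (u r : XD P)) b := by
  have := Finsupp.apply_linearCombination ℝ
    (UniformSpace.Completion.toComplL : C00 P →L[ℝ] XD P).toLinearMap u b
  exact this

theorem IsBlockSeq.abs_mul_norm_le {u : ℕ → C00 P} (hu : IsBlockSeq u) (b : ℕ →₀ ℝ) (r : ℕ) :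
    |b r| * ‖u r‖ ≤ ‖Finsupp.linearCombination ℝ u b‖ := by
  classical
  by_cases hr : b r = 0
  · rw [hr, abs_zero, zero_mul]
    exact norm_nonneg _
  have hr' : r ∈ b.support := Finsupp.mem_support_iff.2 hr
  have h : C00.res {i | i ∈ (u r).coords.support} (Finsupp.linearCombination ℝ u b) = b r • u r := by
    change (C00.res _ (∑ k ∈ b.support, b k • u k)).coords = (b r • u r).coords
    rw [C00.coords_res]
    ext i
    rw [Finsupp.filter_apply, C00.coords_smul, Finsupp.smul_apply, smul_eq_mul]
    split_ifs with hi
    · exact coords_sum_apply hu b hr' hi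
    · rw [Finsupp.notMem_support_iff.1 hi, mul_zero]
  have h1 := C00.norm_res_le {i | i ∈ (u r).coords.support} (Finsupp.linearCombination ℝ u b)
  rwa [h, norm_smul, Real.norm_eq_abs] at h1

/-- Every infinite-dimensional subspace contains an isomorphic copy of a block subspace. -/
theorem exists_isBlockSeq_embedding {Z : Submodule ℝ (XD P)} (hZ : ¬ FiniteDimensional ℝ Z) :
    ∃ u : ℕ → C00 P, IsBlockSeq u ∧ ∃ S : (ℕ →₀ ℝ) →ₗ[ℝ] Z, ∀ b,
      ‖Finsupp.linearCombination ℝ u b‖ ≤ 2 * ‖S b‖ ∧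
      ‖S b‖ ≤ 2 * ‖Finsupp.linearCombination ℝ u b‖ := by
  have hpow : ∀ n : ℕ, (1 / 2 : ℝ) ^ n / 8 ≤ 1 / 2 := fun n => by
    have : (1 / 2 : ℝ) ^ n ≤ 1 := pow_le_one₀ (by norm_num) (by norm_num)
    linarith
  obtain ⟨s, hs0, hs⟩ := exists_seq_of_step
    (fun n T (a : C00 P × XD P) => a.2 ∈ Z ∧ (∀ i ∈ a.1.coords.support, T < (i : ℕ)) ∧
      1 / 2 ≤ ‖a.1‖ ∧ ‖(a.1 : XD P) - a.2‖ ≤ (1 / 2 : ℝ) ^ n / 8)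
    (fun _ a => maxSupp a.1.coords) 0 (fun n T => by
      obtain ⟨u, z, h1, h2, h3, h4⟩ := exists_block_near hZ T (ε := (1 / 2 : ℝ) ^ n / 8)
        (by positivity) (hpow n)
      exact ⟨(u, z), h1, h2, h3, h4⟩)
  have hall : ∀ n, (s n).2 ∈ Z ∧ 1 / 2 ≤ ‖(s n).1‖ ∧
      ‖((s n).1 : XD P) - (s n).2‖ ≤ (1 / 2 : ℝ) ^ n / 8 := by
    intro n
    cases n with
    | zero => exact ⟨hs0.1, hs0.2.2⟩
    | succ n => exact ⟨(hs n).1, (hs n).2.2⟩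
  have hu : IsBlockSeq fun n => (s n).1 := by
    refine isBlockSeq_of_succ (fun k h0 => ?_) fun k i hi i' hi' => ?_
    · have h1 := (hall k).2.1
      rw [C00.coords_eq_zero.1 h0, norm_zero] at h1
      norm_num at h1
    · have h1 := (hs k).2.1 i' hi'
      have h2 := le_maxSupp hi
      have h3 : (i : ℕ) < i' := by omega
      exact_mod_cast h3
  refine ⟨_, hu, Finsupp.linearCombination ℝ fun n => (⟨(s n).2, (hall n).1⟩ : Z), fun b => ?_⟩
  set U := Finsupp.linearCombination ℝ (fun n => (s n).1) b with hU
  set V := Finsupp.linearCombination ℝ (fun n => (⟨(s n).2, (hall n).1⟩ : Z)) b with hV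
  have hVc : (V : XD P) = Finsupp.linearCombination ℝ (fun n => (s n).2) b :=
    Finsupp.apply_linearCombination ℝ Z.subtype (fun n => (⟨(s n).2, (hall n).1⟩ : Z)) b
  -- Since `‖u n‖ ≥ 1 / 2`, contractive projections give `|b n| ≤ 2 ‖U‖`. The perturbations then add
  -- up to at most `∑ 2 ‖U‖ · 2⁻ⁿ / 8 = ‖U‖ / 2`.
  have hdiff : ‖(U : XD P) - V‖ ≤ ‖U‖ / 2 := by
    rw [hVc, hU, coe_linearCombination, Finsupp.linearCombination_apply,
      Finsupp.linearCombination_apply, Finsupp.sum, Finsupp.sum, ← Finset.sum_sub_distrib]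
    have h1 : ∀ n ∈ b.support, ‖b n • ((s n).1 : XD P) - b n • (s n).2‖ ≤
        ‖U‖ / 4 * (1 / 2 : ℝ) ^ n := by
      intro n _
      rw [← smul_sub, norm_smul, Real.norm_eq_abs]
      have h2 := hu.abs_mul_norm_le b n
      have h3 : |b n| ≤ 2 * ‖U‖ := by nlinarith [(hall n).2.1, abs_nonneg (b n)]
      refine (mul_le_mul h3 (hall n).2.2 (norm_nonneg _) (by positivity)).trans (le_of_eq ?_)
      ring
    refine (norm_sum_le_of_le _ h1).trans ?_
    rw [← Finset.mul_sum]
    have h4 := (summable_geometric_two.sum_le_tsum b.support fun n _ => by positivity).trans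
      tsum_geometric_two.le
    nlinarith [norm_nonneg U]
  have h1 : ‖V‖ = ‖(V : XD P)‖ := rfl
  have h2 : ‖(U : XD P)‖ = ‖U‖ := UniformSpace.Completion.norm_coe U
  have h3 := norm_sub_norm_le (U : XD P) V
  have h4 := norm_sub_norm_le (V : XD P) U
  rw [norm_sub_rev] at h4
  have h5 := norm_nonneg U
  constructor <;> linarith

/-! ### Dyadic positions of the nodes -/

/-- The centre of the dyadic interval that corresponds to a node. -/
def pos : List Bool → ℝ
  | [] => 1 / 2
  | b :: s => ((b.toNat : ℝ) + pos s) / 2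

theorem pos_mem : ∀ s : List Bool, pos s ∈ Set.Ioo (0 : ℝ) 1
  | [] => by rw [pos]; norm_num
  | b :: s => by
    have h := pos_mem s
    rw [pos]
    cases b <;> simp only [Bool.toNat_false, Bool.toNat_true, Nat.cast_zero, Nat.cast_one] <;>
      exact ⟨by linarith [h.1], by linarith [h.2]⟩

theorem pos_injective : Function.Injective pos := by
  intro s
  induction s with
  | nil =>
    intro t h
    cases t with
    | nil => rfl
    | cons b t =>
      have h1 := pos_mem t
      cases b <;> simp only [pos, Bool.toNat_false, Bool.toNat_true, Nat.cast_zero,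
        Nat.cast_one] at h
      · linarith [h1.2]
      · linarith [h1.1]
  | cons a s ih =>
    intro t h
    have h0 := pos_mem s
    cases t with
    | nil =>
      cases a <;> simp only [pos, Bool.toNat_false, Bool.toNat_true, Nat.cast_zero,
        Nat.cast_one] at h
      · linarith [h0.2]
      · linarith [h0.1]
    | cons b t =>
      have h1 := pos_mem t
      cases a <;> cases b <;> simp only [pos, Bool.toNat_false, Bool.toNat_true, Nat.cast_zero,
        Nat.cast_one] at h
      · rw [ih (by linarith : pos s = pos t)]
      · linarith [h0.2, h1.1]
      · linarith [h0.1, h1.2]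
      · rw [ih (by linarith : pos s = pos t)]

theorem pos_append (s t : List Bool) :
    pos (s ++ t) = pos s + (1 / 2) ^ s.length * (pos t - 1 / 2) := by
  induction s with
  | nil => simp [pos]
  | cons b s ih => rw [List.cons_append, pos, pos, ih, List.length_cons, pow_succ]; ring

theorem abs_pos_sub_le {s t : List Bool} (h : s <+: t) :
    |pos t - pos s| ≤ (1 / 2) ^ s.length := by
  obtain ⟨r, rfl⟩ := h
  have h1 := pos_mem r
  rw [pos_append, add_sub_cancel_left, abs_mul, abs_of_nonneg (by positivity)]
  refine mul_le_of_le_one_right (by positivity) ?_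
  rw [abs_le]
  constructor <;> linarith [h1.1, h1.2]

theorem exists_pos_near (n : ℕ) : ∀ t ∈ Set.Icc (0 : ℝ) 1, ∃ l, |pos l - t| ≤ (1 / 2) ^ n := by
  induction n with
  | zero =>
    intro t ht
    refine ⟨[], ?_⟩
    rw [pos, abs_le]
    constructor <;> linarith [ht.1, ht.2]
  | succ n ih =>
    intro t ht
    have key : ∀ b : Bool, 2 * t - b.toNat ∈ Set.Icc (0 : ℝ) 1 →
        ∃ l, |pos l - t| ≤ (1 / 2) ^ (n + 1) := by
      intro b hb
      obtain ⟨l, hl⟩ := ih _ hb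
      refine ⟨b :: l, ?_⟩
      rw [pos, show ((b.toNat : ℝ) + pos l) / 2 - t = (pos l - (2 * t - b.toNat)) / 2 by ring,
        abs_div, abs_two, pow_succ]
      linarith
    rcases le_total t (1 / 2) with h | h
    · refine key false ?_
      rw [Bool.toNat_false, Nat.cast_zero]
      exact ⟨by linarith [ht.1], by linarith⟩
    · refine key true ?_
      rw [Bool.toNat_true, Nat.cast_one]
      exact ⟨by linarith, by linarith [ht.2]⟩

/-! ### Riemann sums along a tree -/

section Riemann

variable {E : Type*} [NormedAddCommGroup E]

open Classical in
/-- The function that vanishes except at the positions of the nodes, where it takes the values of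
the tree. -/
def treeFun (Y : Node → E) (t : ℝ) : E := if h : ∃ l : List Bool, pos l = t then Y h.choose else 0

theorem treeFun_pos (Y : Node → E) (l : List Bool) : treeFun Y (pos l) = Y l := by
  have h : ∃ l' : List Bool, pos l' = pos l := ⟨l, rfl⟩
  rw [treeFun, dif_pos h, pos_injective h.choose_spec]

theorem treeFun_of_notMem (Y : Node → E) {t : ℝ} (h : t ∉ Set.range pos) : treeFun Y t = 0 :=
  dif_neg h

/-- Near every point there are positions of nodes, with values of norm at least `r`, and points that
are not positions, with value zero, as the set of positions is countable. -/
theorem not_continuousWithinAt_treeFun {Y : Node → E} {r : ℝ} (hr : 0 < r) (hY : ∀ l, r ≤ ‖Y l‖)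
    {t : ℝ} (ht : t ∈ Set.Icc (0 : ℝ) 1) :
    ¬ ContinuousWithinAt (treeFun Y) (Set.Icc 0 1) t := by
  intro h
  obtain ⟨δ, hδ, hcont⟩ := Metric.continuousWithinAt_iff.1 h (r / 2) (by positivity)
  obtain ⟨n, hn⟩ := exists_pow_lt_of_lt_one hδ (show (1 / 2 : ℝ) < 1 by norm_num)
  obtain ⟨l, hl⟩ := exists_pos_near n t ht
  have hl' : dist (pos l) t < δ := hl.trans_lt hn
  obtain ⟨x, hx, hxr⟩ := ((Set.countable_range pos).dense_compl ℝ).inter_open_nonempty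
    (Set.Ioo 0 1 ∩ Metric.ball t δ) (isOpen_Ioo.inter Metric.isOpen_ball)
    ⟨pos l, pos_mem l, hl'⟩
  have h1 := hcont (Set.Ioo_subset_Icc_self (pos_mem l)) hl'
  have h2 := hcont (Set.Ioo_subset_Icc_self hx.1) hx.2
  have h3 := dist_triangle_right (treeFun Y (pos l)) (treeFun Y x) (treeFun Y t)
  rw [treeFun_of_notMem Y hxr, dist_zero_right, treeFun_pos] at h3
  rw [treeFun_pos] at h1
  rw [treeFun_of_notMem Y hxr] at h2
  linarith [hY l]

variable [NormedSpace ℝ E]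

/-- The tree `Y` is bounded, and its fronts are dominated by the basis of `c₀`. -/
def IsUpperC0Tree (C : ℝ) (Y : Node → E) : Prop :=
  ∀ (N : ℕ) (μ : (Fin N → Bool) → Node), (∀ l, Node.ofFn l ≤ μ l) →
    ∀ (a : (Fin N → Bool) → ℝ) (M : ℝ), (∀ l, |a l| ≤ M) → ‖∑ l, a l • Y (μ l)‖ ≤ C * M

theorem IsUpperC0Tree.norm_le {C : ℝ} {Y : Node → E} (hY : IsUpperC0Tree C Y) (l : Node) :
    ‖Y l‖ ≤ C := by
  have h := hY 0 (fun _ => l) (fun k => List.nil_prefix) (fun _ => 1) 1 fun _ => by simp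
  simpa using h

/-- The first `N` entries of a node. -/
def key (N : ℕ) (l : Node) : Fin N → Bool := fun k => List.getD (α := Bool) l k false

theorem ofFn_getD_le {N : ℕ} {l : List Bool} (h : N ≤ l.length) :
    List.ofFn (fun k : Fin N => l.getD k false) <+: l := by
  have : List.ofFn (fun k : Fin N => l.getD k false) = l.take N := by
    refine List.ext_getElem (by simpa using h) fun k h1 h2 => ?_
    have hk : k < l.length := by
      rw [List.length_ofFn] at h1
      omega
    rw [List.getElem_ofFn, List.getElem_take]
    exact List.getD_eq_getElem _ _ hk
  rw [this]
  exact List.take_prefix _ _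

theorem ofFn_key_le {N : ℕ} {l : Node} (h : N ≤ List.length (α := Bool) l) :
    Node.ofFn (key N l) ≤ l := ofFn_getD_le h

/-- After testing with a functional `g`, each class of nodes with a common initial segment is
replaced by one node at which `|g (Y ·)|` is largest. These nodes form a front, and the `c₀`
estimate with the signs of `g` as coefficients gives `∑ |g (Y (m l))| ≤ ‖g‖ C`. The mass of each
class enters only through its maximum `β`. -/
theorem IsUpperC0Tree.norm_sum_le {C : ℝ} {Y : Node → E} (hY : IsUpperC0Tree C Y) {N : ℕ}
    {ι : Type*} {s : Finset ι} {v : ι → ℝ} {nd : ι → Node} {β : ℝ} (hv : ∀ i ∈ s, 0 ≤ v i)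
    (hβ : 0 ≤ β) (hN : ∀ i ∈ s, N ≤ List.length (α := Bool) (nd i))
    (hm : ∀ l : Fin N → Bool, ∑ i ∈ s with key N (nd i) = l, v i ≤ β) :
    ‖∑ i ∈ s, v i • Y (nd i)‖ ≤ C * β := by
  classical
  have hC : 0 ≤ C := (norm_nonneg _).trans (hY.norm_le (Node.ofFn (N := 0) fun _ => false))
  refine NormedSpace.norm_le_dual_bound ℝ _ (mul_nonneg hC hβ) fun g => ?_
  have hrep : ∀ l : Fin N → Bool, ∃ m : Node, Node.ofFn l ≤ m ∧
      ∀ i ∈ s.filter fun i => key N (nd i) = l, |g (Y (nd i))| ≤ |g (Y m)| := by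
    intro l
    rcases (s.filter fun i => key N (nd i) = l).eq_empty_or_nonempty with h | h
    · exact ⟨Node.ofFn l, List.prefix_refl _, by simp [h]⟩
    · obtain ⟨i, hi, hmax⟩ := Finset.exists_max_image _ (fun i => |g (Y (nd i))|) h
      obtain ⟨his, rfl⟩ := Finset.mem_filter.1 hi
      exact ⟨nd i, ofFn_key_le (hN i his), hmax⟩
  choose m hm1 hm2 using hrep
  have h1 : ‖∑ l, (SignType.sign (g (Y (m l))) : ℝ) • Y (m l)‖ ≤ C * 1 := by
    refine hY N m hm1 _ 1 fun l => ?_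
    rcases lt_trichotomy (g (Y (m l))) 0 with h | h | h <;> simp [h]
  have h2 : ∑ l, |g (Y (m l))| ≤ ‖g‖ * C := by
    have h3 := (g.le_opNorm _).trans (mul_le_mul_of_nonneg_left h1 (norm_nonneg g))
    rw [map_sum, mul_one] at h3
    refine le_trans (le_of_eq ?_) ((le_abs_self _).trans h3)
    exact Finset.sum_congr rfl fun l _ => by rw [map_smul, smul_eq_mul, sign_mul_self]
  calc ‖g (∑ i ∈ s, v i • Y (nd i))‖ ≤ ∑ i ∈ s, v i * |g (Y (nd i))| := by
        rw [map_sum]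
        refine norm_sum_le_of_le _ fun i hi => ?_
        rw [map_smul, smul_eq_mul, Real.norm_eq_abs, abs_mul, abs_of_nonneg (hv i hi)]
    _ = ∑ l, ∑ i ∈ s with key N (nd i) = l, v i * |g (Y (nd i))| :=
        (Finset.sum_fiberwise _ _ _).symm
    _ ≤ ∑ l, β * |g (Y (m l))| := by
        refine Finset.sum_le_sum fun l _ => ?_
        refine le_trans (Finset.sum_le_sum fun i hi => mul_le_mul_of_nonneg_left (hm2 l i hi)
          (hv i (Finset.mem_filter.1 hi).1)) ?_
        rw [← Finset.sum_mul]
        exact mul_le_mul_of_nonneg_right (hm l) (abs_nonneg _)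
    _ ≤ C * β * ‖g‖ := by
        rw [← Finset.mul_sum]
        nlinarith [mul_le_mul_of_nonneg_left h2 hβ]

/-- The boxes are disjoint and lie in a ball of radius `δ + ρ` about `c`, whose length is `2 (δ +
ρ)`. -/
theorem sum_volume_le {π : BoxIntegral.TaggedPrepartition unitBox} {δ ρ c : ℝ} (hδ : 0 ≤ δ)
    (hρ : 0 ≤ ρ) (hπ : ∀ J ∈ π.boxes, BoxIntegral.Box.Icc J ⊆ Metric.closedBall (π.tag J) δ)
    {s : Finset (BoxIntegral.Box (Fin 1))} (hs : s ⊆ π.boxes)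
    (hc : ∀ J ∈ s, |π.tag J 0 - c| ≤ ρ) :
    ∑ J ∈ s, ∏ i, (J.upper i - J.lower i) ≤ 2 * (δ + ρ) := by
  have h1 : ∀ J : BoxIntegral.Box (Fin 1), ∏ i, (J.upper i - J.lower i) =
      MeasureTheory.volume.real (J : Set (Fin 1 → ℝ)) := fun J =>
    (BoxIntegral.Box.volume_apply' J).symm
  simp only [h1]
  rw [← MeasureTheory.measureReal_biUnion_finset
    (fun J hJ J' hJ' => π.pairwiseDisjoint (hs hJ) (hs hJ'))
    (fun J _ => J.measurableSet_coe) fun J _ => (J.measure_coe_lt_top _).ne]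
  have h2 : ⋃ J ∈ s, (J : Set (Fin 1 → ℝ)) ⊆ Metric.closedBall (fun _ => c) (δ + ρ) := by
    refine Set.iUnion₂_subset fun J hJ x hx => ?_
    have h3 := hπ J (hs hJ) (BoxIntegral.Box.coe_subset_Icc hx)
    rw [Metric.mem_closedBall] at h3 ⊢
    refine (dist_triangle _ (π.tag J) _).trans (add_le_add h3 ?_)
    refine (dist_pi_le_iff hρ).2 fun i => ?_
    rw [Subsingleton.elim i 0, Real.dist_eq]
    exact hc J hJ
  refine (MeasureTheory.measureReal_mono h2 (by
    rw [Real.volume_pi_closedBall _ (by positivity)]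
    exact ENNReal.ofReal_ne_top)).trans ?_
  rw [MeasureTheory.measureReal_def, Real.volume_pi_closedBall _ (by positivity),
    ENNReal.toReal_ofReal (by positivity), Fintype.card_fin, pow_one]

/-- Tags at nodes of height at least `N` are grouped by their first `N` entries: tags of one group
lie within `2⁻ᴺ` of a dyadic centre, which bounds the mass of the group. The finitely many lower
nodes are estimated singly, by mass at most `2 δ` each. -/
theorem IsUpperC0Tree.norm_integralSum_le {C : ℝ} {Y : Node → E} (hY : IsUpperC0Tree C Y)
    {N : ℕ} {L : Finset (List Bool)} (hL : ∀ l : List Bool, l.length < N → l ∈ L) {δ : ℝ}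
    (hδ : 0 ≤ δ) {π : BoxIntegral.TaggedPrepartition unitBox}
    (hπ : ∀ J ∈ π.boxes, BoxIntegral.Box.Icc J ⊆ Metric.closedBall (π.tag J) δ) :
    ‖BoxIntegral.integralSum (fun t => treeFun Y (t 0))
      (BoxIntegral.BoxAdditiveMap.volume (E := E)) π‖ ≤
      C * (2 * (δ + (1 / 2) ^ N)) + L.card * (2 * δ) * C := by
  classical
  have hC : 0 ≤ C := (norm_nonneg _).trans (hY.norm_le (Node.ofFn (N := 0) fun _ => false))
  let v : BoxIntegral.Box (Fin 1) → ℝ := fun J => ∏ i, (J.upper i - J.lower i)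
  have hv : ∀ J, 0 ≤ v J := fun J =>
    Finset.prod_nonneg fun i _ => sub_nonneg.2 (J.lower_le_upper i)
  let p : BoxIntegral.Box (Fin 1) → Prop := fun J => ∃ l : List Bool, pos l = π.tag J 0
  have hnd : ∀ J, ∃ l : List Bool, p J → pos l = π.tag J 0 := fun J => by
    by_cases h : p J
    · exact ⟨h.choose, fun _ => h.choose_spec⟩
    · exact ⟨[], fun h' => absurd h' h⟩
  choose nd hnd using hnd
  let s := π.boxes.filter p
  have hs : s ⊆ π.boxes := Finset.filter_subset _ _
  have hsum : BoxIntegral.integralSum (fun t => treeFun Y (t 0))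
      (BoxIntegral.BoxAdditiveMap.volume (E := E)) π = ∑ J ∈ s, v J • Y (nd J) := by
    rw [BoxIntegral.integralSum, Finset.sum_filter]
    refine Finset.sum_congr rfl fun J _ => ?_
    rw [BoxIntegral.BoxAdditiveMap.volume_apply]
    split_ifs with h
    · rw [← hnd J h, treeFun_pos]
    · rw [treeFun_of_notMem Y h, smul_zero]
  rw [hsum, ← Finset.sum_filter_add_sum_filter_not s fun J => N ≤ (nd J).length]
  refine (norm_add_le _ _).trans (add_le_add ?_ ?_)
  · refine hY.norm_sum_le (fun J _ => hv J) (by positivity)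
      (fun J hJ => (Finset.mem_filter.1 hJ).2) fun l => ?_
    refine sum_volume_le (c := pos (List.ofFn l)) hδ (by positivity) hπ
      ((Finset.filter_subset _ _).trans ((Finset.filter_subset _ _).trans hs)) fun J hJ => ?_
    obtain ⟨hJ1, rfl⟩ := Finset.mem_filter.1 hJ
    obtain ⟨hJ2, hJ3⟩ := Finset.mem_filter.1 hJ1
    rw [← hnd J (Finset.mem_filter.1 hJ2).2]
    have h := abs_pos_sub_le (ofFn_key_le (N := N) (l := nd J) hJ3)
    rwa [show (Node.ofFn (key N (nd J)) : List Bool).length = N from List.length_ofFn] at h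
  · calc ‖∑ J ∈ s with ¬ N ≤ (nd J).length, v J • Y (nd J)‖
        ≤ ∑ J ∈ s with ¬ N ≤ (nd J).length, v J * C := by
          refine norm_sum_le_of_le _ fun J _ => ?_
          rw [norm_smul, Real.norm_of_nonneg (hv J)]
          exact mul_le_mul_of_nonneg_left (hY.norm_le _) (hv J)
      _ = (∑ l ∈ L, ∑ J ∈ (s.filter fun J => ¬ N ≤ (nd J).length) with nd J = l, v J) * C := by
          rw [← Finset.sum_mul, Finset.sum_fiberwise_of_maps_to]
          intro J hJ
          exact hL _ (not_le.1 (Finset.mem_filter.1 hJ).2)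
      _ ≤ L.card * (2 * δ) * C := by
          refine mul_le_mul_of_nonneg_right ?_ hC
          rw [← nsmul_eq_mul]
          refine Finset.sum_le_card_nsmul _ _ _ fun l _ => ?_
          refine (sum_volume_le (ρ := 0) (c := pos l) hδ le_rfl hπ
            ((Finset.filter_subset _ _).trans ((Finset.filter_subset _ _).trans hs))
            fun J hJ => ?_).trans (by rw [add_zero])
          obtain ⟨hJ1, rfl⟩ := Finset.mem_filter.1 hJ
          rw [← hnd J (Finset.mem_filter.1 (Finset.mem_filter.1 hJ1).1).2, sub_self, abs_zero]

theorem IsUpperC0Tree.riemannIntegrable {C : ℝ} {Y : Node → E} (hY : IsUpperC0Tree C Y) :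
    RiemannIntegrable (treeFun Y) := by
  have hC : 0 ≤ C := (norm_nonneg _).trans (hY.norm_le (Node.ofFn (N := 0) fun _ => false))
  refine BoxIntegral.HasIntegral.integrable (y := 0) (BoxIntegral.hasIntegral_iff.2 fun ε hε => ?_)
  obtain ⟨N, hN⟩ := exists_pow_lt_of_lt_one (show 0 < ε / (4 * (C + 1)) by positivity)
    (show (1 / 2 : ℝ) < 1 by norm_num)
  let L := (List.finite_length_lt Bool N).toFinset
  have hL : ∀ l : List Bool, l.length < N → l ∈ L := fun l hl => by simpa [L] using hl
  let δ : ℝ := ε / (4 * (C + 1) * (L.card + 1))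
  have hδ : 0 < δ := by positivity
  -- The radius has to be constant for Riemann integrability. `N` and `δ` are such that `2 C 2⁻ᴺ`
  -- and `2 C δ (L.card + 1)` are each at most `ε / 2`.
  refine ⟨fun _ _ => ⟨δ, hδ⟩, fun _ _ _ => rfl, fun c π hπ _ => ?_⟩
  rw [dist_zero_right]
  refine (hY.norm_integralSum_le hL hδ.le fun J hJ => hπ.isSubordinate J hJ).trans ?_
  have h1 : δ * (4 * (C + 1) * (L.card + 1)) = ε := div_mul_cancel₀ _ (by positivity)
  have h2 : (1 / 2 : ℝ) ^ N * (4 * (C + 1)) ≤ ε := by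
    rw [lt_div_iff₀ (by positivity)] at hN
    exact hN.le
  have h3 : 0 ≤ (1 / 2 : ℝ) ^ N := by positivity
  have h4 : 0 ≤ δ * (L.card + 1) := by positivity
  nlinarith

theorem IsUpperC0Tree.not_lebesgueProperty {C : ℝ} {Y : Node → E} (hY : IsUpperC0Tree C Y)
    {r : ℝ} (hr : 0 < r) (hYr : ∀ l, r ≤ ‖Y l‖) : ¬ LebesgueProperty E := by
  intro h
  have h1 := h _ hY.riemannIntegrable
  rw [MeasureTheory.ae_restrict_iff' measurableSet_Icc] at h1
  have h2 : ∀ᵐ t ∂(MeasureTheory.volume : MeasureTheory.Measure ℝ), t ∉ Set.Icc (0 : ℝ) 1 :=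
    h1.mono fun t ht hmem => not_continuousWithinAt_treeFun hr hYr hmem (ht hmem)
  have h3 : MeasureTheory.volume (Set.Icc (0 : ℝ) 1) = 0 := by
    refine MeasureTheory.measure_mono_null (fun t ht => ?_) (MeasureTheory.ae_iff.1 h2)
    exact not_not.2 ht
  simp at h3

end Riemann

/-! ### Transfer of the tree to subspaces and conclusion -/

theorem not_lebesgueProperty_of_not_finiteDimensional {Z : Submodule ℝ (XD P)}
    (hZ : ¬ FiniteDimensional ℝ Z) : ¬ LebesgueProperty Z := by
  obtain ⟨u, hu, S, hS⟩ := exists_isBlockSeq_embedding hZ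
  obtain ⟨y, w, hy, hyu⟩ := exists_isExactTree hu
  choose b hb using fun l => (Finsupp.mem_span_range_iff_exists_finsupp).1 (hyu l)
  have hb' : ∀ l, Finsupp.linearCombination ℝ u (b l) = y l := hb
  -- The constant 6 is the upper constant 3 of the tree times the bound 2 of the embedding; the
  -- embedding also keeps the norms at least `1 / 2`.
  have hY : IsUpperC0Tree 6 fun l => S (b l) := by
    intro N μ hμ a M ha
    have h1 : ∑ l, a l • S (b (μ l)) = S (∑ l, a l • b (μ l)) := by
      rw [map_sum]
      exact Finset.sum_congr rfl fun l _ => (map_smul S _ _).symm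
    have h2 : Finsupp.linearCombination ℝ u (∑ l, a l • b (μ l)) = ∑ l, a l • y (μ l) := by
      rw [map_sum]
      exact Finset.sum_congr rfl fun l _ => by rw [map_smul, hb']
    have h3 := (hS (∑ l, a l • b (μ l))).2
    rw [h2] at h3
    have h4 := hy.norm_sum_le hμ ha
    change ‖∑ l, a l • S (b (μ l))‖ ≤ 6 * M
    rw [h1]
    linarith
  refine hY.not_lebesgueProperty (r := 1 / 2) (by norm_num) fun l => ?_
  have h1 := (hS (b l)).1
  rw [hb', hy.norm_eq] at h1
  linarith

theorem exists_tree_of_isBlockSubspace {Y : Submodule ℝ (XD P)} (hY : IsBlockSubspace Y) :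
    ∃ (y : Node → C00 P) (w : Node → ℕ+), IsExactTree y w ∧ ∀ l, ((y l : C00 P) : XD P) ∈ Y := by
  obtain ⟨x, h0, hx, rfl⟩ := hY
  obtain ⟨y, w, hy, hyx⟩ := exists_isExactTree
    (isBlockSeq_of_succ (fun k h => h0 k (C00.coords_eq_zero.1 h)) hx)
  refine ⟨y, w, hy, fun l => Submodule.le_topologicalClosure _ ?_⟩
  obtain ⟨b, hb⟩ := (Finsupp.mem_span_range_iff_exists_finsupp).1 (hyx l)
  have hb' : Finsupp.linearCombination ℝ x b = y l := hb
  rw [← hb', coe_linearCombination]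
  exact Finsupp.mem_span_range_iff_exists_finsupp.2 ⟨b, rfl⟩

end

end XDSpace

theorem mainTheorem1 (P : Params) :
    (∀ Y : Submodule ℝ (XD P), IsBlockSubspace Y →
      ∃ y : Node → C00 P,
        (∀ l, ((y l : C00 P) : XD P) ∈ Y) ∧
        (∀ l, ‖((y l : C00 P) : XD P)‖ = 1) ∧
        (∀ l l', Node.LexLT l l' → Before (y l).coords (y l').coords) ∧
        ∀ (N : ℕ) (μ : (Fin N → Bool) → Node), (∀ l, Node.ofFn l ≤ μ l) →
          ∀ a : (Fin N → Bool) → ℝ,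
            (⨆ l, |a l|) ≤ ‖∑ l, a l • ((y (μ l) : C00 P) : XD P)‖ ∧
            ‖∑ l, a l • ((y (μ l) : C00 P) : XD P)‖ ≤ 3 * ⨆ l, |a l|) ∧
    ∀ Z : Submodule ℝ (XD P), IsClosed (Z : Set (XD P)) → ¬ FiniteDimensional ℝ Z →
      ¬ LebesgueProperty Z := by
  refine ⟨fun Y hY => ?_, fun Z _ hZ => not_lebesgueProperty_of_not_finiteDimensional hZ⟩
  obtain ⟨y, w, hy, hyY⟩ := exists_tree_of_isBlockSubspace hY
  refine ⟨y, hyY, fun l => (UniformSpace.Completion.norm_coe _).trans (hy.norm_eq l),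
    fun l l' h => hy.before l l' (num_lt_of_lexLT h), fun N μ hμ a => ?_⟩
  have hcoe : ‖∑ l, a l • ((y (μ l) : C00 P) : XD P)‖ = ‖∑ l, a l • y (μ l)‖ := by
    rw [← UniformSpace.Completion.norm_coe (∑ l, a l • y (μ l))]
    have := map_sum (UniformSpace.Completion.toComplL : C00 P →L[ℝ] XD P)
      (fun l => a l • y (μ l)) Finset.univ
    simp only [map_smul] at this
    exact congrArg _ this.symm
  rw [hcoe]
  exact ⟨ciSup_le (hy.abs_le_norm hμ a),
    hy.norm_sum_le hμ fun l => le_ciSup (f := fun l => |a l|) (Set.finite_range _).bddAbove l⟩
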